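/- **Theorem (Total complexity result I).** Let $d,m\ge 1$, $n\ge 0$, and consider $$\min_{x\in\mathbb R^d} F(x):=f(x)+h(x)\quad\text{s.t. } Ax=b,\ g_i(x)\le 0\ (i=1,\dots,m),\qquad \mathcal X:=\mathrm{dom}(F).$$ *Assumptions.* $\mathcal X$ is compact with diameter $D$; $h$ is closed convex with domain $\mathcal X$, $F$ is continuous on $\mathcal X$; $f$ is $\rho$-weakly convex on $\mathcal X$ ($\rho>0$) and $L_f$-smooth on an open set containing $\mathcal X$; the $g_i$ are convex on $\mathbb R^d$ and $L_g$-smooth on an open set containing $\mathcal X$; there is $x_{\rm feas}\in\mathrm{int}(\mathcal X)$ with $Ax_{\rm feas}=b$ and $g_{\min}:=\min_i -g_i(x_{\rm feas})>0$; there is $r_h>0$ such that, for all $x\in\mathcal X$, $\emptyset\neq\partial h(x)\subseteq\mathcal N_{\mathcal X}(x)+\{\|\xi\|\le r_h\}$. Let $\|\nabla f\|\le B_f$ and $\max\{|g_i|,\|\nabla g_i\|\}\le B_g$ on $\mathcal X$. Norms are Euclidean / spectral, $[\cdot]_+$ is the componentwise positive part, $\mathrm{dist}(0,\emptyset)=+\infty$,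 $\partial F(x)=\partial(F+\frac\rho2\|\cdot\|^2)(x)-\rho x$. A point $x\in\mathcal X$ is an $\varepsilon$-KKT point if for some $y\in\mathbb R^n$, $z\in\mathbb R^m_+$ the three quantities $\mathrm{dist}(0,\partial F(x)+\sum_i z_i\nabla g_i(x)+A^\top y)$, $\sqrt{\|Ax-b\|^2+\|[g(x)]_+\|^2}$, $\sum_i|z_ig_i(x)|$ are all at most $\varepsilon$. *Method (DPALM).* Given $x^0\in\mathcal X$, $y^0\in\mathrm{Range}(A)$, $z^0\ge0$, $\beta_0,v_0>0$ and $\varepsilon>0$, set $\beta_k=\beta_0\sqrt{k+1}$ for $k\ge0$, $v_k=v_0/(\sqrt{k+1}\log^2(k+1))$ for $k\ge 1$, and $\varepsilon_k=\min\{\varepsilon/8,\sqrt{\rho/(2\beta_k)},1\}$. With $$\mathcal L_\beta(x;y,z)=F(x)+y^\top(Ax-b)+\tfrac\beta2\|Ax-b\|^2+\tfrac\beta2\|[g(x)+z/\beta]_+\|^2-\tfrac{\|z\|^2}{2\beta},$$ the $k$-th outer iteration applies the accelerated proximal gradient method below to $\phi=\tilde f+\tilde h$, where $\tilde f=\mathcal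 L_{\beta_k}(\cdot;y^k,z^k)+\frac\rho2\|\cdot-x^k\|^2-h$ and $\tilde h=h+\frac\rho2\|\cdot-x^k\|^2$, until it returns $x^{k+1}$ with $\mathrm{dist}(0,\partial\phi(x^{k+1}))\le\varepsilon_k$; then $y^{k+1}=y^k+\alpha_k(Ax^{k+1}-b)$, $z^{k+1}=z^k+\alpha_k\max\{-z^k/\beta_k,g(x^{k+1})\}$ with $\alpha_k=\min\{\beta_k,\ v_k/\sqrt{\|Ax^{k+1}-b\|^2+\|[g(x^{k+1})]_+\|^2}\}$ (where $v/0=+\infty$). *Subroutine (Nesterov's APG with line search).* Parameters: $\mu=\rho$, $\gamma_u=2\le\gamma_d$, a starting point $u^0\in\mathcal X$ and $L_0>0$ (both may depend on $k$). Let $M_L(y)=\mathrm{prox}_{\tilde h/L}(y-\frac1L\nabla\tilde f(y))$ and $\phi'(M_L(y))=L(y-M_L(y))+\nabla\tilde f(M_L(y))-\nabla\tilde f(y)$. Start with $A_0=0$, $w^0=u^0$, $L=L_0$. Iteration $t\ge0$: for the current $L$ compute $a>0$ with $\frac{a^2}{A_t+a}=2\frac{1+\mu A_t}{L}$ and $y=\frac{A_tu^t+aw^t}{A_t+a}$;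 if $\langle\phi'(M_L(y)),y-M_L(y)\rangle<\frac1L\|\phi'(M_L(y))\|^2$, replace $L$ by $\gamma_uL$ and repeat. Otherwise set $u^{t+1}=M_L(y)$, $a_{t+1}=a$, $A_{t+1}=A_t+a$, $w^{t+1}=\mathrm{prox}_{A_{t+1}\tilde h}(u^0-\sum_{i\le t+1}a_i\nabla\tilde f(u^i))$, replace $L$ by $L/\gamma_d$, and stop with output $u^{t+1}$ if $\mathrm{dist}(0,\partial\phi(u^{t+1}))\le\varepsilon_k$. Each iteration $t$ is one (accepted) proximal gradient step. *Constants.* With $\mathrm{dist}_{\rm bd}=\mathrm{dist}(x_{\rm feas},\mathrm{bd}\,\mathcal X)$, put $\tau=\min\{\frac{g_{\min}}{2\sqrt mB_g},\mathrm{dist}_{\rm bd}\}$, $\overline B=D(r_h+B_f)+2\rho D^2+D+\tau(1+r_h+B_f+2\rho D)$, $\theta=\overline B/\min\{\tau\sqrt{\lambda^+_{\min}(AA^\top)},\frac{g_{\min}}2\}$ with $\lambda^+_{\min}$ the smallest positive eigenvalue ($\theta=2\overline B/g_{\min}$ if $A=0$), $B_p=\max\{\|(y^0,z^0)\|,\theta\}$,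 $Q=D(B_f+2\rho D+r_h)$, $C_1=\frac1D+\frac1{\mathrm{dist}_{\rm bd}}+\frac{B_g}{g_{\min}}$, $C_p=4\big(B_p+\sqrt{Q^2/g_{\min}^2+Q^2\|(AA^\top)^\dagger A\|^2C_1^2}\big)+2$, $$C_x=2\max_{\mathcal X}|F|+\tfrac{14C_p^2+8B_pC_p+7B_p^2}{4\beta_0}+(10C_p+4B_p)\tfrac{v_0}{\beta_0}+\tfrac{\beta_0}2\Big(\|Ax^0-b\|^2+\big\|[g(x^0)+\tfrac{z^0}{\beta_0}]_+\big\|^2\Big)+|\langle y^0,Ax^0-b\rangle|,$$ $C_2=\|A^\top A\|+mB_g(B_g+L_g)$, $C_3=L_f+\rho+\sqrt m\,L_gB_p$, $K_1=\big\lceil\max\{\frac{C_p^2}{\beta_0^2\varepsilon^2},\frac{(4B_p+5C_p^2)^2}{16\beta_0^2\varepsilon^2}\}\big\rceil$, $K_2=\lceil5C_x\rho\varepsilon^{-2}\rceil$, $K=K_1+K_2$. Assume the line search is started with $0<L_0\le\gamma_u(C_3+\sqrt{k+1}\,\beta_0C_2)$ in the $k$-th outer iteration. *Conclusions.* 1.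 For every $\varepsilon>0$, all line searches and all calls of the subroutine terminate, for some $k<K$ the point $x^{k+1}$ is an $\varepsilon$-KKT point, and the total number $T_1^{\rm total}$ of proximal gradient steps in the first $K$ outer iterations satisfies $$T_1^{\rm total}\le \mathcal T(\varepsilon):=2K+K\Big(2\sqrt{\tfrac{C_3}\rho}+2\sqrt{\tfrac{\sqrt K\beta_0C_2}\rho}+\tfrac1{\log2}\Big)\log^+\!\Big(9\varepsilon_K^{-1}D\sqrt{\tfrac1\rho}\,(C_3+\sqrt K\beta_0C_2)^{3/2}\Big),$$ where $\log^+=\max\{\log,0\}$. 2. There is $C$ independent of $\varepsilon$ with $\mathcal T(\varepsilon)\le C\varepsilon^{-5/2}\log(1/\varepsilon)$ for all $0<\varepsilon\le\frac12$. If $\gamma_d$ is fixed and all $L_0$ are bounded below by a fixed positive number, then a bound of this form (with $C$ independent of $\varepsilon$, of the starting points and of the values $L_0$) also holds for the total number of trial proximal gradient steps, including those rejected by the line searches. 3. (Dependence on $\rho$.) Let $\rho$ range over all values $\ge\rho_0$, where $f$ is $\rho_0$-weakly convex and $\rho_0>0$, everything else except $\beta_0$ being fixed. For each such $\rho$ there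 is $\beta_0>0$ with $\beta_0=R$, where $R:=(B_p+C_p+C_p^2)/\sqrt{C_x\rho}$ ($C_x$ itself depends on $\beta_0$). For all $0<\kappa_1\le\kappa_2$ there is $C$ such that for all $\rho\ge\rho_0$, all $\beta_0>0$ with $\kappa_1R\le\beta_0\le\kappa_2R$ and all $0<\varepsilon\le\frac12$: $\ \mathcal T(\varepsilon)\le C\sqrt\rho\,(1+\rho^3)\,\varepsilon^{-5/2}\log(1/\varepsilon)$. -/

import Mathlib

open scoped Matrix.Norms.L2Operator RealInnerProductSpace

noncomputable section

namespace DPALM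

/-- `ℝ^k` with the Euclidean norm. -/
abbrev Vec (k : ℕ) := EuclideanSpace ℝ (Fin k)

/-! ## Convex analysis -/

section Convex

variable {d : ℕ}

/-- `dist(0, S) ≤ r`, with the convention `dist(0, ∅) = ∞`. -/
def DistZeroLE (S : Set (Vec d)) (r : ℝ) : Prop :=
  Metric.infEDist (0 : Vec d) S ≤ ENNReal.ofReal r

/-- Subdifferential at `x ∈ X` of the convex function that equals `φ` on `X` and `+∞` off `X`. -/
def subdiff (X : Set (Vec d)) (φ : Vec d → ℝ) (x : Vec d) : Set (Vec d) :=
  {ξ | ∀ x' ∈ X, ⟪ξ, x' - x⟫ ≤ φ x' - φ x}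

/-- Subdifferential of a `ρ`-weakly convex function with domain `X`:
`∂φ(x) = ∂(φ + ρ/2 ‖·‖²)(x) - ρ x`. -/
def weakSubdiff (ρ : ℝ) (X : Set (Vec d)) (φ : Vec d → ℝ) (x : Vec d) : Set (Vec d) :=
  {ξ | ξ + ρ • x ∈ subdiff X (fun u => φ u + ρ / 2 * ‖u‖ ^ 2) x}

/-- Normal cone of `X` at `x`. -/
def normalCone (X : Set (Vec d)) (x : Vec d) : Set (Vec d) :=
  {ξ | ∀ x' ∈ X, ⟪ξ, x' - x⟫ ≤ 0}

/-- `φ` is `ρ`-weakly convex on `X`. -/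
def WeaklyConvexOn (ρ : ℝ) (X : Set (Vec d)) (φ : Vec d → ℝ) : Prop :=
  ConvexOn ℝ X (fun u => φ u + ρ / 2 * ‖u‖ ^ 2)

/-- `φ` is `L`-smooth on the set `U` (used for open `U`). -/
def SmoothOn (L : ℝ) (U : Set (Vec d)) (φ : Vec d → ℝ) : Prop :=
  (∀ x ∈ U, DifferentiableAt ℝ φ x) ∧
    ∀ x ∈ U, ∀ y ∈ U, ‖gradient φ x - gradient φ y‖ ≤ L * ‖x - y‖

/-- A minimizer of `φ` over `X` (arbitrary if there is none). -/
def argminOver (X : Set (Vec d)) (φ : Vec d → ℝ) : Vec d :=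
  Classical.epsilon fun x => x ∈ X ∧ ∀ u ∈ X, φ x ≤ φ u

/-- `prox_{η φ}(u)` for `φ` with domain `X`. -/
def prox (X : Set (Vec d)) (φ : Vec d → ℝ) (η : ℝ) (u : Vec d) : Vec d :=
  argminOver X (fun x => η * φ x + 1 / 2 * ‖x - u‖ ^ 2)

/-- Componentwise positive part. -/
def posVec (a : Vec d) : Vec d := WithLp.toLp 2 (fun i => max (a i) 0)

end Convex

/-! ## Matrices -/

/-- The four Penrose equations. -/
structure IsMoorePenrose {p q : ℕ} (M : Matrix (Fin p) (Fin q) ℝ)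
    (N : Matrix (Fin q) (Fin p) ℝ) : Prop where
  mul_mul_left : M * N * M = M
  mul_mul_right : N * M * N = N
  symm_left : (M * N).transpose = M * N
  symm_right : (N * M).transpose = N * M

/-- The Moore–Penrose inverse `M†`. -/
def pinv {p q : ℕ} (M : Matrix (Fin p) (Fin q) ℝ) : Matrix (Fin q) (Fin p) ℝ :=
  Classical.epsilon (IsMoorePenrose M)

open Matrix in
/-- Symmetric matrices, the only ones used below, have a Moore–Penrose inverse. -/
theorem isMoorePenrose_pinv {p : ℕ} {M : Matrix (Fin p) (Fin p) ℝ} (hM : M.IsHermitian) :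
    IsMoorePenrose M (pinv M) := by
  refine Classical.epsilon_spec (p := IsMoorePenrose M) ?_
  obtain ⟨U, D, h1, h2⟩ : ∃ (U : Matrix (Fin p) (Fin p) ℝ) (D : Fin p → ℝ),
      Uᵀ * U = 1 ∧ M = U * diagonal D * Uᵀ := by
    refine ⟨hM.eigenvectorUnitary, hM.eigenvalues, ?_, ?_⟩
    · have := (Matrix.mem_unitaryGroup_iff').1 hM.eigenvectorUnitary.2
      simpa [star_eq_conjTranspose] using this
    · have := hM.spectral_theorem
      simpa [Unitary.conjStarAlgAut_apply, star_eq_conjTranspose, Function.comp_def] using this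
  have key : ∀ a b : Fin p → ℝ, U * diagonal a * Uᵀ * (U * diagonal b * Uᵀ)
      = U * diagonal (fun i => a i * b i) * Uᵀ := by
    intro a b
    calc U * diagonal a * Uᵀ * (U * diagonal b * Uᵀ)
        = U * diagonal a * (Uᵀ * U) * diagonal b * Uᵀ := by simp only [Matrix.mul_assoc]
      _ = _ := by rw [h1, Matrix.mul_one, Matrix.mul_assoc U, diagonal_mul_diagonal]
  have sy : ∀ a : Fin p → ℝ, (U * diagonal a * Uᵀ)ᵀ = U * diagonal a * Uᵀ := by
    intro a
    simp [Matrix.transpose_mul, Matrix.mul_assoc]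
  refine ⟨U * diagonal (fun i => (D i)⁻¹) * Uᵀ, ?_, ?_, ?_, ?_⟩ <;> subst h2
  · simp only [key, mul_inv_mul_cancel]
  · have hD : (fun i => (D i)⁻¹ * D i * (D i)⁻¹) = fun i => (D i)⁻¹ := by
      funext i
      by_cases h : D i = 0 <;> simp [h]
    rw [key, key, hD]
  · simp only [key, sy]
  · simp only [key, sy]

open Matrix in
/-- The Moore–Penrose inverse is unique. -/
theorem isMoorePenrose_unique {p q : ℕ} {M : Matrix (Fin p) (Fin q) ℝ}
    {N N' : Matrix (Fin q) (Fin p) ℝ} (h : IsMoorePenrose M N) (h' : IsMoorePenrose M N') :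
    N = N' := by
  have e1 : M * N = M * N' := by
    calc M * N = (M * N)ᵀ := h.symm_left.symm
      _ = (M * N' * (M * N))ᵀ := by rw [← Matrix.mul_assoc, h'.mul_mul_left]
      _ = (M * N)ᵀ * (M * N')ᵀ := by rw [Matrix.transpose_mul]
      _ = M * N * (M * N') := by rw [h.symm_left, h'.symm_left]
      _ = M * N' := by rw [← Matrix.mul_assoc, h.mul_mul_left]
  have e2 : N * M = N' * M := by
    calc N * M = (N * M)ᵀ := h.symm_right.symm
      _ = (N * M * (N' * M))ᵀ := by
          rw [Matrix.mul_assoc N, ← Matrix.mul_assoc M, h'.mul_mul_left]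
      _ = (N' * M)ᵀ * (N * M)ᵀ := by rw [Matrix.transpose_mul]
      _ = N' * M * (N * M) := by rw [h.symm_right, h'.symm_right]
      _ = N' * M := by rw [Matrix.mul_assoc N', ← Matrix.mul_assoc M, h.mul_mul_left]
  calc N = N * M * N := h.mul_mul_right.symm
    _ = N' * (M * N) := by rw [e2, Matrix.mul_assoc]
    _ = N' * M * N' := by rw [e1, Matrix.mul_assoc]
    _ = N' := h'.mul_mul_right

/-- Smallest positive eigenvalue of `M`. -/
def lambdaMinPos {p : ℕ} (M : Matrix (Fin p) (Fin p) ℝ) : ℝ :=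
  sInf {μ : ℝ | 0 < μ ∧ Module.End.HasEigenvalue (Matrix.toLin' M) μ}

/-- The vector `M x`. -/
def app {p q : ℕ} (M : Matrix (Fin p) (Fin q) ℝ) (x : Vec q) : Vec p :=
  Matrix.toEuclideanLin M x

/-! ## Nesterov's accelerated proximal gradient method with line search

The method for `min_{x ∈ X} ft(x) + ht(x)`; `ht` has domain `X` and is `μ`-strongly convex. -/

section APG

variable {d : ℕ}

/-- The data of the method: the composite problem, the starting point `start = x⁰`, the initial
estimate `L0` of the Lipschitz constant, the line search factors `γu`, `γd`, and the stopping
tolerance `Δ`. -/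
structure APGData (d : ℕ) where
  X : Set (Vec d)
  ft : Vec d → ℝ
  ht : Vec d → ℝ
  μ : ℝ
  start : Vec d
  L0 : ℝ
  γu : ℝ
  γd : ℝ
  Δ : ℝ

/-- The state after `t` iterations: `x = xᵗ`, `v = vᵗ`, `A = A_t`, `L` is the first trial value
for the next line search, and `G = ∑_{i=1}^t a_i ∇ft(xⁱ)`. -/
structure APGState (d : ℕ) where
  x : Vec d
  v : Vec d
  A : ℝ
  L : ℝ
  G : Vec d

namespace APGData

variable (D : APGData d)

/-- The proximal gradient step `M_L(y) = prox_{ht/L}(y - ∇ft(y)/L)`. -/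
def proxGrad (L : ℝ) (y : Vec d) : Vec d :=
  prox D.X D.ht (1 / L) (y - (1 / L) • gradient D.ft y)

/-- `φ'(M_L(y)) = L (y - M_L(y)) + ∇ft(M_L(y)) - ∇ft(y)`. -/
def compGrad (L : ℝ) (y : Vec d) : Vec d :=
  L • (y - D.proxGrad L y) + gradient D.ft (D.proxGrad L y) - gradient D.ft y

/-- The positive root `a` of `a² / (A + a) = 2 (1 + μ A) / L`. -/
def coef (A L : ℝ) : ℝ :=
  (1 + D.μ * A) / L + √(((1 + D.μ * A) / L) ^ 2 + 2 * ((1 + D.μ * A) / L) * A)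

theorem coef_spec {A L : ℝ} (hμ : 0 ≤ D.μ) (hA : 0 ≤ A) (hL : 0 < L) :
    0 < D.coef A L ∧ D.coef A L ^ 2 / (A + D.coef A L) = 2 * (1 + D.μ * A) / L := by
  have he : 0 < (1 + D.μ * A) / L := by positivity
  obtain ⟨e, hee⟩ : ∃ e, e = (1 + D.μ * A) / L := ⟨_, rfl⟩
  have h2 : 2 * (1 + D.μ * A) / L = 2 * e := by rw [hee]; ring
  rw [h2]
  unfold coef
  rw [← hee] at he ⊢
  have hs : √(e ^ 2 + 2 * e * A) ^ 2 = e ^ 2 + 2 * e * A := Real.sq_sqrt (by positivity)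
  have hpos : 0 < e + √(e ^ 2 + 2 * e * A) := by positivity
  refine ⟨hpos, ?_⟩
  rw [div_eq_iff (by positivity)]
  nlinarith [hs]

/-- The extrapolated point `y = (A x + a v) / (A + a)` for the trial value `L`. -/
def extrap (s : APGState d) (L : ℝ) : Vec d :=
  (1 / (s.A + D.coef s.A L)) • (s.A • s.x + D.coef s.A L • s.v)

/-- The line search accepts the trial value `L`. -/
def Accepts (s : APGState d) (L : ℝ) : Prop :=
  1 / L * ‖D.compGrad L (D.extrap s L)‖ ^ 2 ≤
    ⟪D.compGrad L (D.extrap s L), D.extrap s L - D.proxGrad L (D.extrap s L)⟫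

/-- The line search finds an acceptable value among `L, L γu, L γu², …`. -/
def LineSearchTerminates (s : APGState d) : Prop :=
  ∃ j : ℕ, D.Accepts s (s.L * D.γu ^ j)

/-- Number of trial values that the line search rejects. -/
def rejected (s : APGState d) : ℕ :=
  sInf {j : ℕ | D.Accepts s (s.L * D.γu ^ j)}

/-- The accepted value `L_{t+1}`. -/
def accepted (s : APGState d) : ℝ := s.L * D.γu ^ D.rejected s

/-- One iteration (one accepted proximal gradient step). -/
def step (s : APGState d) : APGState d :=
  let L := D.accepted s
  let a := D.coef s.A L
  let x := D.proxGrad L (D.extrap s L)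
  let G := s.G + a • gradient D.ft x
  { x := x
    v := prox D.X D.ht (s.A + a) (D.start - G)
    A := s.A + a
    L := L / D.γd
    G := G }

/-- The state after `t` iterations. -/
def iter : ℕ → APGState d
  | 0 => { x := D.start, v := D.start, A := 0, L := D.L0, G := 0 }
  | t + 1 => D.step (iter t)

/-- The stopping test `dist(0, ∂(ft + ht)(xᵗ)) ≤ Δ` holds after `t` iterations. -/
def Stops (t : ℕ) : Prop :=
  DistZeroLE (subdiff D.X (fun u => D.ft u + D.ht u) (D.iter t).x) D.Δ

/-- Number of iterations performed: the test is made after each iteration. -/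
def numIter : ℕ := sInf {t : ℕ | 1 ≤ t ∧ D.Stops t}

/-- The method stops: the test is eventually met and each line search before that is finite. -/
def Terminates : Prop :=
  (∃ t : ℕ, 1 ≤ t ∧ D.Stops t) ∧ ∀ t < D.numIter, D.LineSearchTerminates (D.iter t)

/-- The output point. -/
def output : Vec d := (D.iter D.numIter).x

/-- Number of trial proximal gradient steps, accepted or rejected, over all line searches. Each
costs one proximal mapping and two gradients of `ft`. -/
def numTrials : ℕ := ∑ t ∈ Finset.range D.numIter, (D.rejected (D.iter t) + 1)

end APGData

end APG

/-! ## The problem and the method -/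

section Problem

variable {d n m : ℕ}

/-- `min f(x) + h(x)` subject to `A x = b`, `g_i(x) ≤ 0`. Here `X = dom(f + h)`, and `h` is `+∞`
off `X`; the value of the Lean function `h` off `X` is never used. -/
structure Problem (d n m : ℕ) where
  A : Matrix (Fin n) (Fin d) ℝ
  b : Vec n
  f : Vec d → ℝ
  h : Vec d → ℝ
  g : Fin m → Vec d → ℝ
  X : Set (Vec d)

/-- Constants that describe the problem, and a Slater point `xfeas`. -/
structure Constants (d : ℕ) where
  ρ : ℝ
  Lf : ℝ
  Lg : ℝ
  Bf : ℝ
  Bg : ℝ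
  rh : ℝ
  xfeas : Vec d

/-- Initial iterates and the parameters `β₀`, `v₀` of the method. -/
structure Setup (d n m : ℕ) where
  x0 : Vec d
  y0 : Vec n
  z0 : Vec m
  β0 : ℝ
  v0 : ℝ

namespace Problem

variable (P : Problem d n m)

/-- The objective `F = f + h`. -/
def F (x : Vec d) : ℝ := P.f x + P.h x

/-- The residual `A x - b`. -/
def res (x : Vec d) : Vec n := app P.A x - P.b

/-- The vector `g(x)`. -/
def gvec (x : Vec d) : Vec m := WithLp.toLp 2 (fun i => P.g i x)

/-- Violation `√(‖A x - b‖² + ‖[g(x)]₊‖²)` of the constraints. -/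
def infeas (x : Vec d) : ℝ := √(‖P.res x‖ ^ 2 + ‖posVec (P.gvec x)‖ ^ 2)

/-- `x` is an `ε`-KKT point; `ρ` is a weak convexity constant of `F`. -/
def IsKKT (ρ ε : ℝ) (x : Vec d) : Prop :=
  x ∈ P.X ∧ ∃ (y : Vec n) (z : Vec m), (∀ i, 0 ≤ z i) ∧
    DistZeroLE ((fun ξ => ξ + ∑ i, z i • gradient (P.g i) x + app P.A.transpose y) ''
      weakSubdiff ρ P.X P.F x) ε ∧
    P.infeas x ≤ ε ∧
    ∑ i, |z i * P.g i x| ≤ ε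

/-- The augmented Lagrangian without the term `h`. -/
def smoothAL (β : ℝ) (y : Vec n) (z : Vec m) (x : Vec d) : ℝ :=
  P.f x + ⟪y, P.res x⟫ + β / 2 * ‖P.res x‖ ^ 2
    + β / 2 * ‖posVec (P.gvec x + (1 / β) • z)‖ ^ 2 - ‖z‖ ^ 2 / (2 * β)

/-- The standing assumptions. -/
structure Assumptions (c : Constants d) : Prop where
  compact : IsCompact P.X
  rho_pos : 0 < c.ρ
  weaklyConvex : WeaklyConvexOn c.ρ P.X P.f
  h_convex : ConvexOn ℝ P.X P.h
  h_closed : IsClosed {p : Vec d × ℝ | p.1 ∈ P.X ∧ P.h p.1 ≤ p.2}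
  F_cont : ContinuousOn P.F P.X
  g_convex : ∀ i, ConvexOn ℝ Set.univ (P.g i)
  g_smooth : ∃ U : Set (Vec d), IsOpen U ∧ P.X ⊆ U ∧ ∀ i, SmoothOn c.Lg U (P.g i)
  f_smooth : ∃ U : Set (Vec d), IsOpen U ∧ P.X ⊆ U ∧ SmoothOn c.Lf U P.f
  slater_mem : c.xfeas ∈ interior P.X
  slater_eq : app P.A c.xfeas = P.b
  slater_lt : ∀ i, P.g i c.xfeas < 0
  rh_pos : 0 < c.rh
  h_subdiff : ∀ x ∈ P.X, ∀ ξ ∈ subdiff P.X P.h x,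
    ∃ ξ₁ ∈ normalCone P.X x, ∃ ξ₂, ‖ξ₂‖ ≤ c.rh ∧ ξ = ξ₁ + ξ₂
  h_subdiff_nonempty : ∀ x ∈ P.X, (subdiff P.X P.h x).Nonempty
  Bf_bound : ∀ x ∈ P.X, ‖gradient P.f x‖ ≤ c.Bf
  Bg_bound : ∀ x ∈ P.X, ∀ i, |P.g i x| ≤ c.Bg ∧ ‖gradient (P.g i) x‖ ≤ c.Bg

/-! ### The constants in the complexity bound -/

variable (c : Constants d) (s : Setup d n m)

/-- Diameter `D` of `X`. -/
def diam : ℝ := Metric.diam P.X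

/-- `g_min = min_i -g_i(xfeas)`. -/
def gmin : ℝ := ⨅ i, -P.g i c.xfeas

/-- `dist(xfeas, bd X)`. -/
def distBd : ℝ := Metric.infDist c.xfeas (frontier P.X)

def tau : ℝ := min (P.gmin c / (2 * √m * c.Bg)) (P.distBd c)

def Bbar : ℝ :=
  P.diam * (c.rh + c.Bf) + 2 * c.ρ * P.diam ^ 2 + P.diam
    + P.tau c * (1 + c.rh + c.Bf + 2 * c.ρ * P.diam)

open Classical in
/-- The denominator of `θ`. If `A = 0`, then `A Aᵀ` has no positive eigenvalue and the first
member of the minimum is dropped (`min ∅ = +∞`). -/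
def thetaDen : ℝ :=
  if P.A = 0 then P.gmin c / 2
  else min (P.tau c * √(lambdaMinPos (P.A * P.A.transpose))) (P.gmin c / 2)

def theta : ℝ := P.Bbar c / P.thetaDen c

/-- The bound on the multipliers. -/
def Bp : ℝ := max (√(‖s.y0‖ ^ 2 + ‖s.z0‖ ^ 2)) (P.theta c)

def Q : ℝ := P.diam * (c.Bf + 2 * c.ρ * P.diam + c.rh)

def C1 : ℝ := 1 / P.diam + 1 / P.distBd c + c.Bg / P.gmin c

def Chatp : ℝ :=
  2 * (P.Bp c s + √(P.Q c ^ 2 / P.gmin c ^ 2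
    + P.Q c ^ 2 * ‖pinv (P.A * P.A.transpose) * P.A‖ ^ 2 * P.C1 c ^ 2)) + 1

/-- The constant of primal feasibility. -/
def Cp : ℝ := 2 * P.Chatp c s

/-- The bound on the cumulative decrease of the augmented Lagrangian. -/
def Cx : ℝ :=
  2 * sSup ((fun x => |P.F x|) '' P.X)
    + 1 / (4 * s.β0) * (14 * P.Cp c s ^ 2 + 8 * P.Bp c s * P.Cp c s + 7 * P.Bp c s ^ 2)
    + (10 * P.Cp c s + 4 * P.Bp c s) * (s.v0 / s.β0)
    + s.β0 / 2 * (‖P.res s.x0‖ ^ 2 + ‖posVec (P.gvec s.x0 + (1 / s.β0) • s.z0)‖ ^ 2)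
    + |⟪s.y0, P.res s.x0⟫|

def C2 : ℝ := ‖P.A.transpose * P.A‖ + m * c.Bg * (c.Bg + c.Lg)

def C3 : ℝ := c.Lf + c.ρ + √m * c.Lg * P.Bp c s

/-- The smoothness constant of the smooth part of the `k`-th subproblem. -/
def subLip (k : ℕ) : ℝ := P.C3 c s + √(k + 1) * s.β0 * P.C2 c

def K1 (ε : ℝ) : ℕ :=
  ⌈max (P.Cp c s ^ 2 / (s.β0 ^ 2 * ε ^ 2))
    ((4 * P.Bp c s + 5 * P.Cp c s ^ 2) ^ 2 / (16 * s.β0 ^ 2 * ε ^ 2))⌉₊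

def K2 (ε : ℝ) : ℕ := ⌈5 * P.Cx c s * c.ρ / ε ^ 2⌉₊

/-- Number of outer iterations. -/
def K (ε : ℝ) : ℕ := P.K1 c s ε + P.K2 c s ε

end Problem

/-- Penalty parameters `β_k = β₀ √(k+1)`. -/
def Setup.β (s : Setup d n m) (k : ℕ) : ℝ := s.β0 * √(k + 1)

/-- Damping parameters `v_k = v₀ / (√(k+1) (log(k+1))²)` for `k ≥ 1`. -/
def Setup.v (s : Setup d n m) (k : ℕ) : ℝ :=
  if k = 0 then s.v0 else s.v0 / (√(k + 1) * Real.log (k + 1) ^ 2)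

/-- Subproblem tolerances `ε_k = min {ε/8, √(ρ/(2β_k)), 1}`. -/
def tol (c : Constants d) (s : Setup d n m) (ε : ℝ) (k : ℕ) : ℝ :=
  min (ε / 8) (min (√(c.ρ / (2 * s.β k))) 1)

namespace Problem

variable (P : Problem d n m) (c : Constants d) (s : Setup d n m)

/-- The bound on the total number of proximal gradient steps, with `log⁺ = max {log, 0}`. -/
def totalBound (ε : ℝ) : ℝ :=
  2 * P.K c s ε + P.K c s ε *
    (2 * √(P.C3 c s / c.ρ) + 2 * √(√(P.K c s ε) * s.β0 * P.C2 c / c.ρ) + 1 / Real.log 2) *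
    Real.posLog (9 * (tol c s ε (P.K c s ε))⁻¹ * P.diam * √(1 / c.ρ) *
      (P.C3 c s + √(P.K c s ε) * s.β0 * P.C2 c) ^ (3 / 2 : ℝ))

/-! ### The damped proximal augmented Lagrangian method -/

/-- Dual stepsize `min {β_k, v_k / √(‖A x - b‖² + ‖[g(x)]₊‖²)}` with `v / 0 = +∞`. -/
def stepsize (k : ℕ) (x : Vec d) : ℝ :=
  if P.infeas x = 0 then s.β k else min (s.β k) (s.v k / P.infeas x)

end Problem

/-- Free parameters of the subroutine: for the `k`-th subproblem, the starting point `start k` and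
the initial Lipschitz estimate `L0 k`; and the factor `γd`. -/
structure Subroutine (d : ℕ) where
  start : ℕ → Vec d
  L0 : ℕ → ℝ
  γd : ℝ

/-- The iterates `(xᵏ, yᵏ, zᵏ)`. -/
structure State (d n m : ℕ) where
  x : Vec d
  y : Vec n
  z : Vec m

namespace Problem

variable (P : Problem d n m) (c : Constants d) (s : Setup d n m) (r : Subroutine d) (ε : ℝ)

/-- The `k`-th subproblem, from the iterate `w`, as it is passed to the accelerated proximal
gradient method with `γu = 2`: `X` is the domain,
`ft = L_{β_k}(·; y, z) + ρ/2 ‖· - x‖² - h` and `ht = h + ρ/2 ‖· - x‖²`. -/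
def subproblem (k : ℕ) (w : State d n m) : APGData d where
  X := P.X
  ft := fun u => P.smoothAL (s.β k) w.y w.z u + c.ρ / 2 * ‖u - w.x‖ ^ 2
  ht := fun u => P.h u + c.ρ / 2 * ‖u - w.x‖ ^ 2
  μ := c.ρ
  start := r.start k
  L0 := r.L0 k
  γu := 2
  γd := r.γd
  Δ := tol c s ε k

/-- One outer iteration. -/
def outerStep (k : ℕ) (w : State d n m) : State d n m :=
  let x := (P.subproblem c s r ε k w).output
  let α := P.stepsize s k x
  { x := x
    y := w.y + α • P.res x
    z := w.z + α • WithLp.toLp 2 (fun i => max (-(w.z i / s.β k)) (P.g i x)) }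

/-- The iterates of the method. -/
def iterate : ℕ → State d n m
  | 0 => { x := s.x0, y := s.y0, z := s.z0 }
  | k + 1 => P.outerStep c s r ε k (iterate k)

/-- The call of the subroutine in the `k`-th outer iteration. -/
def call (k : ℕ) : APGData d := P.subproblem c s r ε k (P.iterate c s r ε k)

/-- Admissible initialization: `x⁰ ∈ X`, `y⁰ ∈ Range(A)`, `z⁰ ≥ 0`, `β₀, v₀ > 0`. -/
structure ValidSetup : Prop where
  x0_mem : s.x0 ∈ P.X
  y0_mem : ∃ u, s.y0 = app P.A u
  z0_nonneg : ∀ i, 0 ≤ s.z0 i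
  β0_pos : 0 < s.β0
  v0_pos : 0 < s.v0

/-- Admissible subroutine parameters: starting points in `X`, `γd ≥ γu = 2`, and initial estimates
that do not exceed `γu` times the smoothness constant. -/
structure ValidSubroutine : Prop where
  start_mem : ∀ k, r.start k ∈ P.X
  L0_pos : ∀ k, 0 < r.L0 k
  L0_le : ∀ k, r.L0 k ≤ 2 * P.subLip c s k
  γd_ge : 2 ≤ r.γd

end Problem

end Problem

end DPALM

end

open DPALM

namespace DPALM

open Filter Topology Set

/-! ## Convex analysis on a convex set -/

section ConvexAnalysis

variable {d : ℕ} {X : Set (Vec d)}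

/-! The outer analysis rests on one a priori estimate, `multiplier_bound`. At an approximate
stationary point `x` of a subproblem let `ybar = y + β (A x - b)` and `zbar = [z + β g(x)]₊` be the
full-step multipliers; stationarity is then an approximate Lagrange condition for them. Test it
against `x - xfeas`. If the pair has grown in norm, then `⟨ybar, A x - b⟩ + ∑ zbar_i g_i(x) ≥ 0`, so
convexity of the `g_i` and the Slater margin bound `∑ zbar_i` and the normal part of the subgradient
of `h`. The condition itself then bounds `Aᵀ ybar`, and hence `ybar`, which lies in the range of
`A`. So the new pair is either no longer than the old one or of norm at most `θ`. The damped dual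
step is a convex combination of old and full-step multipliers, so the ball of radius `B_p` is never
left.

Feasibility and complementarity follow: `β_k` times the violation is at most the displacement from
`(y, z)` to `(ybar, zbar)`, thus at most `2 B_p`, and `β_k ∑ |zbar_i g_i| ≤ 2 B_p²`. From iteration
`K₁` on both errors are below `ε`. The stationarity residual is `ζ - 2ρ (x^{k+1} - x^k)` with `‖ζ‖ ≤
ε/8`, so one short primal step suffices. Strong convexity makes the merit function drop by `(3ρ/2)
‖Δ‖² - ε_k ‖Δ‖` for a primal step `Δ`. The dual step raises it by `O(v_k/β_k)` and the penalty
update by `O(1/β_k - 1/β_{k+1})`; both are absorbed by telescoping terms in `potential`. The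
potential can fall by at most `C_x`, which excludes `K₂` long steps in a row (`exists_isKKT`).

For the inner cost, Nesterov's estimate functions keep both `u^t` and `w^t` within `D/√(ρ A_t)` of
the minimizer, and `√A_t` grows by the factor `1 + √(ρ/ℓ)/2` in each step, where `ℓ` is the
smoothness constant. Hence the residual decays geometrically (`numIter_le_log`). The line search
accepts every `L ≥ ℓ` by cocoercivity of the gradient, which `cocoercive` proves on `X` itself
because no control is available on a larger convex set.

For the orders, `K` is of size `ε⁻²`, one call costs about `√(√K β₀/ρ)`, which is of size
`ε^{-1/2}`, times a logarithm. Both order statements come from `totalBound_le_of_bounds`, with a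
scale `R`: `R = 1` for a fixed problem, and `R = ρ/ρ₀` for the dependence on `ρ`. In the latter
`B_p`, `C_p` and `C₃` grow at most linearly in `R`, and the balance condition forces `β₀` to be of
order `R` and `C_x` to be at most of that order (`bounds_of_balance`). -/

theorem tendsto_slope_of_hasGradientAt {f : Vec d → ℝ} {v x : Vec d} (hf : HasGradientAt f v x)
    (u : Vec d) : Tendsto (fun t : ℝ => (f (x + t • u) - f x) / t) (𝓝[>] 0) (𝓝 ⟪v, u⟫) := by
  have h1 : HasDerivAt (fun t : ℝ => f (x + t • u)) ⟪v, u⟫ 0 := by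
    have hl : HasDerivAt (fun t : ℝ => x + t • u) u 0 := by
      simpa using ((hasDerivAt_id (0 : ℝ)).smul_const u).const_add x
    have hf' : HasFDerivAt f (InnerProductSpace.toDual ℝ _ v) (x + (0 : ℝ) • u) := by
      simpa using hf.hasFDerivAt
    have h := hf'.comp_hasDerivAt (0 : ℝ) hl
    rwa [InnerProductSpace.toDual_apply_apply] at h
  have h2 := h1.tendsto_slope_zero_right
  simpa [div_eq_inv_mul] using h2

theorem convex_segment_mem {x x' : Vec d} (hX : Convex ℝ X) (hx : x ∈ X) (hx' : x' ∈ X) {t : ℝ}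
    (h0 : 0 ≤ t) (h1 : t ≤ 1) : x + t • (x' - x) ∈ X :=
  hX.add_smul_sub_mem hx hx' ⟨h0, h1⟩

theorem eventually_mem_Ioo_zero_one : ∀ᶠ t : ℝ in 𝓝[>] 0, 0 < t ∧ t < 1 :=
  Ioo_mem_nhdsGT one_pos

theorem gradient_mem_subdiff {f : Vec d → ℝ} {v x : Vec d} (hf : HasGradientAt f v x)
    (hc : ConvexOn ℝ X f) (hx : x ∈ X) : v ∈ subdiff X f x := by
  intro x' hx'
  refine le_of_tendsto (tendsto_slope_of_hasGradientAt hf (x' - x)) ?_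
  filter_upwards [eventually_mem_Ioo_zero_one] with t ht
  have := hc.2 hx hx' (sub_nonneg.2 ht.2.le) ht.1.le (by ring)
  rw [div_le_iff₀ ht.1]
  have e : (1 - t) • x + t • x' = x + t • (x' - x) := by module
  rw [e] at this
  simp only [smul_eq_mul] at this
  linarith

/-- Sum rule: a differentiable term can be removed from a subgradient. -/
theorem subdiff_sub_gradient {f h : Vec d → ℝ} {v x ξ : Vec d} (hf : HasGradientAt f v x)
    (hc : ConvexOn ℝ X h) (hx : x ∈ X) (hξ : ξ ∈ subdiff X (fun u => f u + h u) x) :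
    ξ - v ∈ subdiff X h x := by
  intro x' hx'
  have key : ⟪ξ, x' - x⟫ - (h x' - h x) ≤ ⟪v, x' - x⟫ := by
    refine ge_of_tendsto (tendsto_slope_of_hasGradientAt hf (x' - x)) ?_
    filter_upwards [eventually_mem_Ioo_zero_one] with t ht
    have h1 := hc.2 hx hx' (sub_nonneg.2 ht.2.le) ht.1.le (by ring)
    have e : (1 - t) • x + t • x' = x + t • (x' - x) := by module
    have h2 := hξ _ (convex_segment_mem hc.1 hx hx' ht.1.le ht.2.le)
    rw [e] at h1
    simp only [smul_eq_mul, add_sub_cancel_left, inner_smul_right] at h1 h2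
    rw [le_div_iff₀ ht.1]
    linarith
  rw [inner_sub_left]
  linarith

/-- Quadratic growth of a strongly convex function above a subgradient. -/
theorem subdiff_growth {φ : Vec d → ℝ} {μ : ℝ} (hφ : StrongConvexOn X μ φ) {w x ξ : Vec d}
    (hw : w ∈ X) (hξ : ξ ∈ subdiff X φ w) (hx : x ∈ X) :
    φ w + ⟪ξ, x - w⟫ + μ / 2 * ‖x - w‖ ^ 2 ≤ φ x := by
  -- Strong convexity on the segment from `w` to `x`, combined with the subgradient inequality at `w
  -- + t (x - w)` and divided by `t`, gives the claim with the factor `1 - t`; then `t → 0`.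
  have hl : Tendsto (fun t : ℝ => φ w + ⟪ξ, x - w⟫ + (1 - t) * (μ / 2 * ‖x - w‖ ^ 2)) (𝓝[>] 0)
      (𝓝 (φ w + ⟪ξ, x - w⟫ + (1 - 0) * (μ / 2 * ‖x - w‖ ^ 2))) := by
    refine Tendsto.mono_left ?_ nhdsWithin_le_nhds
    exact Continuous.tendsto (by fun_prop) 0
  rw [sub_zero, one_mul] at hl
  refine le_of_tendsto hl ?_
  filter_upwards [eventually_mem_Ioo_zero_one] with t ht
  have h1 := hφ.2 hw hx (sub_nonneg.2 ht.2.le) ht.1.le (by ring)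
  have e : (1 - t) • w + t • x = w + t • (x - w) := by module
  have h2 := hξ _ (convex_segment_mem hφ.1 hw hx ht.1.le ht.2.le)
  rw [e] at h1
  simp only [smul_eq_mul, add_sub_cancel_left, inner_smul_right, norm_sub_rev w x] at h1 h2
  have : t * (φ w + ⟪ξ, x - w⟫ + (1 - t) * (μ / 2 * ‖x - w‖ ^ 2)) ≤ t * φ x := by nlinarith
  exact le_of_mul_le_mul_left this ht.1

theorem zero_mem_subdiff_iff {φ : Vec d → ℝ} {w : Vec d} :
    (0 : Vec d) ∈ subdiff X φ w ↔ ∀ u ∈ X, φ w ≤ φ u := by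
  simp [subdiff]

theorem minimizer_growth {φ : Vec d → ℝ} {μ : ℝ} (hφ : StrongConvexOn X μ φ) {w x : Vec d}
    (hw : w ∈ X) (hmin : ∀ u ∈ X, φ w ≤ φ u) (hx : x ∈ X) :
    φ w + μ / 2 * ‖x - w‖ ^ 2 ≤ φ x := by
  simpa using subdiff_growth hφ hw (zero_mem_subdiff_iff.2 hmin) hx

theorem subdiff_add {f h : Vec d → ℝ} {x ξ η : Vec d} (hξ : ξ ∈ subdiff X f x)
    (hη : η ∈ subdiff X h x) : ξ + η ∈ subdiff X (fun u => f u + h u) x := by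
  intro x' hx'
  have h1 := hξ x' hx'
  have h2 := hη x' hx'
  rw [inner_add_left]
  linarith

theorem isClosed_subdiff (φ : Vec d → ℝ) (x : Vec d) : IsClosed (subdiff X φ x) := by
  have : subdiff X φ x = ⋂ x' ∈ X, {ξ | ⟪ξ, x' - x⟫ ≤ φ x' - φ x} := by
    ext; simp [subdiff]
  rw [this]
  exact isClosed_biInter fun x' _ => isClosed_le (by fun_prop) continuous_const

/-- Closedness turns the stopping test into an actual residual vector; the convention for the empty
set rules out an empty subdifferential. -/
theorem DistZeroLE.exists_mem {S : Set (Vec d)} (hS : IsClosed S) {r : ℝ} (hr : 0 ≤ r)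
    (h : DistZeroLE S r) : ∃ ξ ∈ S, ‖ξ‖ ≤ r := by
  have hne : S.Nonempty := by
    by_contra hne
    rw [Set.not_nonempty_iff_eq_empty] at hne
    simp [DistZeroLE, hne] at h
  obtain ⟨ξ, hξ, he⟩ := hS.exists_infDist_eq_dist hne (0 : Vec d)
  refine ⟨ξ, hξ, ?_⟩
  rw [dist_zero_left] at he
  rw [← he, Metric.infDist]
  exact ENNReal.toReal_le_of_le_ofReal hr h

theorem distZeroLE_of_mem {S : Set (Vec d)} {r : ℝ} {ξ : Vec d} (hξ : ξ ∈ S) (h : ‖ξ‖ ≤ r) :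
    DistZeroLE S r := by
  refine (Metric.infEDist_le_edist_of_mem hξ).trans ?_
  rw [edist_dist, dist_zero_left]
  exact ENNReal.ofReal_le_ofReal h

theorem exists_minimizer {φ : Vec d → ℝ} (hX : IsCompact X) (hne : X.Nonempty)
    (hφ : ContinuousOn φ X) : ∃ x ∈ X, ∀ u ∈ X, φ x ≤ φ u :=
  hX.exists_isMinOn hne hφ

theorem argminOver_spec {φ : Vec d → ℝ} (hX : IsCompact X) (hne : X.Nonempty)
    (hφ : ContinuousOn φ X) :
    argminOver X φ ∈ X ∧ ∀ u ∈ X, φ (argminOver X φ) ≤ φ u := by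
  obtain ⟨x, hx, h⟩ := exists_minimizer hX hne hφ
  exact Classical.epsilon_spec (p := fun x => x ∈ X ∧ ∀ u ∈ X, φ x ≤ φ u) ⟨x, hx, h⟩

theorem prox_spec {φ : Vec d → ℝ} (hX : IsCompact X) (hne : X.Nonempty)
    (hφ : ContinuousOn φ X) (η : ℝ) (u : Vec d) :
    prox X φ η u ∈ X ∧ ∀ x ∈ X, η * φ (prox X φ η u) + 1 / 2 * ‖prox X φ η u - u‖ ^ 2
      ≤ η * φ x + 1 / 2 * ‖x - u‖ ^ 2 :=
  argminOver_spec hX hne (by fun_prop)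

/-! ### Gradients -/

theorem hasGradientAt_add {f g : Vec d → ℝ} {v w x : Vec d} (hf : HasGradientAt f v x)
    (hg : HasGradientAt g w x) : HasGradientAt (fun u => f u + g u) (v + w) x := by
  rw [hasGradientAt_iff_hasFDerivAt] at *
  rw [map_add]
  exact hf.add hg

theorem hasGradientAt_const_mul {f : Vec d → ℝ} {v x : Vec d} (a : ℝ) (hf : HasGradientAt f v x) :
    HasGradientAt (fun u => a * f u) (a • v) x := by
  rw [hasGradientAt_iff_hasFDerivAt] at *
  rw [map_smul]
  exact hf.const_mul a

theorem hasGradientAt_sum {ι : Type*} (s : Finset ι) {f : ι → Vec d → ℝ} {v : ι → Vec d}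
    {x : Vec d} (hf : ∀ i ∈ s, HasGradientAt (f i) (v i) x) :
    HasGradientAt (fun u => ∑ i ∈ s, f i u) (∑ i ∈ s, v i) x := by
  simp only [hasGradientAt_iff_hasFDerivAt] at *
  simpa using HasFDerivAt.fun_sum hf

theorem hasGradientAt_comp {f : Vec d → ℝ} {v x : Vec d} {φ : ℝ → ℝ} {φ' : ℝ}
    (hφ : HasDerivAt φ φ' (f x)) (hf : HasGradientAt f v x) :
    HasGradientAt (fun u => φ (f u)) (φ' • v) x := by
  rw [hasGradientAt_iff_hasFDerivAt] at *
  rw [map_smul]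
  exact hφ.comp_hasFDerivAt x hf

theorem hasGradientAt_half_normSq (a x : Vec d) :
    HasGradientAt (fun u => 1 / 2 * ‖u - a‖ ^ 2) (x - a) x := by
  rw [hasGradientAt_iff_hasFDerivAt]
  have := (((hasFDerivAt_id x).sub_const a).norm_sq).const_mul (1 / 2 : ℝ)
  refine this.congr_fderiv ?_
  ext u
  simp

/-- Optimality condition of the proximal mapping. -/
theorem prox_optimality {φ : Vec d → ℝ} (hX : IsCompact X) (hne : X.Nonempty)
    (hφ : ContinuousOn φ X) (hc : ConvexOn ℝ X φ) {η : ℝ} (hη : 0 < η) (u : Vec d) :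
    η⁻¹ • (u - prox X φ η u) ∈ subdiff X φ (prox X φ η u) := by
  obtain ⟨hM, hmin⟩ := prox_spec hX hne hφ η u
  set M := prox X φ η u
  have h1 : (0 : Vec d) ∈ subdiff X (fun x => 1 / 2 * ‖x - u‖ ^ 2 + η * φ x) M := by
    rw [zero_mem_subdiff_iff]
    intro x hx
    linarith [hmin x hx]
  have h2 := subdiff_sub_gradient (hasGradientAt_half_normSq u M)
    (by simpa using hc.smul hη.le) hM h1
  intro x hx
  have h3 := h2 x hx
  rw [zero_sub, neg_sub] at h3
  rw [inner_smul_left]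
  simp only [conj_trivial]
  rw [← mul_sub] at h3
  rwa [inv_mul_le_iff₀ hη]

theorem strongConvexOn_add_half_normSq {φ : Vec d → ℝ} (hc : ConvexOn ℝ X φ) (μ : ℝ) (a : Vec d) :
    StrongConvexOn X μ (fun u => φ u + μ / 2 * ‖u - a‖ ^ 2) := by
  rw [strongConvexOn_iff_convex]
  have e : (fun x => φ x + μ / 2 * ‖x - a‖ ^ 2 - μ / 2 * ‖x‖ ^ 2)
      = fun x => φ x + (⟪-μ • a, x⟫ + μ / 2 * ‖a‖ ^ 2) := by
    funext x
    rw [norm_sub_sq_real, inner_smul_left, real_inner_comm]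
    simp
    ring
  rw [e]
  refine hc.add ⟨hc.1, ?_⟩
  intro x _ y _ α β _ _ hαβ
  simp only [inner_add_right, inner_smul_right, smul_eq_mul]
  have : β = 1 - α := by linarith
  subst this
  exact le_of_eq (by ring)

end ConvexAnalysis

/-! ### Cocoercivity of the gradient of a convex function that is smooth on a convex set -/

section Cocoercivity

variable {d : ℕ} {X : Set (Vec d)} {f : Vec d → ℝ} {L : ℝ}

/-- Descent lemma on a convex set. -/
theorem descent_lemma (hX : Convex ℝ X) (hdiff : ∀ x ∈ X, DifferentiableAt ℝ f x)
    (hlip : ∀ x ∈ X, ∀ y ∈ X, ‖gradient f x - gradient f y‖ ≤ L * ‖x - y‖) {y z : Vec d}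
    (hy : y ∈ X) (hz : z ∈ X) :
    f z ≤ f y + ⟪gradient f y, z - y⟫ + L / 2 * ‖z - y‖ ^ 2 := by
  set u := z - y with hu
  have hmem : ∀ t ∈ Icc (0 : ℝ) 1, y + t • u ∈ X := fun t ht =>
    convex_segment_mem hX hy hz ht.1 ht.2
  have hd : ∀ t ∈ Icc (0 : ℝ) 1, HasDerivAt
      (fun t : ℝ => f (y + t • u) - (t * ⟪gradient f y, u⟫ + L / 2 * ‖u‖ ^ 2 * t ^ 2))
      (⟪gradient f (y + t • u), u⟫ - (⟪gradient f y, u⟫ + L * ‖u‖ ^ 2 * t)) t := by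
    intro t ht
    have hl : HasDerivAt (fun t : ℝ => y + t • u) u t := by
      simpa using ((hasDerivAt_id t).smul_const u).const_add y
    have h := (hdiff _ (hmem t ht)).hasGradientAt.hasFDerivAt.comp_hasDerivAt t hl
    rw [InnerProductSpace.toDual_apply_apply] at h
    have h2 := ((hasDerivAt_id t).mul_const ⟪gradient f y, u⟫).add
      (((hasDerivAt_id t).pow 2).const_mul (L / 2 * ‖u‖ ^ 2))
    refine (h.sub h2).congr_deriv ?_
    simp
    ring
  have hanti := antitoneOn_of_deriv_nonpos (convex_Icc (0 : ℝ) 1)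
    (fun t ht => (hd t ht).continuousAt.continuousWithinAt)
    (fun t ht => (hd t (interior_subset ht)).differentiableAt.differentiableWithinAt)
    (by
      intro t ht
      have ht' : t ∈ Icc (0 : ℝ) 1 := interior_subset ht
      rw [(hd t ht').deriv]
      have h1 : ⟪gradient f (y + t • u) - gradient f y, u⟫ ≤ L * ‖u‖ ^ 2 * t := by
        refine (real_inner_le_norm _ _).trans ?_
        have h2 := hlip _ (hmem t ht') _ hy
        rw [add_sub_cancel_left, norm_smul, Real.norm_of_nonneg ht'.1] at h2
        nlinarith [mul_le_mul_of_nonneg_right h2 (norm_nonneg u)]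
      rw [inner_sub_left] at h1
      linarith)
  have := hanti (left_mem_Icc.2 zero_le_one) (right_mem_Icc.2 zero_le_one) zero_le_one
  simp only [one_smul, zero_smul, add_zero, hu, add_sub_cancel] at this
  rw [← hu] at this
  linarith

/-- The usual proof evaluates the descent lemma at `b - L⁻¹ (∇f(b) - ∇f(a))`, which may leave `X`.
This point is within `‖b - a‖` of `b`, whence the hypotheses on balls. Adding the inequality to its
mirror image gives the result. -/
theorem cocoercive_of_ball (hdiff : ∀ x ∈ X, DifferentiableAt ℝ f x)
    (hconv : ConvexOn ℝ X f) (hL : 0 < L)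
    (hlip : ∀ x ∈ X, ∀ y ∈ X, ‖gradient f x - gradient f y‖ ≤ L * ‖x - y‖) {x y : Vec d}
    (hx : Metric.closedBall x ‖y - x‖ ⊆ X) (hy : Metric.closedBall y ‖y - x‖ ⊆ X) :
    ‖gradient f y - gradient f x‖ ^ 2 ≤ L * ⟪gradient f y - gradient f x, y - x⟫ := by
  have key : ∀ a b : Vec d, a ∈ X → b ∈ X → Metric.closedBall b ‖b - a‖ ⊆ X →
      f a + ⟪gradient f a, b - a⟫ + 1 / (2 * L) * ‖gradient f b - gradient f a‖ ^ 2 ≤ f b := by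
    intro a b ha hb hball
    set Δ := gradient f b - gradient f a with hΔ
    have hzX : b - L⁻¹ • Δ ∈ X := by
      apply hball
      rw [Metric.mem_closedBall, dist_eq_norm, sub_sub_cancel_left, norm_neg, norm_smul, norm_inv,
        Real.norm_of_nonneg hL.le, inv_mul_le_iff₀ hL]
      exact hlip b hb a ha
    have h1 := gradient_mem_subdiff (hdiff a ha).hasGradientAt hconv ha _ hzX
    have h2 := descent_lemma hconv.1 hdiff hlip hb hzX
    rw [sub_sub_cancel_left, norm_neg, inner_neg_right, inner_smul_right, norm_smul, norm_inv,
      Real.norm_of_nonneg hL.le] at h2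
    rw [sub_right_comm, inner_sub_right, inner_smul_right] at h1
    have h3 : ‖Δ‖ ^ 2 = ⟪gradient f b, Δ⟫ - ⟪gradient f a, Δ⟫ := by
      rw [← inner_sub_left, ← hΔ, real_inner_self_eq_norm_sq]
    have e1 : L / 2 * (L⁻¹ * ‖Δ‖) ^ 2 = 1 / (2 * L) * ‖Δ‖ ^ 2 := by field_simp
    have e2 : L⁻¹ * ⟪gradient f b, Δ⟫ - L⁻¹ * ⟪gradient f a, Δ⟫ = 2 * (1 / (2 * L) * ‖Δ‖ ^ 2) := by
      rw [h3]; field_simp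
    linarith
  have hxX : x ∈ X := hx (Metric.mem_closedBall_self (norm_nonneg _))
  have hyX : y ∈ X := hy (Metric.mem_closedBall_self (norm_nonneg _))
  have h1 := key x y hxX hyX hy
  have h2 := key y x hyX hxX (by rwa [norm_sub_rev])
  rw [norm_sub_rev (gradient f x), ← neg_sub y x, inner_neg_right] at h2
  rw [inner_sub_left]
  have e : 1 / (2 * L) * ‖gradient f y - gradient f x‖ ^ 2 * (2 * L)
      = ‖gradient f y - gradient f x‖ ^ 2 := by field_simp
  nlinarith

/-- A segment in the interior has a uniform margin to the boundary, so it can be cut into `N` equal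
pieces short enough for the ball version. Nothing is lost in the constant: Cauchy–Schwarz costs a
factor `N`, and each piece has displacement `(y - x)/N`. -/
theorem cocoercive_interior (hdiff : ∀ x ∈ X, DifferentiableAt ℝ f x)
    (hconv : ConvexOn ℝ X f) (hL : 0 < L)
    (hlip : ∀ x ∈ X, ∀ y ∈ X, ‖gradient f x - gradient f y‖ ≤ L * ‖x - y‖) {x y : Vec d}
    (hx : x ∈ interior X) (hy : y ∈ interior X) :
    ‖gradient f y - gradient f x‖ ^ 2 ≤ L * ⟪gradient f y - gradient f x, y - x⟫ := by
  have hseg : IsCompact (segment ℝ x y) := by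
    rw [segment_eq_image']
    exact isCompact_Icc.image (by fun_prop)
  obtain ⟨δ, hδ, hsub⟩ := hseg.exists_cthickening_subset_open isOpen_interior
    (hconv.1.interior.segment_subset hx hy)
  obtain ⟨N, hN⟩ := exists_nat_gt (‖y - x‖ / δ)
  have hN0 : (0 : ℝ) < N := lt_of_le_of_lt (by positivity) hN
  set p : ℕ → Vec d := fun i => x + ((i : ℝ) / N) • (y - x) with hp
  have hstep : ∀ i, p (i + 1) - p i = (1 / (N : ℝ)) • (y - x) := by
    intro i
    simp only [hp]
    push_cast
    module
  have hball : ∀ i ≤ N, Metric.closedBall (p i) ‖(1 / (N : ℝ)) • (y - x)‖ ⊆ X := by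
    intro i hi z hz
    refine interior_subset (hsub ?_)
    refine Metric.mem_cthickening_of_dist_le z (p i) δ _ ?_ ?_
    · rw [segment_eq_image']
      exact ⟨(i : ℝ) / N, ⟨by positivity, (div_le_one hN0).2 (by exact_mod_cast hi)⟩, rfl⟩
    · refine (Metric.mem_closedBall.1 hz).trans ?_
      rw [norm_smul, Real.norm_of_nonneg (by positivity), one_div, inv_mul_le_iff₀ hN0]
      rw [div_lt_iff₀ hδ] at hN
      exact hN.le
  set G : ℕ → Vec d := fun i => gradient f (p i) with hG
  have hloc : ∀ i ∈ Finset.range N, ‖G (i + 1) - G i‖ ^ 2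
      ≤ L / N * ⟪G (i + 1) - G i, y - x⟫ := by
    intro i hi
    have hi' := Finset.mem_range.1 hi
    have := cocoercive_of_ball hdiff hconv hL hlip (x := p i) (y := p (i + 1))
      (by rw [hstep]; exact hball i hi'.le) (by rw [hstep]; exact hball (i + 1) hi')
    rw [hstep, inner_smul_right] at this
    calc _ ≤ _ := this
      _ = _ := by ring
  have hsum := Finset.sum_le_sum hloc
  rw [← Finset.mul_sum, ← sum_inner, Finset.sum_range_sub] at hsum
  have hcs : ‖G N - G 0‖ ^ 2 ≤ N * ∑ i ∈ Finset.range N, ‖G (i + 1) - G i‖ ^ 2 := by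
    have h1 : ‖G N - G 0‖ ≤ ∑ i ∈ Finset.range N, ‖G (i + 1) - G i‖ := by
      rw [← Finset.sum_range_sub]
      exact norm_sum_le _ _
    have h2 := sq_sum_le_card_mul_sum_sq (s := Finset.range N)
      (f := fun i => ‖G (i + 1) - G i‖)
    rw [Finset.card_range] at h2
    exact (pow_le_pow_left₀ (norm_nonneg _) h1 2).trans h2
  have e0 : G 0 = gradient f x := by simp [hG, hp]
  have eN : G N = gradient f y := by simp [hG, hp, hN0.ne']
  rw [e0, eN] at hcs hsum
  calc _ ≤ _ := hcs
    _ ≤ N * (L / N * ⟪gradient f y - gradient f x, y - x⟫) := by gcongr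
    _ = _ := by field_simp

/-- Boundary points are reached by moving both points slightly towards an interior point and passing
to the limit, the gradient being continuous along `X`. -/
theorem cocoercive (hint : (interior X).Nonempty) (hdiff : ∀ x ∈ X, DifferentiableAt ℝ f x)
    (hconv : ConvexOn ℝ X f) (hL : 0 < L)
    (hlip : ∀ x ∈ X, ∀ y ∈ X, ‖gradient f x - gradient f y‖ ≤ L * ‖x - y‖) {x y : Vec d}
    (hx : x ∈ X) (hy : y ∈ X) :
    ‖gradient f y - gradient f x‖ ^ 2 ≤ L * ⟪gradient f y - gradient f x, y - x⟫ := by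
  obtain ⟨q, hq⟩ := hint
  have hint : ∀ z ∈ X, ∀ᶠ t : ℝ in 𝓝[>] 0, z + t • (q - z) ∈ interior X := by
    intro z hz
    filter_upwards [eventually_mem_Ioo_zero_one] with t ht
    exact hconv.1.add_smul_sub_mem_interior hz hq ⟨ht.1, ht.2.le⟩
  have hpt : ∀ z : Vec d, Tendsto (fun t : ℝ => z + t • (q - z)) (𝓝[>] 0) (𝓝 z) := by
    intro z
    have : Tendsto (fun t : ℝ => z + t • (q - z)) (𝓝 0) (𝓝 (z + (0 : ℝ) • (q - z))) :=
      Continuous.tendsto (by fun_prop) 0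
    rw [zero_smul, add_zero] at this
    exact this.mono_left nhdsWithin_le_nhds
  have hgr : ∀ z ∈ X, Tendsto (fun t : ℝ => gradient f (z + t • (q - z))) (𝓝[>] 0)
      (𝓝 (gradient f z)) := by
    intro z hz
    rw [tendsto_iff_norm_sub_tendsto_zero]
    have h0 : Tendsto (fun t : ℝ => L * ‖z + t • (q - z) - z‖) (𝓝[>] 0) (𝓝 0) := by
      simpa using (tendsto_iff_norm_sub_tendsto_zero.1 (hpt z)).const_mul L
    refine squeeze_zero' (Eventually.of_forall fun t => norm_nonneg _) ?_ h0
    filter_upwards [hint z hz] with t ht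
    exact hlip _ (interior_subset ht) _ hz
  have hg := (hgr y hy).sub (hgr x hx)
  refine le_of_tendsto_of_tendsto (hg.norm.pow 2)
    ((hg.inner ((hpt y).sub (hpt x))).const_mul L) ?_
  filter_upwards [hint x hx, hint y hy] with t h1 h2
  exact cocoercive_interior hdiff hconv hL hlip h1 h2

end Cocoercivity

/-! ## Complexity of the accelerated proximal gradient method -/

namespace APGData

variable {d : ℕ}

/-- The composite problem is convex with `ℓ`-smooth first term and strongly convex second term, and
the parameters of the method are admissible. -/
structure Regular (D : APGData d) (ℓ : ℝ) : Prop where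
  compact : IsCompact D.X
  int_nonempty : (interior D.X).Nonempty
  ft_diff : ∀ x ∈ D.X, DifferentiableAt ℝ D.ft x
  ft_convex : ConvexOn ℝ D.X D.ft
  ft_lip : ∀ x ∈ D.X, ∀ y ∈ D.X, ‖gradient D.ft x - gradient D.ft y‖ ≤ ℓ * ‖x - y‖
  ht_cont : ContinuousOn D.ht D.X
  ht_strong : StrongConvexOn D.X D.μ D.ht
  mu_pos : 0 < D.μ
  mu_le : D.μ ≤ ℓ
  start_mem : D.start ∈ D.X
  L0_pos : 0 < D.L0
  L0_le : D.L0 ≤ 2 * ℓ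
  gammau_eq : D.γu = 2
  gammad_ge : 2 ≤ D.γd
  tol_pos : 0 < D.Δ

/-- The invariant of the iteration: an estimate function `ψ` that lies below
`A φ + ‖· - start‖² / 2` and above `A φ(x) + (1 + μ A) / 2 ‖· - v‖²`. -/
structure Invariant (D : APGData d) (ℓ : ℝ) (s : APGState d) : Prop where
  x_mem : s.x ∈ D.X
  v_mem : s.v ∈ D.X
  A_nonneg : 0 ≤ s.A
  L_pos : 0 < s.L
  L_le : s.L ≤ 2 * ℓ
  estimate : ∃ c : ℝ, ∀ x ∈ D.X,
    1 / 2 * ‖x - D.start‖ ^ 2 + ⟪s.G, x⟫ + s.A * D.ht x + c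
        ≤ s.A * (D.ft x + D.ht x) + 1 / 2 * ‖x - D.start‖ ^ 2 ∧
      s.A * (D.ft s.x + D.ht s.x) + (1 + D.μ * s.A) / 2 * ‖x - s.v‖ ^ 2
        ≤ 1 / 2 * ‖x - D.start‖ ^ 2 + ⟪s.G, x⟫ + s.A * D.ht x + c

variable {D : APGData d} {ℓ : ℝ}

namespace Regular

theorem nonempty (h : D.Regular ℓ) : D.X.Nonempty := ⟨_, h.start_mem⟩

theorem lip_pos (h : D.Regular ℓ) : 0 < ℓ := h.mu_pos.trans_le h.mu_le

theorem ht_convex (h : D.Regular ℓ) : ConvexOn ℝ D.X D.ht :=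
  strongConvexOn_zero.1 (h.ht_strong.mono h.mu_pos.le)

theorem phi_strong (h : D.Regular ℓ) : StrongConvexOn D.X D.μ (fun u => D.ft u + D.ht u) := by
  rw [strongConvexOn_iff_convex]
  refine (h.ft_convex.add (strongConvexOn_iff_convex.1 h.ht_strong)).congr fun u _ => ?_
  simp only [Pi.add_apply]
  ring

theorem proxGrad_mem (h : D.Regular ℓ) (L : ℝ) (y : Vec d) : D.proxGrad L y ∈ D.X :=
  (prox_spec h.compact h.nonempty h.ht_cont _ _).1

theorem compGrad_mem (h : D.Regular ℓ) {L : ℝ} (hL : 0 < L) (y : Vec d) :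
    D.compGrad L y - gradient D.ft (D.proxGrad L y) ∈ subdiff D.X D.ht (D.proxGrad L y) := by
  have := prox_optimality h.compact h.nonempty h.ht_cont h.ht_convex (one_div_pos.2 hL)
    (y - (1 / L) • gradient D.ft y)
  have e : D.compGrad L y - gradient D.ft (D.proxGrad L y)
      = (1 / L)⁻¹ • (y - (1 / L) • gradient D.ft y
        - prox D.X D.ht (1 / L) (y - (1 / L) • gradient D.ft y)) := by
    have hL' : L * L⁻¹ = 1 := mul_inv_cancel₀ hL.ne'
    unfold compGrad proxGrad
    rw [one_div, inv_inv, smul_sub, smul_sub, smul_sub, smul_smul, hL', one_smul]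
    abel
  rw [e]
  exact this

theorem compGrad_mem_phi (h : D.Regular ℓ) {L : ℝ} (hL : 0 < L) (y : Vec d) :
    D.compGrad L y ∈ subdiff D.X (fun u => D.ft u + D.ht u) (D.proxGrad L y) := by
  have hM := h.proxGrad_mem L y
  have := subdiff_add (gradient_mem_subdiff (h.ft_diff _ hM).hasGradientAt h.ft_convex hM)
    (h.compGrad_mem hL y)
  rwa [add_sub_cancel] at this

theorem extrap_mem (h : D.Regular ℓ) {s : APGState d} (hs : D.Invariant ℓ s) {L : ℝ}
    (hL : 0 < L) : D.extrap s L ∈ D.X := by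
  have ha := (D.coef_spec h.mu_pos.le hs.A_nonneg hL).1
  have hsum : 0 < s.A + D.coef s.A L := add_pos_of_nonneg_of_pos hs.A_nonneg ha
  unfold extrap
  rw [smul_add, smul_smul, smul_smul]
  refine h.ht_convex.1 hs.x_mem hs.v_mem (mul_nonneg (by positivity) hs.A_nonneg)
    (by positivity) ?_
  field_simp

/-- With `δ = ∇ft(y) - ∇ft(M)`, expanding the squares shows that the acceptance test is equivalent
to `‖δ‖² ≤ L ⟨δ, y - M⟩`, which is cocoercivity with constant `L ≥ ℓ`. -/
theorem accepts_of_le (h : D.Regular ℓ) {s : APGState d} (hs : D.Invariant ℓ s) {L : ℝ}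
    (hL : ℓ ≤ L) : D.Accepts s L := by
  have hL0 := h.lip_pos.trans_le hL
  unfold Accepts compGrad
  set y := D.extrap s L
  have hy : y ∈ D.X := h.extrap_mem hs hL0
  have hM := h.proxGrad_mem L y
  set M := D.proxGrad L y
  have hco := cocoercive h.int_nonempty h.ft_diff h.ft_convex hL0
    (fun a ha b hb => (h.ft_lip a ha b hb).trans (by gcongr)) hM hy
  set δ := gradient D.ft y - gradient D.ft M
  have e : L • (y - M) + gradient D.ft M - gradient D.ft y = L • (y - M) - δ := by
    simp only [δ]; abel
  rw [e, one_div, inv_mul_le_iff₀ hL0, norm_sub_sq_real, inner_sub_left, inner_smul_left,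
    inner_smul_left, norm_smul, real_inner_self_eq_norm_sq, Real.norm_of_nonneg hL0.le,
    real_inner_comm]
  simp only [conj_trivial]
  nlinarith

theorem lineSearchTerminates (h : D.Regular ℓ) {s : APGState d} (hs : D.Invariant ℓ s) :
    D.LineSearchTerminates s := by
  obtain ⟨j, hj⟩ := pow_unbounded_of_one_lt (ℓ / s.L) (one_lt_two : (1 : ℝ) < 2)
  refine ⟨j, h.accepts_of_le hs ?_⟩
  rw [h.gammau_eq]
  rw [div_lt_iff₀ hs.L_pos] at hj
  linarith

theorem accepts_accepted (h : D.Regular ℓ) {s : APGState d} (hs : D.Invariant ℓ s) :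
    D.Accepts s (D.accepted s) :=
  Nat.sInf_mem (s := {j : ℕ | D.Accepts s (s.L * D.γu ^ j)}) (h.lineSearchTerminates hs)

theorem accepted_pos (h : D.Regular ℓ) {s : APGState d} (hs : D.Invariant ℓ s) :
    0 < D.accepted s := by
  unfold accepted
  rw [h.gammau_eq]
  have := hs.L_pos
  positivity

/-- Either the first trial value is accepted, or half of the accepted value was rejected and is
therefore below `ℓ`. -/
theorem accepted_le (h : D.Regular ℓ) {s : APGState d} (hs : D.Invariant ℓ s) :
    D.accepted s ≤ 2 * ℓ := by
  unfold accepted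
  rcases Nat.eq_zero_or_pos (D.rejected s) with h0 | h0
  · rw [h0, pow_zero, mul_one]
    exact hs.L_le
  · have hn : ¬ D.Accepts s (s.L * D.γu ^ (D.rejected s - 1)) := by
      have : D.rejected s - 1 < D.rejected s := by omega
      exact Nat.notMem_of_lt_sInf this
    have hlt := lt_of_not_ge fun hle => hn (h.accepts_of_le hs hle)
    obtain ⟨k, hk⟩ := Nat.exists_eq_succ_of_ne_zero h0.ne'
    rw [hk] at hlt ⊢
    rw [Nat.succ_sub_one] at hlt
    rw [pow_succ]
    rw [h.gammau_eq] at *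
    linarith

theorem step_A (s : APGState d) :
    (D.step s).A = s.A + D.coef s.A (D.accepted s) := rfl

theorem norm_compGrad_le {L : ℝ} (hL : 0 < L) {s : APGState d} (ha : D.Accepts s L) :
    ‖D.compGrad L (D.extrap s L)‖ ≤ L * ‖D.extrap s L - D.proxGrad L (D.extrap s L)‖ := by
  have h1 := ha.trans (real_inner_le_norm _ _)
  rw [one_div, inv_mul_le_iff₀ hL] at h1
  rcases (norm_nonneg (D.compGrad L (D.extrap s L))).eq_or_lt with h0 | h0
  · rw [← h0]; positivity
  · nlinarith

theorem invariant_zero (h : D.Regular ℓ) : D.Invariant ℓ (D.iter 0) where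
  x_mem := h.start_mem
  v_mem := h.start_mem
  A_nonneg := le_rfl
  L_pos := h.L0_pos
  L_le := h.L0_le
  estimate := ⟨0, fun x _ => by simp [iter]⟩

/-- The estimate function gains `a` times the linearization of `ft` at the new point plus `a · ht`.
Convexity of `ft` preserves the upper bound. The lower bound first holds without its quadratic term
(`hlow`); this term comes back from the strong convexity of the new estimate function, whose
minimizer is the new `v`. -/
theorem invariant_step (h : D.Regular ℓ) {s : APGState d} (hs : D.Invariant ℓ s) :
    D.Invariant ℓ (D.step s) := by
  have hLpos := h.accepted_pos hs
  have hacc := h.accepts_accepted hs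
  have hLle := h.accepted_le hs
  unfold step
  set L := D.accepted s
  obtain ⟨hapos, haeq⟩ := D.coef_spec h.mu_pos.le hs.A_nonneg hLpos
  have hyX := h.extrap_mem hs hLpos
  have hydef : (s.A + D.coef s.A L) • D.extrap s L = s.A • s.x + D.coef s.A L • s.v := by
    unfold extrap
    rw [smul_smul, mul_one_div, div_self (by linarith [hs.A_nonneg]), one_smul]
  unfold Accepts at hacc
  set a := D.coef s.A L
  set y := D.extrap s L
  have hp := h.compGrad_mem_phi hLpos y
  have hph := h.compGrad_mem hLpos y
  have hM := h.proxGrad_mem L y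
  set M := D.proxGrad L y
  set q := D.compGrad L y
  have hA := hs.A_nonneg
  have hApos : 0 < s.A + a := by linarith
  have hμ := h.mu_pos
  obtain ⟨c, hc⟩ := hs.estimate
  set G := s.G + a • gradient D.ft M with hG
  have hv := prox_spec h.compact h.nonempty h.ht_cont (s.A + a) (D.start - G)
  set w := prox D.X D.ht (s.A + a) (D.start - G)
  -- The constant part of the linearization goes into `c'`, so that only the accumulated gradient
  -- `G` is part of the state.
  set c' := c + a * (D.ft M - ⟪gradient D.ft M, M⟫) with hc'
  have hfull : ∀ x : Vec d, 1 / 2 * ‖x - D.start‖ ^ 2 + ⟪G, x⟫ + (s.A + a) * D.ht x + c'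
      = (1 / 2 * ‖x - D.start‖ ^ 2 + ⟪s.G, x⟫ + s.A * D.ht x + c)
        + a * (D.ft M + ⟪gradient D.ft M, x - M⟫ + D.ht x) := by
    intro x
    rw [hG, hc', inner_add_left, inner_smul_left, inner_sub_right]
    simp only [conj_trivial]
    ring
  have hlow : ∀ x ∈ D.X, (s.A + a) * (D.ft M + D.ht M)
      ≤ 1 / 2 * ‖x - D.start‖ ^ 2 + ⟪G, x⟫ + (s.A + a) * D.ht x + c' := by
    intro x hx
    rw [hfull]
    have h1 := (hc x hx).2
    have h2 := hp s.x hs.x_mem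
    have h3 := hph x hx
    have h4 : a ^ 2 * ‖q‖ ^ 2 = 2 * (1 + D.μ * s.A) * ((s.A + a) * (1 / L * ‖q‖ ^ 2)) := by
      rw [div_eq_iff hApos.ne'] at haeq
      rw [haeq]; ring
    -- The equation that defines `a` is used here: it makes `(1 + μA)/2 ‖x - v‖² + a ⟨q, x - v⟩ + (A
    -- + a)/L ‖q‖²` a multiple of this square.
    have h5 : 0 ≤ ‖(1 + D.μ * s.A) • (x - s.v) + a • q‖ ^ 2 := by positivity
    rw [norm_add_sq_real, norm_smul, norm_smul, inner_smul_left, inner_smul_right, mul_pow,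
      mul_pow, Real.norm_eq_abs, Real.norm_eq_abs, sq_abs, sq_abs, h4] at h5
    simp only [conj_trivial] at h5
    have h5' : 0 ≤ (1 + D.μ * s.A) / 2 * ‖x - s.v‖ ^ 2 + a * ⟪q, x - s.v⟫
        + (s.A + a) * (1 / L * ‖q‖ ^ 2) := by
      have h6 : 0 < 1 + D.μ * s.A := by positivity
      rw [real_inner_comm q] at h5
      have : 0 ≤ 2 * (1 + D.μ * s.A) * ((1 + D.μ * s.A) / 2 * ‖x - s.v‖ ^ 2
          + a * ⟪q, x - s.v⟫ + (s.A + a) * (1 / L * ‖q‖ ^ 2)) := by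
        nlinarith
      exact nonneg_of_mul_nonneg_right this (by positivity)
    -- The choice of `y` as weighted mean of `x` and `v` trades the two subgradient terms for `⟨q, y
    -- - M⟩`, which the line search controls, and a term in `x - v`, which the square absorbs.
    have h7 : s.A * ⟪q, s.x - M⟫ + a * ⟪q, x - M⟫
        = (s.A + a) * ⟪q, y - M⟫ + a * ⟪q, x - s.v⟫ := by
      have : ⟪q, (s.A + a) • y⟫ = ⟪q, s.A • s.x + a • s.v⟫ := by rw [hydef]
      simp only [inner_add_right, inner_smul_right] at this
      simp only [inner_sub_right]
      linarith
    have h8 := mul_le_mul_of_nonneg_left hacc hApos.le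
    have h9 := mul_le_mul_of_nonneg_left h2 hA
    rw [inner_sub_left] at h3
    have h10 := mul_le_mul_of_nonneg_left h3 hapos.le
    linarith
  refine ⟨hM, hv.1, hApos.le, by have := h.gammad_ge; positivity, ?_, c', fun x hx => ⟨?_, ?_⟩⟩
  · refine (div_le_self hLpos.le (by linarith [h.gammad_ge])).trans hLle
  · rw [hfull]
    have h1 := (hc x hx).1
    have h2 := gradient_mem_subdiff (h.ft_diff _ hM).hasGradientAt h.ft_convex hM x hx
    have h3 := mul_le_mul_of_nonneg_left h2 hapos.le
    dsimp only
    linarith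
  · have hsq : ∀ u : Vec d, 1 / 2 * ‖u - (D.start - G)‖ ^ 2
        = 1 / 2 * ‖u - D.start‖ ^ 2 + ⟪G, u⟫ + (1 / 2 * ‖G‖ ^ 2 - ⟪G, D.start⟫) := by
      intro u
      rw [show u - (D.start - G) = (u - D.start) + G by abel, norm_add_sq_real,
        real_inner_comm, inner_sub_right]
      ring
    have hstrong : StrongConvexOn D.X (1 + D.μ * (s.A + a))
        (fun u => (s.A + a) * D.ht u + 1 / 2 * ‖u - (D.start - G)‖ ^ 2) := by
      rw [strongConvexOn_iff_convex]
      have h1 := ((strongConvexOn_iff_convex.1 h.ht_strong).smul hApos.le)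
      have h2 := strongConvexOn_iff_convex.1
        (strongConvexOn_add_half_normSq (convexOn_const 0 h.ht_convex.1) 1 (D.start - G))
      refine (h1.add h2).congr ?_
      intro u _
      simp only [Pi.add_apply, smul_eq_mul]
      ring
    have hg := minimizer_growth hstrong hv.1 hv.2 hx
    have hw := hlow w hv.1
    rw [hsq, hsq] at hg
    dsimp only
    linarith

theorem invariant (h : D.Regular ℓ) (t : ℕ) : D.Invariant ℓ (D.iter t) := by
  induction t with
  | zero => exact h.invariant_zero
  | succ t ih => exact h.invariant_step ih

end Regular

end APGData

/-! ### Growth of `A_t`, iteration count and trial count -/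

namespace APGData

variable {d : ℕ} {D : APGData d} {ℓ : ℝ}

/-- The growth factor `1 + √(μ/ℓ)/2` of `√A`. -/
noncomputable def rate (D : APGData d) (ℓ : ℝ) : ℝ := 1 + √(D.μ / ℓ) / 2

theorem one_le_rate (D : APGData d) (ℓ : ℝ) : 1 ≤ D.rate ℓ := by
  unfold rate
  linarith [Real.sqrt_nonneg (D.μ / ℓ)]

namespace Regular

/-- As the accepted `L` is at most `2ℓ`, the increment satisfies `a² ≥ (1 + μA)(A + a)/ℓ`. The term
with `μ/ℓ` forces geometric growth; the term `1/ℓ` gives the first positive value, since `a² ≤ (A +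
a)²`. -/
theorem A_growth (h : D.Regular ℓ) {s : APGState d} (hs : D.Invariant ℓ s) :
    s.A * D.rate ℓ ^ 2 ≤ (D.step s).A ∧ 1 / ℓ ≤ (D.step s).A := by
  rw [step_A]
  have hL := h.accepted_pos hs
  have hLle := h.accepted_le hs
  have hℓ := h.lip_pos
  have hA := hs.A_nonneg
  obtain ⟨ha, he⟩ := D.coef_spec h.mu_pos.le hA hL
  set a := D.coef s.A (D.accepted s)
  set L := D.accepted s
  rw [div_eq_iff (by positivity)] at he
  have hμ := h.mu_pos
  have hge : (1 + D.μ * s.A) / ℓ * (s.A + a) ≤ a ^ 2 := by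
    rw [he]
    have : (1 + D.μ * s.A) / ℓ ≤ 2 * (1 + D.μ * s.A) / L := by
      rw [div_le_div_iff₀ hℓ hL]
      have : 0 ≤ 1 + D.μ * s.A := by positivity
      nlinarith
    gcongr
  unfold rate
  set x := √(D.μ / ℓ) / 2 with hx
  have hx0 : 0 ≤ x := by positivity
  have hx2 : D.μ / ℓ = 4 * x ^ 2 := by
    rw [hx, div_pow, Real.sq_sqrt (by positivity)]; ring
  have hge' : (1 / ℓ + 4 * x ^ 2 * s.A) * (s.A + a) ≤ a ^ 2 := by
    have e : (1 + D.μ * s.A) / ℓ = 1 / ℓ + 4 * x ^ 2 * s.A := by rw [← hx2]; ring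
    rwa [e] at hge
  have hl : 0 < 1 / ℓ := by positivity
  constructor
  · by_contra hlt
    push Not at hlt
    have hb : a < s.A * (2 * x + x ^ 2) := by nlinarith
    have h1 : 4 * x ^ 2 * s.A * (s.A + a) < a ^ 2 := by
      have : 0 < 1 / ℓ * (s.A + a) := by positivity
      nlinarith
    have hxA : 0 ≤ x * s.A := by positivity
    have h2 : a ^ 2 ≤ a * (s.A * (2 * x + x ^ 2)) := by nlinarith
    have h3 : 4 * x ^ 2 * s.A * (s.A + a) < a * (s.A * (2 * x + x ^ 2)) := by linarith
    have hxApos : 0 < s.A * x := by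
      rcases hxA.eq_or_lt with h0 | h0
      · have : s.A * (2 * x + x ^ 2) = (x * s.A) * (2 + x) := by ring
        rw [this, ← h0] at hb
        linarith
      · linarith
    have h4 : 4 * x * (s.A + a) < a * (2 + x) := by
      have : s.A * x * (4 * x * (s.A + a)) < s.A * x * (a * (2 + x)) := by nlinarith
      exact lt_of_mul_lt_mul_left this hxApos.le
    have hxpos : 0 < x := by
      by_contra h0
      have : x = 0 := le_antisymm (not_lt.1 h0) hx0
      rw [this] at hxApos
      simp at hxApos
    -- `4 x s.A < a (2 - 3 x)` contradicts `a < s.A x (2 + x)`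
    have h5 : 4 * x * s.A < a * (2 - 3 * x) := by linarith
    have h6 : 0 < 2 - 3 * x := by
      by_contra h6
      nlinarith
    have h7 : a * (2 - 3 * x) < s.A * (2 * x + x ^ 2) * (2 - 3 * x) :=
      mul_lt_mul_of_pos_right hb h6
    have h8 : 0 ≤ s.A * x * (4 * x + 3 * x ^ 2) := by positivity
    nlinarith
  · have h1 : 1 / ℓ * (s.A + a) ≤ a ^ 2 := by
      have : 0 ≤ 4 * x ^ 2 * s.A * (s.A + a) := by positivity
      nlinarith
    have h2 : a ^ 2 ≤ (s.A + a) * (s.A + a) := by nlinarith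
    exact le_of_mul_le_mul_right (h1.trans h2) (by positivity)

theorem le_A (h : D.Regular ℓ) (t : ℕ) : 1 / ℓ * (D.rate ℓ ^ t) ^ 2 ≤ (D.iter (t + 1)).A := by
  induction t with
  | zero => rw [pow_zero, one_pow, mul_one]; exact (h.A_growth (h.invariant 0)).2
  | succ t ih =>
    refine le_trans ?_ (h.A_growth (h.invariant (t + 1))).1
    have := mul_le_mul_of_nonneg_right ih (sq_nonneg (D.rate ℓ))
    calc _ = _ := by ring
      _ ≤ _ := this

/-- Evaluate both sides of the estimate at the minimizer `u` and add the quadratic growth of `φ`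
above `u`: the function values cancel and `‖u - start‖²` remains. -/
theorem dist_le (h : D.Regular ℓ) {Δ : ℝ} (hΔ : ∀ x ∈ D.X, ∀ y ∈ D.X, ‖x - y‖ ≤ Δ)
    {u : Vec d} (hu : u ∈ D.X) (hmin : ∀ x ∈ D.X, D.ft u + D.ht u ≤ D.ft x + D.ht x)
    {s : APGState d} (hs : D.Invariant ℓ s) :
    (1 + D.μ * s.A) * ‖s.v - u‖ ^ 2 + D.μ * s.A * ‖s.x - u‖ ^ 2 ≤ Δ ^ 2 := by
  obtain ⟨c, hc⟩ := hs.estimate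
  have h1 := hc u hu
  have h2 := minimizer_growth h.phi_strong hu hmin hs.x_mem
  have h3 := mul_le_mul_of_nonneg_left h2 hs.A_nonneg
  have h4 : ‖u - D.start‖ ^ 2 ≤ Δ ^ 2 :=
    pow_le_pow_left₀ (norm_nonneg _) (hΔ _ hu _ h.start_mem) 2
  rw [norm_sub_rev u s.v] at h1
  linarith

/-- The points `x`, `v` and the next `x` are all within `Δ/√(μA)` of the minimizer, hence so is the
convex combination `y`. The step is at most twice this distance, and acceptance bounds the residual
by `L ≤ 2ℓ` times the step. -/
theorem norm_compGrad_bound (h : D.Regular ℓ) {Δ : ℝ}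
    (hΔ : ∀ x ∈ D.X, ∀ y ∈ D.X, ‖x - y‖ ≤ Δ) {s : APGState d} (hs : D.Invariant ℓ s)
    (hA : 0 < s.A) :
    ‖D.compGrad (D.accepted s) (D.extrap s (D.accepted s))‖
      ≤ 4 * ℓ * (Δ / √(D.μ * s.A)) := by
  have hL := h.accepted_pos hs
  have hLle := h.accepted_le hs
  have hμ := h.mu_pos
  have hΔ0 : 0 ≤ Δ := (norm_nonneg _).trans (hΔ _ h.start_mem _ h.start_mem)
  refine (norm_compGrad_le hL (h.accepts_accepted hs)).trans ?_
  obtain ⟨u, hu, hmin⟩ := exists_minimizer (φ := fun u => D.ft u + D.ht u) h.compact h.nonempty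
    (ContinuousOn.add (fun x hx => (h.ft_diff x hx).continuousAt.continuousWithinAt) h.ht_cont)
  have hd := h.dist_le hΔ hu hmin hs
  have hs' := h.invariant_step hs
  have hd' := h.dist_le hΔ hu hmin hs'
  have hAle : s.A ≤ (D.step s).A :=
    (le_mul_of_one_le_right hs.A_nonneg (one_le_pow₀ (D.one_le_rate ℓ))).trans (h.A_growth hs).1
  have hℓ := h.lip_pos
  have hr : 0 < √(D.μ * s.A) := by positivity
  have key : ∀ w : Vec d, D.μ * s.A * ‖w‖ ^ 2 ≤ Δ ^ 2 → ‖w‖ ≤ Δ / √(D.μ * s.A) := by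
    intro w hw
    rw [le_div_iff₀ hr]
    refine abs_le_of_sq_le_sq' ?_ hΔ0 |>.2
    rw [mul_pow, Real.sq_sqrt (by positivity)]
    linarith
  have hn1 : 0 ≤ D.μ * s.A * ‖s.v - u‖ ^ 2 := by positivity
  have hn2 : 0 ≤ D.μ * s.A * ‖s.x - u‖ ^ 2 := by positivity
  have hx := key (s.x - u) (by linarith [sq_nonneg ‖s.v - u‖])
  have hv := key (s.v - u) (by linarith [sq_nonneg ‖s.v - u‖])
  have hx' : ‖(D.step s).x - u‖ ≤ Δ / √(D.μ * s.A) := key _ (by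
    have h1 : D.μ * s.A * ‖(D.step s).x - u‖ ^ 2 ≤ D.μ * (D.step s).A * ‖(D.step s).x - u‖ ^ 2 := by
      gcongr
    have h2 : 0 ≤ (1 + D.μ * (D.step s).A) * ‖(D.step s).v - u‖ ^ 2 := by
      have := hs'.A_nonneg
      positivity
    linarith)
  have ha := (D.coef_spec hμ.le hs.A_nonneg hL).1
  have hy : ‖D.extrap s (D.accepted s) - u‖ ≤ Δ / √(D.μ * s.A) := by
    have e : D.extrap s (D.accepted s) - u = (1 / (s.A + D.coef s.A (D.accepted s))) •
        (s.A • (s.x - u) + D.coef s.A (D.accepted s) • (s.v - u)) := by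
      have hne : s.A + D.coef s.A (D.accepted s) ≠ 0 := by positivity
      have : u = (1 / (s.A + D.coef s.A (D.accepted s))) •
          ((s.A + D.coef s.A (D.accepted s)) • u) := by
        rw [smul_smul, one_div_mul_cancel hne, one_smul]
      unfold extrap
      conv_lhs => rw [this]
      module
    rw [e, norm_smul, Real.norm_of_nonneg (by positivity), one_div, inv_mul_le_iff₀ (by positivity)]
    refine (norm_add_le _ _).trans ?_
    rw [norm_smul, norm_smul, Real.norm_of_nonneg hA.le, Real.norm_of_nonneg ha.le, add_mul]
    gcongr
  have hdist : ‖D.extrap s (D.accepted s) - D.proxGrad (D.accepted s)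
      (D.extrap s (D.accepted s))‖ ≤ 2 * (Δ / √(D.μ * s.A)) := by
    have := norm_sub_le_norm_sub_add_norm_sub (D.extrap s (D.accepted s)) u (D.step s).x
    rw [norm_sub_rev u] at this
    refine this.trans ?_
    linarith
  calc _ ≤ 2 * ℓ * (2 * (Δ / √(D.μ * s.A))) := by gcongr
    _ = _ := by ring

/-- Two iterations are added to `t`: the first makes `A` positive, and the last produces the point
at which the residual is measured. -/
theorem stops_of_le (h : D.Regular ℓ) {Δ : ℝ} (hΔ : ∀ x ∈ D.X, ∀ y ∈ D.X, ‖x - y‖ ≤ Δ) {t : ℕ}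
    (ht : 4 * ℓ * (Δ * √(ℓ / D.μ)) / D.Δ ≤ D.rate ℓ ^ t) : D.Stops (t + 2) := by
  have hs := h.invariant (t + 1)
  have hA := h.le_A t
  have hμ := h.mu_pos
  have hℓ := h.lip_pos
  have hΔ0 : 0 ≤ Δ := (norm_nonneg _).trans (hΔ _ h.start_mem _ h.start_mem)
  have hr : 0 < D.rate ℓ ^ t := pow_pos (zero_lt_one.trans_le (D.one_le_rate ℓ)) t
  have hApos : 0 < (D.iter (t + 1)).A := lt_of_lt_of_le (by positivity) hA
  have hb := h.norm_compGrad_bound hΔ hs hApos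
  refine distZeroLE_of_mem (h.compGrad_mem_phi (h.accepted_pos hs) _) (hb.trans ?_)
  have h1 : √(D.μ / ℓ) * D.rate ℓ ^ t ≤ √(D.μ * (D.iter (t + 1)).A) := by
    apply Real.le_sqrt_of_sq_le
    rw [mul_pow, Real.sq_sqrt (by positivity)]
    calc _ = D.μ * (1 / ℓ * (D.rate ℓ ^ t) ^ 2) := by ring
      _ ≤ _ := by gcongr
  rw [div_le_iff₀ h.tol_pos] at ht
  calc 4 * ℓ * (Δ / √(D.μ * (D.iter (t + 1)).A))
      ≤ 4 * ℓ * (Δ / (√(D.μ / ℓ) * D.rate ℓ ^ t)) := by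
        have : 0 < √(D.μ / ℓ) := by positivity
        gcongr
    _ = 4 * ℓ * (Δ * √(ℓ / D.μ)) / D.rate ℓ ^ t := by
        rw [show ℓ / D.μ = (D.μ / ℓ)⁻¹ by rw [inv_div], Real.sqrt_inv]
        field_simp
    _ ≤ D.Δ := by
        rw [div_le_iff₀ hr]
        linarith

/-- Number of iterations in terms of a power of the growth factor. -/
theorem numIter_le (h : D.Regular ℓ) {Δ : ℝ} (hΔ : ∀ x ∈ D.X, ∀ y ∈ D.X, ‖x - y‖ ≤ Δ) {t : ℕ}
    (ht : 4 * ℓ * (Δ * √(ℓ / D.μ)) / D.Δ ≤ D.rate ℓ ^ t) : D.numIter ≤ t + 2 :=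
  Nat.sInf_le ⟨by omega, h.stops_of_le hΔ ht⟩

theorem rate_gt_one (h : D.Regular ℓ) : 1 < D.rate ℓ := by
  have := h.mu_pos
  have := h.lip_pos
  have : 0 < √(D.μ / ℓ) := by positivity
  unfold rate
  linarith

theorem exists_bound (h : D.Regular ℓ) : ∃ Δ : ℝ, ∀ x ∈ D.X, ∀ y ∈ D.X, ‖x - y‖ ≤ Δ := by
  obtain ⟨C, hC⟩ := Metric.isBounded_iff.1 h.compact.isBounded
  exact ⟨C, fun x hx y hy => by rw [← dist_eq_norm]; exact hC hx hy⟩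

theorem exists_stops (h : D.Regular ℓ) : ∃ t : ℕ, 1 ≤ t ∧ D.Stops t := by
  obtain ⟨Δ, hΔ⟩ := h.exists_bound
  obtain ⟨t, ht⟩ := pow_unbounded_of_one_lt (4 * ℓ * (Δ * √(ℓ / D.μ)) / D.Δ) h.rate_gt_one
  exact ⟨t + 2, by omega, h.stops_of_le hΔ ht.le⟩

theorem terminates (h : D.Regular ℓ) : D.Terminates :=
  ⟨h.exists_stops, fun t _ => h.lineSearchTerminates (h.invariant t)⟩

theorem stops_numIter (h : D.Regular ℓ) : D.Stops D.numIter :=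
  (Nat.sInf_mem (s := {t : ℕ | 1 ≤ t ∧ D.Stops t}) h.exists_stops).2

theorem output_mem (h : D.Regular ℓ) : D.output ∈ D.X := (h.invariant _).x_mem

theorem exists_output_subgradient (h : D.Regular ℓ) :
    ∃ ξ ∈ subdiff D.X (fun u => D.ft u + D.ht u) D.output, ‖ξ‖ ≤ D.Δ :=
  h.stops_numIter.exists_mem (isClosed_subdiff _ _) h.tol_pos.le

/-- Complexity of the accelerated proximal gradient method. -/
theorem numIter_le_log (h : D.Regular ℓ) {Δ : ℝ} (hΔ : ∀ x ∈ D.X, ∀ y ∈ D.X, ‖x - y‖ ≤ Δ) :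
    (D.numIter : ℝ) ≤ 2 + (2 * √(ℓ / D.μ) + 1 / Real.log 2) *
      Real.posLog (9 * D.Δ⁻¹ * Δ * √(1 / D.μ) * ℓ ^ (3 / 2 : ℝ)) := by
  have hμ := h.mu_pos
  have hℓ := h.lip_pos
  have htol := h.tol_pos
  have hΔ0 : 0 ≤ Δ := (norm_nonneg _).trans (hΔ _ h.start_mem _ h.start_mem)
  obtain ⟨Y, hY⟩ : ∃ Y, Y = 4 * ℓ * (Δ * √(ℓ / D.μ)) / D.Δ := ⟨_, rfl⟩
  have hY0 : 0 ≤ Y := by rw [hY]; positivity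
  -- The logarithm in the claim has the argument `9/4 · Y`, where `Y` is the power of the growth
  -- factor that suffices. The surplus `9/4` pays for rounding up below.
  have hYe : 9 * D.Δ⁻¹ * Δ * √(1 / D.μ) * ℓ ^ (3 / 2 : ℝ) = 9 / 4 * Y := by
    have e : ℓ ^ (3 / 2 : ℝ) = ℓ * √ℓ := by
      rw [Real.sqrt_eq_rpow, show (3 / 2 : ℝ) = 1 + 1 / 2 by norm_num, Real.rpow_add hℓ,
        Real.rpow_one]
    rw [hY, e, Real.sqrt_div zero_le_one, Real.sqrt_one, Real.sqrt_div hℓ.le]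
    field_simp
  rw [hYe]
  obtain ⟨x, hx⟩ : ∃ x, x = √(D.μ / ℓ) / 2 := ⟨_, rfl⟩
  have hrate : D.rate ℓ = 1 + x := by rw [hx]; rfl
  have hx0 : 0 < x := by rw [hx]; positivity
  have hxhalf : x ≤ 1 / 2 := by
    have : √(D.μ / ℓ) ≤ 1 := Real.sqrt_le_one.2 ((div_le_one hℓ).2 h.mu_le)
    linarith
  have hinv : 2 * √(ℓ / D.μ) = 1 / x := by
    rw [hx, show ℓ / D.μ = (D.μ / ℓ)⁻¹ by rw [inv_div], Real.sqrt_inv]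
    field_simp
  rw [hinv]
  have hlog2 : 0 < Real.log 2 := Real.log_pos one_lt_two
  have hlog2' : 1.442 ≤ 1 / Real.log 2 := by
    rw [le_div_iff₀ hlog2]
    linarith [Real.log_two_lt_d9]
  rcases le_or_gt Y 1 with hY1 | hY1
  · have h1 : D.numIter ≤ 0 + 2 := h.numIter_le hΔ (by rw [← hY]; simpa using hY1)
    have h2 : (D.numIter : ℝ) ≤ 2 := by exact_mod_cast h1
    have h3 : 0 ≤ (1 / x + 1 / Real.log 2) * Real.posLog (9 / 4 * Y) :=
      mul_nonneg (by positivity) Real.posLog_nonneg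
    linarith
  · have hlogY : 0 < Real.log Y := Real.log_pos hY1
    have hlx : 0 < Real.log (1 + x) := Real.log_pos (by linarith)
    have hlogx : x / (1 + x) ≤ Real.log (1 + x) := by
      have := Real.one_sub_inv_le_log_of_pos (show 0 < 1 + x by linarith)
      calc x / (1 + x) = 1 - (1 + x)⁻¹ := by field_simp; ring
        _ ≤ _ := this
    have hq : Real.log Y / Real.log (1 + x) ≤ (1 / x + 1) * Real.log Y := by
      rw [div_le_iff₀ hlx]
      have : 1 ≤ (1 / x + 1) * Real.log (1 + x) := by
        calc (1 : ℝ) = (1 / x + 1) * (x / (1 + x)) := by field_simp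
          _ ≤ _ := by gcongr
      nlinarith
    have hpow : Y ≤ (1 + x) ^ ⌈Real.log Y / Real.log (1 + x)⌉₊ := by
      rw [← Real.log_le_log_iff (by linarith) (by positivity), Real.log_pow, ← div_le_iff₀ hlx]
      exact Nat.le_ceil _
    have h1 := h.numIter_le hΔ (by rw [← hY, hrate]; exact hpow)
    have h2 : (D.numIter : ℝ) ≤ ⌈Real.log Y / Real.log (1 + x)⌉₊ + 2 := by exact_mod_cast h1
    have h3 := Nat.ceil_lt_add_one (div_nonneg hlogY.le hlx.le)
    have h4 : Real.log (9 / 4 * Y) ≤ Real.posLog (9 / 4 * Y) := le_max_right _ _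
    rw [Real.log_mul (by norm_num) (by linarith)] at h4
    -- The slack is `0.55 (1/x + 1/log 2) ≥ 0.55 · 3.442 > 1`, which covers the `1` from the
    -- ceiling.
    have h5 : 0.55 ≤ Real.log (9 / 4) := by
      have := Real.one_sub_inv_le_log_of_pos (show (0 : ℝ) < 9 / 4 by norm_num)
      norm_num at this ⊢
      linarith
    have h6 : 2 ≤ 1 / x := by
      rw [le_div_iff₀ hx0]; linarith
    have h7 : (1 / x + 1 / Real.log 2) * (0.55 + Real.log Y)
        ≤ (1 / x + 1 / Real.log 2) * Real.posLog (9 / 4 * Y) := by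
      gcongr
      linarith
    have h8 : (1 / x + 1) * Real.log Y ≤ (1 / x + 1 / Real.log 2) * Real.log Y := by
      gcongr
      linarith
    nlinarith

/-- Every rejection doubles `L` and every iteration divides it by `γd`. The logarithms telescope, so
rejections are paid for by the reductions and by the range of `L` from `L0` to `2ℓ`. -/
theorem L_lower (h : D.Regular ℓ) (t : ℕ) : Real.log (D.iter (t + 1)).L =
    Real.log (D.iter t).L + D.rejected (D.iter t) * Real.log 2 - Real.log D.γd := by
  have hs := h.invariant t
  have e : (D.iter (t + 1)).L = (D.iter t).L * 2 ^ D.rejected (D.iter t) / D.γd := by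
    have : (D.iter (t + 1)).L = (D.iter t).L * D.γu ^ D.rejected (D.iter t) / D.γd := rfl
    rw [this, h.gammau_eq]
  have := hs.L_pos
  have := h.gammad_ge
  rw [e, Real.log_div (by positivity) (by positivity), Real.log_mul (by positivity) (by positivity),
    Real.log_pow]

/-- Number of trial steps, accepted or rejected. -/
theorem numTrials_le (h : D.Regular ℓ) : (D.numTrials : ℝ) ≤
    (1 + Real.log D.γd / Real.log 2) * D.numIter + Real.log (2 * ℓ / D.L0) / Real.log 2 := by
  have key : ∀ N : ℕ, (∑ t ∈ Finset.range N, (D.rejected (D.iter t) : ℝ)) * Real.log 2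
      = Real.log (D.iter N).L - Real.log D.L0 + N * Real.log D.γd := by
    intro N
    induction N with
    | zero => simp [iter]
    | succ N ih =>
      rw [Finset.sum_range_succ, add_mul, ih, h.L_lower N]
      push_cast
      ring
  have hlog2 : 0 < Real.log 2 := Real.log_pos one_lt_two
  have hN := h.invariant D.numIter
  have h1 : Real.log (D.iter D.numIter).L ≤ Real.log (2 * ℓ) := Real.log_le_log hN.L_pos hN.L_le
  have h2 := key D.numIter
  have hℓ := h.lip_pos
  rw [Real.log_div (by positivity) h.L0_pos.ne']
  unfold numTrials
  push_cast
  rw [Finset.sum_add_distrib]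
  simp only [Finset.sum_const, Finset.card_range, nsmul_eq_mul, mul_one]
  have h3 : (∑ t ∈ Finset.range D.numIter, (D.rejected (D.iter t) : ℝ))
      ≤ (Real.log (2 * ℓ) - Real.log D.L0 + D.numIter * Real.log D.γd) / Real.log 2 := by
    rw [le_div_iff₀ hlog2]
    linarith
  calc _ ≤ _ := add_le_add_left h3 _
    _ = _ := by field_simp; ring

end Regular

end APGData

/-! ## The augmented Lagrangian -/

section App

variable {p q r : ℕ}

@[simp] theorem app_add (M : Matrix (Fin p) (Fin q) ℝ) (x y : Vec q) :
    app M (x + y) = app M x + app M y := map_add _ _ _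

@[simp] theorem app_sub (M : Matrix (Fin p) (Fin q) ℝ) (x y : Vec q) :
    app M (x - y) = app M x - app M y := map_sub _ _ _

@[simp] theorem app_smul (M : Matrix (Fin p) (Fin q) ℝ) (a : ℝ) (x : Vec q) :
    app M (a • x) = a • app M x := map_smul _ _ _

theorem app_mul (M : Matrix (Fin p) (Fin q) ℝ) (N : Matrix (Fin q) (Fin r) ℝ) (x : Vec r) :
    app (M * N) x = app M (app N x) := by
  simp [app, Matrix.toLpLin_apply, Matrix.mulVec_mulVec]

theorem inner_app (M : Matrix (Fin p) (Fin q) ℝ) (y : Vec p) (x : Vec q) :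
    ⟪y, app M x⟫ = ⟪app M.transpose y, x⟫ := by
  have h := Matrix.toEuclideanLin_conjTranspose_eq_adjoint M
  rw [Matrix.conjTranspose_eq_transpose_of_trivial] at h
  rw [app, app, h, LinearMap.adjoint_inner_left]

theorem norm_app_le (M : Matrix (Fin p) (Fin q) ℝ) (x : Vec q) : ‖app M x‖ ≤ ‖M‖ * ‖x‖ :=
  Matrix.l2_opNorm_mulVec M x

end App

/-- The error of the linearization at `t` is at most `(s - t)²` in all four sign cases; this makes
the squared penalty differentiable despite the positive part. -/
theorem hasDerivAt_max_zero_sq (t : ℝ) :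
    HasDerivAt (fun t : ℝ => max t 0 ^ 2) (2 * max t 0) t := by
  rw [hasDerivAt_iff_isLittleO]
  refine Asymptotics.IsBigO.trans_isLittleO ?_ (Asymptotics.isLittleO_pow_sub_sub t one_lt_two)
  refine Asymptotics.IsBigO.of_bound 1 (Eventually.of_forall fun s => ?_)
  rw [one_mul, norm_pow, norm_norm, Real.norm_eq_abs, Real.norm_eq_abs, sq_abs, smul_eq_mul, abs_le]
  rcases max_cases s 0 with ⟨h1, h2⟩ | ⟨h1, h2⟩ <;> rcases max_cases t 0 with ⟨h3, h4⟩ | ⟨h3, h4⟩ <;>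
    rw [h1, h3] <;> constructor <;> nlinarith

theorem abs_max_zero_sub_le (s t : ℝ) : |max s 0 - max t 0| ≤ |s - t| :=
  abs_max_sub_max_le_abs s t 0

theorem sum_le_sqrt_card_mul_norm {m : ℕ} (z : Vec m) : ∑ i, z i ≤ √m * ‖z‖ := by
  have h := sq_sum_le_card_mul_sum_sq (s := Finset.univ) (f := fun i => z i)
  rw [Finset.card_univ, Fintype.card_fin] at h
  have h2 : ∑ i, z i ^ 2 = ‖z‖ ^ 2 := (EuclideanSpace.real_norm_sq_eq z).symm
  refine Real.le_sqrt_of_sq_le h |>.trans (le_of_eq ?_)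
  rw [h2, Real.sqrt_mul (Nat.cast_nonneg _), Real.sqrt_sq (norm_nonneg _)]

/-! ### Consequences of the assumptions; gradient and convexity of the augmented Lagrangian -/

namespace Problem

variable {d n m : ℕ} {P : Problem d n m} {c : Constants d}

/-- The multiplier `[z + β g(x)]₊`. -/
noncomputable def zbar (P : Problem d n m) (β : ℝ) (z : Vec m) (x : Vec d) : Vec m :=
  posVec (z + β • P.gvec x)

/-- The multiplier `y + β (A x - b)`. -/
noncomputable def ybar (P : Problem d n m) (β : ℝ) (y : Vec n) (x : Vec d) : Vec n :=
  y + β • P.res x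

@[simp] theorem zbar_apply (β : ℝ) (z : Vec m) (x : Vec d) (i : Fin m) :
    P.zbar β z x i = max (z i + β * P.g i x) 0 := by
  simp [zbar, posVec, gvec]

/-- In this form the gradient of the penalty is visibly `∑ zbar_i ∇g_i`. -/
theorem normSq_posVec_scaled {β : ℝ} (hβ : 0 < β) (z : Vec m) (x : Vec d) :
    β / 2 * ‖posVec (P.gvec x + (1 / β) • z)‖ ^ 2
      = ∑ i, 1 / (2 * β) * max (z i + β * P.g i x) 0 ^ 2 := by
  rw [EuclideanSpace.real_norm_sq_eq, Finset.mul_sum]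
  refine Finset.sum_congr rfl fun i _ => ?_
  have e : z i + β * P.g i x = β * (P.g i x + 1 / β * z i) := by field_simp; ring
  have e2 : max (z i + β * P.g i x) 0 = β * max (P.g i x + 1 / β * z i) 0 := by
    rw [e, mul_max_of_nonneg _ _ hβ.le, mul_zero]
  rw [e2]
  simp only [posVec, gvec, PiLp.add_apply, PiLp.smul_apply, smul_eq_mul]
  field_simp

namespace Assumptions

theorem convex (h : P.Assumptions c) : Convex ℝ P.X := h.h_convex.1

theorem int_nonempty (h : P.Assumptions c) : (interior P.X).Nonempty := ⟨_, h.slater_mem⟩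

theorem xfeas_mem (h : P.Assumptions c) : c.xfeas ∈ P.X := interior_subset h.slater_mem

theorem f_diff (h : P.Assumptions c) : ∀ x ∈ P.X, DifferentiableAt ℝ P.f x := by
  obtain ⟨U, _, hX, hs⟩ := h.f_smooth
  exact fun x hx => hs.1 x (hX hx)

theorem f_lip (h : P.Assumptions c) :
    ∀ x ∈ P.X, ∀ y ∈ P.X, ‖gradient P.f x - gradient P.f y‖ ≤ c.Lf * ‖x - y‖ := by
  obtain ⟨U, _, hX, hs⟩ := h.f_smooth
  exact fun x hx y hy => hs.2 x (hX hx) y (hX hy)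

theorem g_diff (h : P.Assumptions c) (i : Fin m) : ∀ x ∈ P.X, DifferentiableAt ℝ (P.g i) x := by
  obtain ⟨U, _, hX, hs⟩ := h.g_smooth
  exact fun x hx => (hs i).1 x (hX hx)

theorem g_lip (h : P.Assumptions c) (i : Fin m) :
    ∀ x ∈ P.X, ∀ y ∈ P.X, ‖gradient (P.g i) x - gradient (P.g i) y‖ ≤ c.Lg * ‖x - y‖ := by
  obtain ⟨U, _, hX, hs⟩ := h.g_smooth
  exact fun x hx y hy => (hs i).2 x (hX hx) y (hX hy)

theorem f_cont (h : P.Assumptions c) : ContinuousOn P.f P.X := fun x hx =>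
  (h.f_diff x hx).continuousAt.continuousWithinAt

theorem h_cont (h : P.Assumptions c) : ContinuousOn P.h P.X := by
  refine (h.F_cont.sub h.f_cont).congr fun x _ => ?_
  simp [F]

theorem norm_sub_le_diam (h : P.Assumptions c) : ∀ x ∈ P.X, ∀ y ∈ P.X, ‖x - y‖ ≤ P.diam := by
  intro x hx y hy
  rw [← dist_eq_norm]
  exact Metric.dist_le_diam_of_mem h.compact.isBounded hx hy

/-- The dimension being positive enters here: two distinct points of `X` make the diameter positive
and exclude negative Lipschitz constants. -/
theorem exists_ne (hd : 0 < d) (h : P.Assumptions c) : ∃ x ∈ P.X, ∃ y ∈ P.X, 0 < ‖x - y‖ := by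
  obtain ⟨r, hr, hball⟩ := Metric.mem_nhds_iff.1 (mem_interior_iff_mem_nhds.1 h.slater_mem)
  have : Nonempty (Fin d) := ⟨⟨0, hd⟩⟩
  obtain ⟨e, he⟩ := exists_norm_eq (Vec d) (show 0 ≤ r / 2 by positivity)
  refine ⟨c.xfeas + e, hball ?_, c.xfeas, h.xfeas_mem, ?_⟩
  · rw [Metric.mem_ball, dist_eq_norm, add_sub_cancel_left, he]
    linarith
  · rw [add_sub_cancel_left, he]
    positivity

theorem diam_pos (hd : 0 < d) (h : P.Assumptions c) : 0 < P.diam := by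
  obtain ⟨x, hx, y, hy, hxy⟩ := h.exists_ne hd
  exact hxy.trans_le (h.norm_sub_le_diam x hx y hy)

theorem Lf_nonneg (hd : 0 < d) (h : P.Assumptions c) : 0 ≤ c.Lf := by
  obtain ⟨x, hx, y, hy, hxy⟩ := h.exists_ne hd
  exact nonneg_of_mul_nonneg_left ((norm_nonneg _).trans (h.f_lip x hx y hy)) hxy

theorem Lg_nonneg (hd : 0 < d) (hm : 0 < m) (h : P.Assumptions c) : 0 ≤ c.Lg := by
  obtain ⟨x, hx, y, hy, hxy⟩ := h.exists_ne hd
  exact nonneg_of_mul_nonneg_left ((norm_nonneg _).trans (h.g_lip ⟨0, hm⟩ x hx y hy)) hxy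

theorem Bg_pos (hm : 0 < m) (h : P.Assumptions c) : 0 < c.Bg :=
  (abs_pos.2 (h.slater_lt ⟨0, hm⟩).ne).trans_le (h.Bg_bound _ h.xfeas_mem ⟨0, hm⟩).1

theorem Bf_nonneg (h : P.Assumptions c) : 0 ≤ c.Bf :=
  (norm_nonneg _).trans (h.Bf_bound _ h.xfeas_mem)

theorem g_sub_le (h : P.Assumptions c) (i : Fin m) {x y : Vec d} (hx : x ∈ P.X) (hy : y ∈ P.X) :
    |P.g i x - P.g i y| ≤ c.Bg * ‖x - y‖ := by
  have key : ∀ u ∈ P.X, ∀ v ∈ P.X, P.g i u - P.g i v ≤ c.Bg * ‖u - v‖ := by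
    intro u hu v hv
    have h1 := gradient_mem_subdiff (h.g_diff i u hu).hasGradientAt
      ((h.g_convex i).subset (subset_univ _) h.convex) hu v hv
    have h2 := real_inner_le_norm (gradient (P.g i) u) (u - v)
    have h3 := mul_le_mul_of_nonneg_right (h.Bg_bound u hu i).2 (norm_nonneg (u - v))
    rw [← neg_sub u v, inner_neg_right] at h1
    linarith
  rw [abs_le]
  have h1 := key x hx y hy
  have h2 := key y hy x hx
  rw [norm_sub_rev] at h2
  constructor <;> linarith

theorem hasGradientAt_smoothAL (h : P.Assumptions c) {β : ℝ} (hβ : 0 < β) (y : Vec n) (z : Vec m)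
    {x : Vec d} (hx : x ∈ P.X) : HasGradientAt (P.smoothAL β y z)
      (gradient P.f x + app P.A.transpose (P.ybar β y x)
        + ∑ i, P.zbar β z x i • gradient (P.g i) x) x := by
  have hres : HasFDerivAt P.res (Matrix.toEuclideanLin P.A).toContinuousLinearMap x :=
    ((Matrix.toEuclideanLin P.A).toContinuousLinearMap.hasFDerivAt).sub_const P.b
  have h1 : HasGradientAt (fun u => ⟪y, P.res u⟫) (app P.A.transpose y) x := by
    rw [hasGradientAt_iff_hasFDerivAt]
    refine ((innerSL ℝ y).hasFDerivAt.comp x hres).congr_fderiv ?_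
    ext u
    simpa [app] using inner_app P.A y u
  have h2 : HasGradientAt (fun u => ‖P.res u‖ ^ 2) ((2 : ℝ) • app P.A.transpose (P.res x)) x := by
    rw [hasGradientAt_iff_hasFDerivAt]
    refine hres.norm_sq.congr_fderiv ?_
    ext u
    have := inner_app P.A (P.res x) u
    simp only [app] at this
    simp [this, app]
  have h3 : HasGradientAt (fun u => ∑ i, 1 / (2 * β) * max (z i + β * P.g i u) 0 ^ 2)
      (∑ i, P.zbar β z x i • gradient (P.g i) x) x := by
    refine hasGradientAt_sum _ fun i _ => ?_
    have hg := (h.g_diff i x hx).hasGradientAt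
    have h4 := hasGradientAt_comp (hasDerivAt_max_zero_sq (z i + β * P.g i x))
      (hasGradientAt_add (hasGradientAt_const x (z i)) (hasGradientAt_const_mul β hg))
    convert hasGradientAt_const_mul (1 / (2 * β)) h4 using 1
    rw [zbar_apply, zero_add, smul_smul, smul_smul]
    congr 1
    field_simp
  have h5 := hasGradientAt_add (hasGradientAt_add (hasGradientAt_add (hasGradientAt_add
    (h.f_diff x hx).hasGradientAt h1) (hasGradientAt_const_mul (β / 2) h2)) h3)
    (hasGradientAt_const x (-(‖z‖ ^ 2 / (2 * β))))
  have e : P.smoothAL β y z = fun u => P.f u + ⟪y, P.res u⟫ + β / 2 * ‖P.res u‖ ^ 2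
      + ∑ i, 1 / (2 * β) * max (z i + β * P.g i u) 0 ^ 2 + -(‖z‖ ^ 2 / (2 * β)) := by
    funext u
    rw [smoothAL, normSq_posVec_scaled hβ]
    ring
  rw [e]
  convert h5 using 1
  rw [ybar, app_add, app_smul, smul_smul]
  module

theorem gradient_smoothAL (h : P.Assumptions c) {β : ℝ} (hβ : 0 < β) (y : Vec n) (z : Vec m)
    {x : Vec d} (hx : x ∈ P.X) : gradient (P.smoothAL β y z) x =
      gradient P.f x + app P.A.transpose (P.ybar β y x)
        + ∑ i, P.zbar β z x i • gradient (P.g i) x :=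
  (h.hasGradientAt_smoothAL hβ y z hx).gradient

/-- Product rule for `zbar_i ∇g_i`: the factor `zbar_i` is `β B_g`-Lipschitz and bounded by `β B_g +
z_i`. The part proportional to `β` is collected in `C₂`, and `∑ z_i ≤ √m ‖z‖` gives the rest. -/
theorem gradient_smoothAL_lip (hd : 0 < d) (hm : 0 < m) (h : P.Assumptions c) {β : ℝ} (hβ : 0 < β)
    (y : Vec n) {z : Vec m} (hz : ∀ i, 0 ≤ z i) {u v : Vec d} (hu : u ∈ P.X) (hv : v ∈ P.X) :
    ‖gradient (P.smoothAL β y z) u - gradient (P.smoothAL β y z) v‖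
      ≤ (c.Lf + √m * c.Lg * ‖z‖ + β * P.C2 c) * ‖u - v‖ := by
  have hLg := h.Lg_nonneg hd hm
  have hBg := h.Bg_pos hm
  rw [h.gradient_smoothAL hβ y z hu, h.gradient_smoothAL hβ y z hv]
  have hA : ‖app P.A.transpose (P.ybar β y u) - app P.A.transpose (P.ybar β y v)‖
      ≤ β * ‖P.A.transpose * P.A‖ * ‖u - v‖ := by
    have e : app P.A.transpose (P.ybar β y u) - app P.A.transpose (P.ybar β y v)
        = β • app (P.A.transpose * P.A) (u - v) := by
      simp only [ybar, res, app_mul, app_add, app_sub, app_smul]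
      module
    rw [e, norm_smul, Real.norm_of_nonneg hβ.le, mul_assoc]
    exact mul_le_mul_of_nonneg_left (norm_app_le _ _) hβ.le
  have hg : ∀ i, ‖P.zbar β z u i • gradient (P.g i) u - P.zbar β z v i • gradient (P.g i) v‖
      ≤ (β * (c.Bg * (c.Bg + c.Lg)) + c.Lg * z i) * ‖u - v‖ := by
    intro i
    have e : P.zbar β z u i • gradient (P.g i) u - P.zbar β z v i • gradient (P.g i) v
        = (P.zbar β z u i - P.zbar β z v i) • gradient (P.g i) u
          + P.zbar β z v i • (gradient (P.g i) u - gradient (P.g i) v) := by module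
    have h1 : |P.zbar β z u i - P.zbar β z v i| ≤ β * (c.Bg * ‖u - v‖) := by
      rw [zbar_apply, zbar_apply]
      refine (abs_max_zero_sub_le _ _).trans ?_
      rw [add_sub_add_left_eq_sub, ← mul_sub, abs_mul, abs_of_pos hβ]
      exact mul_le_mul_of_nonneg_left (h.g_sub_le i hu hv) hβ.le
    have h2 : |P.zbar β z v i| ≤ β * c.Bg + z i := by
      rw [zbar_apply, abs_of_nonneg (le_max_right _ _)]
      have := hz i
      refine max_le ?_ (by positivity)
      have := (le_abs_self _).trans (h.Bg_bound v hv i).1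
      nlinarith
    rw [e]
    refine (norm_add_le _ _).trans ?_
    rw [norm_smul, norm_smul, Real.norm_eq_abs, Real.norm_eq_abs]
    have h3 := mul_le_mul h1 (h.Bg_bound u hu i).2 (norm_nonneg _) (by positivity)
    have h4 := mul_le_mul h2 (h.g_lip i u hu v hv) (norm_nonneg _)
      (by have := hz i; positivity)
    calc _ ≤ β * (c.Bg * ‖u - v‖) * c.Bg + (β * c.Bg + z i) * (c.Lg * ‖u - v‖) := add_le_add h3 h4
      _ = _ := by ring
  have hsum : ‖∑ i, P.zbar β z u i • gradient (P.g i) u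
      - ∑ i, P.zbar β z v i • gradient (P.g i) v‖
      ≤ (β * (m * c.Bg * (c.Bg + c.Lg)) + √m * c.Lg * ‖z‖) * ‖u - v‖ := by
    rw [← Finset.sum_sub_distrib]
    refine (norm_sum_le _ _).trans ((Finset.sum_le_sum fun i _ => hg i).trans ?_)
    rw [← Finset.sum_mul, Finset.sum_add_distrib, ← Finset.mul_sum _ _ c.Lg]
    have hs := mul_le_mul_of_nonneg_left (sum_le_sqrt_card_mul_norm z) hLg
    simp only [Finset.sum_const, Finset.card_univ, Fintype.card_fin, nsmul_eq_mul]
    refine mul_le_mul_of_nonneg_right ?_ (norm_nonneg _)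
    linarith
  have e : ∀ a₁ a₂ b₁ b₂ c₁ c₂ : Vec d,
      a₁ + b₁ + c₁ - (a₂ + b₂ + c₂) = (a₁ - a₂) + (b₁ - b₂) + (c₁ - c₂) := by
    intros; abel
  rw [e]
  refine (norm_add₃_le).trans ?_
  calc _ ≤ c.Lf * ‖u - v‖ + β * ‖P.A.transpose * P.A‖ * ‖u - v‖
        + (β * (m * c.Bg * (c.Bg + c.Lg)) + √m * c.Lg * ‖z‖) * ‖u - v‖ :=
        add_le_add (add_le_add (h.f_lip u hu v hv) hA) hsum
    _ = _ := by rw [C2]; ring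

theorem convexOn_norm_res_sq (hX : Convex ℝ P.X) : ConvexOn ℝ P.X (fun u => ‖P.res u‖ ^ 2) := by
  have h1 : ConvexOn ℝ P.X (fun u => ‖P.res u‖) := by
    have := ((convexOn_univ_norm (E := Vec n)).comp_affineMap
      ((Matrix.toEuclideanLin P.A).toAffineMap - AffineMap.const ℝ (Vec d) P.b))
    exact this.subset (subset_univ _) hX
  exact h1.pow (fun _ _ => norm_nonneg _) 2

theorem convexOn_inner_res (hX : Convex ℝ P.X) (y : Vec n) :
    ConvexOn ℝ P.X (fun u => ⟪y, P.res u⟫) := by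
  refine ⟨hX, fun u _ v _ a b _ _ hab => le_of_eq ?_⟩
  simp only [res, app_add, app_smul, inner_sub_right, inner_add_right, inner_smul_right,
    smul_eq_mul]
  have : b = 1 - a := by linarith
  subst this
  ring

/-- The smooth part of a subproblem is convex. -/
theorem convexOn_smoothAL (h : P.Assumptions c) {β : ℝ} (hβ : 0 < β) (y : Vec n) (z : Vec m)
    (a : Vec d) : ConvexOn ℝ P.X (fun u => P.smoothAL β y z u + c.ρ / 2 * ‖u - a‖ ^ 2) := by
  have h1 : ConvexOn ℝ P.X (fun u => P.f u + c.ρ / 2 * ‖u - a‖ ^ 2) := by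
    -- Moving the centre of the quadratic from `0` to `a` changes it by an affine function, so weak
    -- convexity of `f` applies.
    have h2 : ConvexOn ℝ P.X (fun u => ⟪-c.ρ • a, u⟫ + c.ρ / 2 * ‖a‖ ^ 2) := by
      refine ⟨h.convex, fun u _ v _ s t _ _ hst => le_of_eq ?_⟩
      simp only [inner_add_right, inner_smul_right, smul_eq_mul]
      have : t = 1 - s := by linarith
      subst this
      ring
    refine (ConvexOn.add h.weaklyConvex h2).congr fun u _ => ?_
    simp only [Pi.add_apply]
    rw [norm_sub_sq_real, inner_smul_left, real_inner_comm]
    simp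
    ring
  have h3 : ConvexOn ℝ P.X (fun u => ∑ i, 1 / (2 * β) * max (z i + β * P.g i u) 0 ^ 2) := by
    have key : ∀ i, ConvexOn ℝ P.X (fun u => 1 / (2 * β) * max (z i + β * P.g i u) 0 ^ 2) := by
      intro i
      have h4 : ConvexOn ℝ P.X (fun u => z i + β * P.g i u) :=
        (convexOn_const (z i) h.convex).add
          (((h.g_convex i).subset (subset_univ _) h.convex).smul hβ.le)
      have h5 : ConvexOn ℝ P.X (fun u => max (z i + β * P.g i u) 0) :=
        h4.sup (convexOn_const 0 h.convex)
      exact (h5.pow (fun _ _ => le_max_right _ _) 2).smul (by positivity)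
    have : ∀ s : Finset (Fin m), ConvexOn ℝ P.X
        (fun u => ∑ i ∈ s, 1 / (2 * β) * max (z i + β * P.g i u) 0 ^ 2) := by
      intro s
      induction s using Finset.induction_on with
      | empty => simpa using convexOn_const 0 h.convex
      | insert i s hi ih =>
        simp only [Finset.sum_insert hi]
        exact (key i).add ih
    exact this _
  have h6 := (((h1.add (convexOn_inner_res h.convex y)).add
    ((convexOn_norm_res_sq h.convex).smul (show 0 ≤ β / 2 by positivity))).add h3).add
    (convexOn_const (-(‖z‖ ^ 2 / (2 * β))) h.convex)
  refine h6.congr fun u _ => ?_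
  simp only [Pi.add_apply, smul_eq_mul]
  rw [smoothAL, normSq_posVec_scaled hβ]
  ring

end Assumptions

end Problem

/-! ### The smallest positive eigenvalue of `A Aᵀ` -/

section Eigenvalue

variable {p q : ℕ} (M : Matrix (Fin p) (Fin q) ℝ)

theorem isHermitian_mul_transpose : (M * M.transpose).IsHermitian := by
  have := Matrix.isHermitian_mul_conjTranspose_self M
  rwa [Matrix.conjTranspose_eq_transpose_of_trivial] at this

theorem app_eigenvector (i : Fin p) :
    app (M * M.transpose) ((isHermitian_mul_transpose M).eigenvectorBasis i)
      = (isHermitian_mul_transpose M).eigenvalues i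
        • (isHermitian_mul_transpose M).eigenvectorBasis i := by
  have := (isHermitian_mul_transpose M).mulVec_eigenvectorBasis i
  ext j
  simpa [app, Matrix.toLpLin_apply] using congrFun this j

theorem eigenvalue_eq_normSq (i : Fin p) : (isHermitian_mul_transpose M).eigenvalues i
    = ‖app M.transpose ((isHermitian_mul_transpose M).eigenvectorBasis i)‖ ^ 2 := by
  set S := isHermitian_mul_transpose M
  have h1 : ⟪S.eigenvectorBasis i, app (M * M.transpose) (S.eigenvectorBasis i)⟫
      = S.eigenvalues i := by
    rw [app_eigenvector, inner_smul_right, real_inner_self_eq_norm_sq,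
      S.eigenvectorBasis.norm_eq_one]
    simp
  rw [← h1, app_mul, inner_app, real_inner_self_eq_norm_sq]

theorem hasEigenvalue_eigenvalues (i : Fin p) : Module.End.HasEigenvalue
    (Matrix.toLin' (M * M.transpose)) ((isHermitian_mul_transpose M).eigenvalues i) := by
  set S := isHermitian_mul_transpose M
  refine Module.End.hasEigenvalue_of_hasEigenvector (x := WithLp.ofLp (S.eigenvectorBasis i)) ?_
  refine ⟨Module.End.mem_eigenspace_iff.2 ?_, ?_⟩
  · rw [Matrix.toLin'_apply]
    exact S.mulVec_eigenvectorBasis i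
  · intro h0
    have : S.eigenvectorBasis i = 0 := by
      ext j
      exact congrFun h0 j
    exact S.eigenvectorBasis.orthonormal.ne_zero i this

theorem lambdaMinPos_le {i : Fin p} (hi : 0 < (isHermitian_mul_transpose M).eigenvalues i) :
    lambdaMinPos (M * M.transpose) ≤ (isHermitian_mul_transpose M).eigenvalues i :=
  csInf_le ⟨0, fun _ hμ => hμ.1.le⟩ ⟨hi, hasEigenvalue_eigenvalues M i⟩

variable {M}

/-- If no eigenvalue were positive, `Mᵀ` would annihilate an eigenbasis and `M` would vanish. The
set of positive eigenvalues is finite, so its infimum is attained and positive. -/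
theorem lambdaMinPos_pos (hM : M ≠ 0) : 0 < lambdaMinPos (M * M.transpose) := by
  set S := isHermitian_mul_transpose M with hS
  have hne : ∃ i, 0 < S.eigenvalues i := by
    by_contra hcon
    push Not at hcon
    have h0 : ∀ i, app M.transpose (S.eigenvectorBasis i) = 0 := by
      intro i
      have h1 := eigenvalue_eq_normSq M i
      have h2 := hcon i
      rw [← norm_eq_zero]
      nlinarith [norm_nonneg (app M.transpose (S.eigenvectorBasis i))]
    have h1 : Matrix.toEuclideanLin M.transpose = 0 := by
      refine S.eigenvectorBasis.toBasis.ext fun i => ?_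
      exact (congrArg _ (S.eigenvectorBasis.coe_toBasis ▸ rfl)).trans (h0 i)
    have h2 : M.transpose = 0 := by simpa using h1
    exact hM (by rw [← Matrix.transpose_transpose M, h2, Matrix.transpose_zero])
  obtain ⟨i, hi⟩ := hne
  have hfin : {μ : ℝ | 0 < μ ∧
      Module.End.HasEigenvalue (Matrix.toLin' (M * M.transpose)) μ}.Finite :=
    (Module.End.finite_hasEigenvalue (Matrix.toLin' (M * M.transpose))).subset fun μ hμ => hμ.2
  have hmem : lambdaMinPos (M * M.transpose) ∈ {μ : ℝ | 0 < μ ∧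
      Module.End.HasEigenvalue (Matrix.toLin' (M * M.transpose)) μ} :=
    Set.Nonempty.csInf_mem ⟨_, hi, hasEigenvalue_eigenvalues M i⟩ hfin
  exact hmem.1

/-- Expand in an eigenbasis of `M Mᵀ`. If the eigenvalue of `e` is zero then `Mᵀ e = 0`, so `e` is
orthogonal to `y = M u`; only positive eigenvalues contribute. -/
theorem sqrt_lambdaMinPos_mul_norm_le {y : Vec p} {u : Vec q} (hy : y = app M u) :
    √(lambdaMinPos (M * M.transpose)) * ‖y‖ ≤ ‖app M.transpose y‖ := by
  set S := isHermitian_mul_transpose M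
  have hexp : ‖app M.transpose y‖ ^ 2
      = ∑ i, S.eigenvalues i * ⟪S.eigenvectorBasis i, y⟫ ^ 2 := by
    have h1 : ‖app M.transpose y‖ ^ 2 = ⟪y, app (M * M.transpose) y⟫ := by
      rw [app_mul, inner_app, real_inner_self_eq_norm_sq]
    have h2 : app (M * M.transpose) y
        = ∑ i, (⟪S.eigenvectorBasis i, y⟫ * S.eigenvalues i) • S.eigenvectorBasis i := by
      conv_lhs => rw [← S.eigenvectorBasis.sum_repr y]
      rw [app, map_sum]
      refine Finset.sum_congr rfl fun i _ => ?_
      have := app_eigenvector M i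
      rw [app] at this
      rw [map_smul, this, smul_smul, S.eigenvectorBasis.repr_apply_apply]
    rw [h1, h2, inner_sum]
    refine Finset.sum_congr rfl fun i _ => ?_
    rw [inner_smul_right, real_inner_comm]
    ring
  have hn : ‖y‖ ^ 2 = ∑ i, ⟪S.eigenvectorBasis i, y⟫ ^ 2 := by
    rw [← S.eigenvectorBasis.sum_sq_norm_inner_right y]
    simp
  have hle : lambdaMinPos (M * M.transpose) * ‖y‖ ^ 2 ≤ ‖app M.transpose y‖ ^ 2 := by
    rw [hexp, hn, Finset.mul_sum]
    refine Finset.sum_le_sum fun i _ => ?_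
    have h0 := eigenvalue_eq_normSq M i
    rcases (sq_nonneg ‖app M.transpose (S.eigenvectorBasis i)‖).eq_or_lt with h1 | h1
    · have h2 : app M.transpose (S.eigenvectorBasis i) = 0 := by
        rw [← norm_eq_zero]
        exact pow_eq_zero_iff two_ne_zero |>.1 h1.symm
      have h3 : ⟪S.eigenvectorBasis i, y⟫ = 0 := by
        rw [hy, inner_app, h2, inner_zero_left]
      rw [h3]; simp
    · exact mul_le_mul_of_nonneg_right (lambdaMinPos_le M (by rw [h0]; exact h1)) (sq_nonneg _)
  have h0 : 0 ≤ lambdaMinPos (M * M.transpose) := Real.sInf_nonneg fun μ hμ => hμ.1.le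
  refine abs_le_of_sq_le_sq' ?_ (norm_nonneg _) |>.2
  rwa [mul_pow, Real.sq_sqrt h0]

end Eigenvalue

namespace Problem

variable {d n m : ℕ} {P : Problem d n m} {c : Constants d}

namespace Assumptions

/-! ### Positivity of the constants -/

theorem gmin_le (P : Problem d n m) (c : Constants d) (i : Fin m) :
    P.gmin c ≤ -P.g i c.xfeas :=
  ciInf_le (Set.finite_range _).bddBelow i

theorem gmin_pos (hm : 0 < m) (h : P.Assumptions c) : 0 < P.gmin c := by
  have : Nonempty (Fin m) := ⟨⟨0, hm⟩⟩
  obtain ⟨i, hi⟩ := exists_eq_ciInf_of_finite (f := fun i => -P.g i c.xfeas)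
  rw [gmin, ← hi]
  exact neg_pos.2 (h.slater_lt i)

theorem frontier_nonempty (hd : 0 < d) (h : P.Assumptions c) : (frontier P.X).Nonempty := by
  have : Nonempty (Fin d) := ⟨⟨0, hd⟩⟩
  exact nonempty_frontier_iff.2 ⟨⟨_, h.xfeas_mem⟩, h.compact.ne_univ⟩

theorem distBd_pos (hd : 0 < d) (h : P.Assumptions c) : 0 < P.distBd c := by
  refine (isClosed_frontier.notMem_iff_infDist_pos (h.frontier_nonempty hd)).1 fun hmem => ?_
  exact hmem.2 h.slater_mem

/-- A ball that avoids the frontier is covered by the disjoint open sets `interior X` and `Xᶜ`;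
being connected and meeting the first, it cannot meet the second. -/
theorem ball_subset (h : P.Assumptions c) : Metric.ball c.xfeas (P.distBd c) ⊆ P.X := by
  intro x hx
  by_contra hxX
  have hr : 0 < P.distBd c := Metric.pos_of_mem_ball hx
  have hcov : Metric.ball c.xfeas (P.distBd c) ⊆ interior P.X ∪ P.Xᶜ := by
    intro w hw
    by_contra hcon
    rw [mem_union, not_or, notMem_compl_iff] at hcon
    have h1 : P.distBd c ≤ dist c.xfeas w :=
      Metric.infDist_le_dist_of_mem ⟨subset_closure hcon.2, hcon.1⟩
    rw [Metric.mem_ball, dist_comm] at hw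
    linarith
  obtain ⟨w, -, hw1, hw2⟩ := (convex_ball c.xfeas (P.distBd c)).isPreconnected _ _ isOpen_interior
    h.compact.isClosed.isOpen_compl hcov ⟨c.xfeas, Metric.mem_ball_self hr, h.slater_mem⟩
    ⟨x, hx, hxX⟩
  exact hw2 (interior_subset hw1)

/-- Apply the normal cone inequality to the point of `X` that is farthest from `xfeas` in direction
`N`. Only the open ball is known to lie in `X`, hence the intermediate radius `r`. -/
theorem distBd_mul_norm_le (hd : 0 < d) (h : P.Assumptions c) {x N : Vec d}
    (hN : N ∈ normalCone P.X x) : P.distBd c * ‖N‖ ≤ ⟪N, x - c.xfeas⟫ := by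
  have hr := h.distBd_pos hd
  rcases (norm_nonneg N).eq_or_lt with h0 | h0
  · rw [← h0, norm_eq_zero.1 h0.symm]; simp
  · by_contra hlt
    push Not at hlt
    obtain ⟨r, hr1, hr2⟩ := exists_between
      (max_lt hr ((div_lt_iff₀ h0).2 hlt) : max 0 (⟪N, x - c.xfeas⟫ / ‖N‖) < P.distBd c)
    have hr0 : 0 < r := (le_max_left _ _).trans_lt hr1
    have hr3 := (le_max_right _ _).trans_lt hr1
    rw [div_lt_iff₀ h0] at hr3
    have hmem : c.xfeas + (r / ‖N‖) • N ∈ P.X := by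
      apply h.ball_subset
      rw [Metric.mem_ball, dist_eq_norm, add_sub_cancel_left, norm_smul,
        Real.norm_of_nonneg (by positivity), div_mul_cancel₀ _ h0.ne']
      exact hr2
    have h1 := hN _ hmem
    have e : c.xfeas + (r / ‖N‖) • N - x = (r / ‖N‖) • N - (x - c.xfeas) := by abel
    rw [e, inner_sub_right, inner_smul_right, real_inner_self_eq_norm_sq] at h1
    have e2 : r / ‖N‖ * ‖N‖ ^ 2 = r * ‖N‖ := by field_simp
    linarith

theorem tau_pos (hd : 0 < d) (hm : 0 < m) (h : P.Assumptions c) : 0 < P.tau c := by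
  have := h.gmin_pos hm
  have := h.Bg_pos hm
  have := h.distBd_pos hd
  have : (0 : ℝ) < m := by exact_mod_cast hm
  exact lt_min (by positivity) (by assumption)

theorem Bbar_pos (hd : 0 < d) (hm : 0 < m) (h : P.Assumptions c) : 0 < P.Bbar c := by
  have := h.tau_pos hd hm
  have := h.diam_pos hd
  have := h.rh_pos
  have := h.Bf_nonneg
  have := h.rho_pos
  unfold Bbar
  positivity

theorem thetaDen_pos (hd : 0 < d) (hm : 0 < m) (h : P.Assumptions c) : 0 < P.thetaDen c := by
  have hg := h.gmin_pos hm
  have ht := h.tau_pos hd hm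
  unfold thetaDen
  split_ifs with hA
  · positivity
  · have := lambdaMinPos_pos hA
    exact lt_min (by positivity) (by positivity)

theorem theta_pos (hd : 0 < d) (hm : 0 < m) (h : P.Assumptions c) : 0 < P.theta c :=
  div_pos (h.Bbar_pos hd hm) (h.thetaDen_pos hd hm)

theorem Bp_pos (hd : 0 < d) (hm : 0 < m) (h : P.Assumptions c) (s : Setup d n m) :
    0 < P.Bp c s :=
  lt_max_of_lt_right (h.theta_pos hd hm)

/-- The only property of `C_p` that correctness needs. It makes `K₁` and `C_x` large compared with
the powers of `B_p` in the estimates. -/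
theorem four_mul_Bp_add_two_le (P : Problem d n m) (c : Constants d) (s : Setup d n m) :
    4 * P.Bp c s + 2 ≤ P.Cp c s := by
  unfold Cp Chatp
  have := Real.sqrt_nonneg (P.Q c ^ 2 / P.gmin c ^ 2
    + P.Q c ^ 2 * ‖pinv (P.A * P.A.transpose) * P.A‖ ^ 2 * P.C1 c ^ 2)
  linarith

theorem C2_nonneg (hd : 0 < d) (hm : 0 < m) (h : P.Assumptions c) : 0 ≤ P.C2 c := by
  have := h.Bg_pos hm
  have := h.Lg_nonneg hd hm
  unfold C2
  positivity

theorem rho_le_C3 (hd : 0 < d) (hm : 0 < m) (h : P.Assumptions c) (s : Setup d n m) :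
    c.ρ ≤ P.C3 c s := by
  have := h.Bp_pos hd hm s
  have := h.Lg_nonneg hd hm
  have := h.Lf_nonneg hd
  have : 0 ≤ √m * c.Lg * P.Bp c s := by positivity
  unfold C3
  linarith

theorem rho_le_subLip (hd : 0 < d) (hm : 0 < m) (h : P.Assumptions c) {s : Setup d n m}
    (hs : 0 < s.β0) (k : ℕ) : c.ρ ≤ P.subLip c s k := by
  have h1 := h.rho_le_C3 hd hm s
  have := h.C2_nonneg hd hm
  have : 0 ≤ √((k : ℝ) + 1) * s.β0 * P.C2 c := by positivity
  unfold subLip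
  linarith

/-! ### The multiplier bound -/

/-- Stationarity in terms of the updated multipliers. -/
theorem exists_subgradient_decomposition (h : P.Assumptions c) {β : ℝ} (hβ : 0 < β) (y : Vec n)
    (z : Vec m) (a : Vec d) {x ζ : Vec d} (hx : x ∈ P.X)
    (hζ : ζ ∈ subdiff P.X (fun u => (P.smoothAL β y z u + c.ρ / 2 * ‖u - a‖ ^ 2)
      + (P.h u + c.ρ / 2 * ‖u - a‖ ^ 2)) x) :
    ∃ η ∈ subdiff P.X P.h x, ζ = gradient P.f x + app P.A.transpose (P.ybar β y x)
      + (∑ i, P.zbar β z x i • gradient (P.g i) x) + (2 * c.ρ) • (x - a) + η := by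
  have hq : HasGradientAt (fun u => c.ρ / 2 * ‖u - a‖ ^ 2) (c.ρ • (x - a)) x := by
    have := hasGradientAt_const_mul c.ρ (hasGradientAt_half_normSq a x)
    refine this.congr_of_eventuallyEq (Eventually.of_forall fun u => ?_)
    dsimp only
    ring
  have h1 := hasGradientAt_add (hasGradientAt_add (h.hasGradientAt_smoothAL hβ y z hx) hq) hq
  have h2 : ζ ∈ subdiff P.X (fun u => (P.smoothAL β y z u + c.ρ / 2 * ‖u - a‖ ^ 2
      + c.ρ / 2 * ‖u - a‖ ^ 2) + P.h u) x := by
    intro x' hx'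
    have := hζ x' hx'
    dsimp only at this ⊢
    linarith
  refine ⟨_, subdiff_sub_gradient h1 h.h_convex hx h2, ?_⟩
  module

theorem normSq_sub_le_inner_ybar (β : ℝ) (y : Vec n) (x : Vec d) :
    ‖P.ybar β y x‖ ^ 2 - ‖y‖ ^ 2 ≤ 2 * β * ⟪P.ybar β y x, P.res x⟫ := by
  have e : β • P.res x = P.ybar β y x - y := by simp [ybar]
  have h1 : β * ⟪P.ybar β y x, P.res x⟫ = ‖P.ybar β y x‖ ^ 2 - ⟪P.ybar β y x, y⟫ := by
    rw [← inner_smul_right, e, inner_sub_right, real_inner_self_eq_norm_sq]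
  have h2 := norm_sub_sq_real (P.ybar β y x) y
  nlinarith [sq_nonneg ‖P.ybar β y x - y‖]

/-- With the analogue for `ybar` it says that multipliers can grow in norm only if their pairing
with the constraint values is positive; this is monotonicity of the dual step. -/
theorem normSq_sub_le_sum_zbar (β : ℝ) (z : Vec m) (x : Vec d) :
    ‖P.zbar β z x‖ ^ 2 - ‖z‖ ^ 2 ≤ 2 * β * ∑ i, P.zbar β z x i * P.g i x := by
  rw [EuclideanSpace.real_norm_sq_eq, EuclideanSpace.real_norm_sq_eq, ← Finset.sum_sub_distrib,
    Finset.mul_sum]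
  refine Finset.sum_le_sum fun i _ => ?_
  rw [zbar_apply]
  rcases max_cases (z i + β * P.g i x) 0 with ⟨h1, _⟩ | ⟨h1, _⟩ <;> rw [h1]
  · nlinarith [sq_nonneg (β * P.g i x)]
  · nlinarith [sq_nonneg (z i)]

theorem norm_zbar_le_sum (β : ℝ) (z : Vec m) (x : Vec d) :
    ‖P.zbar β z x‖ ≤ ∑ i, P.zbar β z x i := by
  have h0 : ∀ i, 0 ≤ P.zbar β z x i := fun i => by rw [zbar_apply]; exact le_max_right _ _
  refine abs_le_of_sq_le_sq' ?_ (Finset.sum_nonneg fun i _ => h0 i) |>.2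
  rw [EuclideanSpace.real_norm_sq_eq]
  exact Finset.sum_sq_le_sq_sum_of_nonneg fun i _ => h0 i

/-- By contradiction: if the pair is longer than before, its pairing with the constraints is
nonnegative and can be dropped from the inner product of stationarity with `x - xfeas`. The
remaining terms bound `∑ zbar_i`, the normal vector, then `Aᵀ ybar`, and give norm at most `θ`. -/
theorem multiplier_bound (hd : 0 < d) (hm : 0 < m) (h : P.Assumptions c) {β : ℝ} (hβ : 0 < β)
    {y : Vec n} (hy : ∃ u, y = app P.A u) (z : Vec m) {a x ζ : Vec d} (ha : a ∈ P.X)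
    (hx : x ∈ P.X) (hζ1 : ‖ζ‖ ≤ 1)
    (hζ : ζ ∈ subdiff P.X (fun u => (P.smoothAL β y z u + c.ρ / 2 * ‖u - a‖ ^ 2)
      + (P.h u + c.ρ / 2 * ‖u - a‖ ^ 2)) x) :
    ‖P.ybar β y x‖ ^ 2 + ‖P.zbar β z x‖ ^ 2 ≤ max (‖y‖ ^ 2 + ‖z‖ ^ 2) (P.theta c ^ 2) := by
  obtain ⟨η, hη, hdec⟩ := h.exists_subgradient_decomposition hβ y z a hx hζ
  obtain ⟨N, hN, ξ, hξ, rfl⟩ := h.h_subdiff x hx η hη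
  by_contra hlt
  push Not at hlt
  obtain ⟨hlt1, hlt2⟩ := max_lt_iff.1 hlt
  have hyr := normSq_sub_le_inner_ybar (P := P) β y x
  have hzr := normSq_sub_le_sum_zbar (P := P) β z x
  have hzn := norm_zbar_le_sum (P := P) β z x
  have hz0 : ∀ i, 0 ≤ P.zbar β z x i := fun i => by rw [zbar_apply]; exact le_max_right _ _
  have hNr := h.distBd_mul_norm_le hd hN
  have hτ := h.tau_pos hd hm
  have hg := h.gmin_pos hm
  have hB := h.Bg_pos hm
  have hden := h.thetaDen_pos hd hm
  have hρ := h.rho_pos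
  -- Since `b = A xfeas`, the residual lies in the range of `A`; without this `Aᵀ ybar` would not
  -- control `ybar`.
  have hyb : ∃ u, P.ybar β y x = app P.A u := by
    obtain ⟨u, rfl⟩ := hy
    refine ⟨u + β • (x - c.xfeas), ?_⟩
    rw [ybar, res, ← h.slater_eq, ← app_sub, ← app_smul, ← app_add]
  set Y := P.ybar β y x
  set Z := P.zbar β z x
  set W := gradient P.f x + (2 * c.ρ) • (x - a) + ξ with hW
  have hWn : ‖W‖ ≤ c.Bf + 2 * c.ρ * P.diam + c.rh := by
    refine (norm_add₃_le).trans ?_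
    have h1 := h.Bf_bound x hx
    have h2 : ‖(2 * c.ρ) • (x - a)‖ ≤ 2 * c.ρ * P.diam := by
      rw [norm_smul, Real.norm_of_nonneg (by positivity)]
      exact mul_le_mul_of_nonneg_left (h.norm_sub_le_diam x hx a ha) (by positivity)
    linarith
  have hdec' : ζ = W + N + app P.A.transpose Y + ∑ i, Z i • gradient (P.g i) x := by
    rw [hdec, hW]; abel
  set e := x - c.xfeas with he
  have hen : ‖e‖ ≤ P.diam := h.norm_sub_le_diam x hx _ h.xfeas_mem
  -- test stationarity against `x - xfeas`
  have hinner : ⟪ζ - W, e⟫ = ⟪N, e⟫ + ⟪Y, P.res x⟫ + ∑ i, Z i * ⟪gradient (P.g i) x, e⟫ := by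
    have h1 : ζ - W = N + app P.A.transpose Y + ∑ i, Z i • gradient (P.g i) x := by
      rw [hdec']; abel
    have h2 : app P.A e = P.res x := by rw [he, app_sub, h.slater_eq, res]
    rw [h1, inner_add_left, inner_add_left, ← inner_app, h2, sum_inner]
    simp only [inner_smul_left, conj_trivial]
  have hZg : ∑ i, Z i * P.g i x + P.gmin c * ∑ i, Z i
      ≤ ∑ i, Z i * ⟪gradient (P.g i) x, e⟫ := by
    rw [Finset.mul_sum, ← Finset.sum_add_distrib]
    refine Finset.sum_le_sum fun i _ => ?_
    have h1 := gradient_mem_subdiff (h.g_diff i x hx).hasGradientAt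
      ((h.g_convex i).subset (subset_univ _) h.convex) hx _ h.xfeas_mem
    rw [← neg_sub x, ← he, inner_neg_right] at h1
    have h2 := gmin_le P c i
    have h3 := mul_le_mul_of_nonneg_left
      (show P.g i x + P.gmin c ≤ ⟪gradient (P.g i) x, e⟫ by linarith) (hz0 i)
    linarith
  have hup : ⟪ζ - W, e⟫ ≤ P.diam * (1 + c.Bf + 2 * c.ρ * P.diam + c.rh) := by
    refine (real_inner_le_norm _ _).trans ?_
    rw [mul_comm]
    refine mul_le_mul hen ((norm_sub_le _ _).trans ?_) (norm_nonneg _) (norm_nonneg _ |>.trans hen)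
    linarith
  have hpos : 0 ≤ ⟪Y, P.res x⟫ + ∑ i, Z i * P.g i x := by
    have : 0 ≤ 2 * β * (⟪Y, P.res x⟫ + ∑ i, Z i * P.g i x) := by linarith
    exact nonneg_of_mul_nonneg_right this (by positivity)
  have hmain : P.gmin c * ∑ i, Z i + P.distBd c * ‖N‖
      ≤ P.diam * (1 + c.Bf + 2 * c.ρ * P.diam + c.rh) := by linarith
  have hZsum : 0 ≤ ∑ i, Z i := Finset.sum_nonneg fun i _ => hz0 i
  have hAY : ‖app P.A.transpose Y‖
      ≤ 1 + (c.Bf + 2 * c.ρ * P.diam + c.rh) + ‖N‖ + c.Bg * ∑ i, Z i := by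
    have h1 : app P.A.transpose Y = ζ - W - N - ∑ i, Z i • gradient (P.g i) x := by
      rw [hdec']; abel
    have h2 : ‖∑ i, Z i • gradient (P.g i) x‖ ≤ c.Bg * ∑ i, Z i := by
      refine (norm_sum_le _ _).trans ?_
      rw [Finset.mul_sum]
      refine Finset.sum_le_sum fun i _ => ?_
      rw [norm_smul, Real.norm_of_nonneg (hz0 i), mul_comm]
      exact mul_le_mul_of_nonneg_right (h.Bg_bound x hx i).2 (hz0 i)
    rw [h1]
    have h3 := norm_sub_le (ζ - W - N) (∑ i, Z i • gradient (P.g i) x)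
    have h4 := norm_sub_le (ζ - W) N
    have h5 := norm_sub_le ζ W
    linarith
  have hτ1 : P.tau c * c.Bg ≤ P.gmin c / 2 := by
    have hm1 : (1 : ℝ) ≤ √m := by
      rw [Real.one_le_sqrt]
      exact_mod_cast hm
    have h1 : P.tau c ≤ P.gmin c / (2 * √m * c.Bg) := min_le_left _ _
    rw [le_div_iff₀ (by positivity)] at h1
    have h2 := mul_le_mul_of_nonneg_left hm1 (mul_pos hτ hB).le
    linarith
  have hτ2 : P.tau c ≤ P.distBd c := min_le_right _ _
  -- The role of `τ`: after multiplication by `τ`, the contributions of `N` and of `∑ Z_i` to the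
  -- bound on `Aᵀ Y` are at most `dist_bd ‖N‖` and half of `g_min ∑ Z_i`, which `hmain` pays for.
  have htot : P.tau c * ‖app P.A.transpose Y‖ + P.gmin c / 2 * ∑ i, Z i ≤ P.Bbar c := by
    have h1 := mul_le_mul_of_nonneg_left hAY hτ.le
    have h2 := mul_le_mul_of_nonneg_right hτ1 hZsum
    have h3 := mul_le_mul_of_nonneg_right hτ2 (norm_nonneg N)
    unfold Bbar
    linarith
  have hsum : P.thetaDen c * (‖Y‖ + ‖Z‖) ≤ P.Bbar c := by
    obtain ⟨u, hu⟩ := hyb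
    unfold thetaDen
    split_ifs with hA
    -- If `A = 0` the range is trivial, so only the second member of the minimum in `θ` is needed.
    · have hY0 : ‖Y‖ = 0 := by
        rw [hu, hA]
        simp [app]
      rw [hY0, zero_add]
      have : P.gmin c / 2 * ‖Z‖ ≤ P.gmin c / 2 * ∑ i, Z i := by gcongr
      have : 0 ≤ P.tau c * ‖app P.A.transpose Y‖ := by positivity
      linarith
    · have h1 := sqrt_lambdaMinPos_mul_norm_le hu
      have h2 := mul_le_mul_of_nonneg_left h1 hτ.le
      rw [mul_add]
      have h3 := mul_le_mul_of_nonneg_right (min_le_left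
        (P.tau c * √(lambdaMinPos (P.A * P.A.transpose))) (P.gmin c / 2)) (norm_nonneg Y)
      have h4 := mul_le_mul (min_le_right
        (P.tau c * √(lambdaMinPos (P.A * P.A.transpose))) (P.gmin c / 2)) hzn (norm_nonneg Z)
        (by positivity)
      linarith
  have hθ : ‖Y‖ + ‖Z‖ ≤ P.theta c := by
    rw [theta, le_div_iff₀ hden]
    linarith
  have hsq := pow_le_pow_left₀ (by positivity) hθ 2
  have hYZ := mul_nonneg (norm_nonneg Y) (norm_nonneg Z)
  linarith [add_sq ‖Y‖ ‖Z‖]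

end Assumptions

end Problem

/-! ## The outer iteration -/

section Parameters

variable {d n m : ℕ} {s : Setup d n m} {c : Constants d} {ε : ℝ}

theorem Setup.beta_pos (hs : 0 < s.β0) (k : ℕ) : 0 < s.β k := by
  unfold Setup.β
  positivity

theorem Setup.beta_mono (hs : 0 < s.β0) {j k : ℕ} (hjk : j ≤ k) : s.β j ≤ s.β k := by
  unfold Setup.β
  have : (j : ℝ) ≤ k := by exact_mod_cast hjk
  gcongr

theorem Setup.v_nonneg (hs : 0 < s.v0) (k : ℕ) : 0 ≤ s.v k := by
  unfold Setup.v
  split_ifs <;> positivity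

theorem tol_pos (hρ : 0 < c.ρ) (hs : 0 < s.β0) (hε : 0 < ε) (k : ℕ) : 0 < tol c s ε k := by
  have := s.beta_pos hs k
  exact lt_min (by positivity) (lt_min (by positivity) one_pos)

theorem tol_antitone (hρ : 0 < c.ρ) (hs : 0 < s.β0) {j k : ℕ} (hjk : j ≤ k) :
    tol c s ε k ≤ tol c s ε j := by
  have := s.beta_pos hs j
  have := Setup.beta_mono hs hjk
  unfold tol
  gcongr

theorem tol_le_one (k : ℕ) : tol c s ε k ≤ 1 :=
  (min_le_right _ _).trans (min_le_right _ _)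

theorem tol_le (k : ℕ) : tol c s ε k ≤ ε / 8 := min_le_left _ _

end Parameters

theorem normSq_convex_comb_le {k : ℕ} {t : ℝ} (h0 : 0 ≤ t) (h1 : t ≤ 1) (u v : Vec k) :
    ‖u + t • (v - u)‖ ^ 2 ≤ (1 - t) * ‖u‖ ^ 2 + t * ‖v‖ ^ 2 := by
  have h2 := norm_add_sq_real u (t • (v - u))
  rw [inner_smul_right, inner_sub_right, real_inner_self_eq_norm_sq, norm_smul, mul_pow,
    Real.norm_eq_abs, sq_abs] at h2
  have h3 := norm_sub_sq_real v u
  rw [real_inner_comm] at h3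
  have h4 : 0 ≤ t * (1 - t) * ‖v - u‖ ^ 2 :=
    mul_nonneg (mul_nonneg h0 (by linarith)) (sq_nonneg _)
  nlinarith

theorem normSq_sub_le_two {k : ℕ} (u v : Vec k) : ‖u - v‖ ^ 2 ≤ 2 * ‖u‖ ^ 2 + 2 * ‖v‖ ^ 2 := by
  have h1 := norm_sub_sq_real u v
  have h2 := norm_add_sq_real u v
  nlinarith [sq_nonneg ‖u + v‖]

/-! ### Invariance of the multiplier bound; feasibility and complementarity of the iterates -/

namespace Problem

variable {d n m : ℕ} {P : Problem d n m} {c : Constants d} {s : Setup d n m} {r : Subroutine d}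
  {ε : ℝ}

/-- The iterates stay feasible for the set constraints and the multipliers stay bounded. -/
structure Admissible (P : Problem d n m) (c : Constants d) (s : Setup d n m) (w : State d n m) :
    Prop where
  x_mem : w.x ∈ P.X
  y_mem : ∃ u, w.y = app P.A u
  z_nonneg : ∀ i, 0 ≤ w.z i
  bound : ‖w.y‖ ^ 2 + ‖w.z‖ ^ 2 ≤ P.Bp c s ^ 2

theorem Admissible.norm_z_le {w : State d n m} (hw : P.Admissible c s w) (hB : 0 ≤ P.Bp c s) :
    ‖w.z‖ ≤ P.Bp c s :=
  abs_le_of_sq_le_sq' (by nlinarith [hw.bound, sq_nonneg ‖w.y‖]) hB |>.2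

theorem infeas_nonneg (P : Problem d n m) (x : Vec d) : 0 ≤ P.infeas x := Real.sqrt_nonneg _

theorem infeas_sq (P : Problem d n m) (x : Vec d) :
    P.infeas x ^ 2 = ‖P.res x‖ ^ 2 + ‖posVec (P.gvec x)‖ ^ 2 :=
  Real.sq_sqrt (by positivity)

theorem stepsize_nonneg (hs : P.ValidSetup s) (k : ℕ) (x : Vec d) : 0 ≤ P.stepsize s k x := by
  have h1 := (s.beta_pos hs.β0_pos k).le
  have h2 := Setup.v_nonneg hs.v0_pos k
  have h3 := P.infeas_nonneg x
  unfold stepsize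
  split_ifs
  · exact h1
  · exact le_min h1 (div_nonneg h2 h3)

theorem stepsize_le_beta (P : Problem d n m) (s : Setup d n m) (k : ℕ) (x : Vec d) :
    P.stepsize s k x ≤ s.β k := by
  unfold stepsize
  split_ifs
  · exact le_rfl
  · exact min_le_left _ _

theorem stepsize_mul_infeas_le (hs : P.ValidSetup s) (k : ℕ) (x : Vec d) :
    P.stepsize s k x * P.infeas x ≤ s.v k := by
  have h2 := Setup.v_nonneg hs.v0_pos k
  unfold stepsize
  split_ifs with h
  · rw [h, mul_zero]; exact h2
  · have hpos : 0 < P.infeas x := lt_of_le_of_ne (P.infeas_nonneg x) (Ne.symm h)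
    calc _ ≤ s.v k / P.infeas x * P.infeas x :=
          mul_le_mul_of_nonneg_right (min_le_right _ _) hpos.le
      _ = _ := div_mul_cancel₀ _ h

theorem hasGradientAt_subproblem (h : P.Assumptions c) (hβ : 0 < s.β0) (k : ℕ) (w : State d n m)
    {u : Vec d} (hu : u ∈ P.X) : HasGradientAt (P.subproblem c s r ε k w).ft
      (gradient (P.smoothAL (s.β k) w.y w.z) u + c.ρ • (u - w.x)) u := by
  have h1 := (h.hasGradientAt_smoothAL (s.beta_pos hβ k) w.y w.z hu).differentiableAt.hasGradientAt
  have h2 := hasGradientAt_const_mul c.ρ (hasGradientAt_half_normSq w.x u)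
  refine (hasGradientAt_add h1 h2).congr_of_eventuallyEq (Eventually.of_forall fun v => ?_)
  simp only [subproblem]
  ring

theorem regular_subproblem (hd : 0 < d) (hm : 0 < m) (h : P.Assumptions c) (hs : P.ValidSetup s)
    (hr : P.ValidSubroutine c s r) (hε : 0 < ε) (k : ℕ) {w : State d n m}
    (hw : P.Admissible c s w) : (P.subproblem c s r ε k w).Regular (P.subLip c s k) where
  compact := h.compact
  int_nonempty := h.int_nonempty
  ft_diff := fun u hu => (hasGradientAt_subproblem h hs.β0_pos k w hu).differentiableAt
  ft_convex := h.convexOn_smoothAL (s.beta_pos hs.β0_pos k) w.y w.z w.x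
  ft_lip := by
    intro u hu v hv
    rw [(hasGradientAt_subproblem h hs.β0_pos k w hu).gradient,
      (hasGradientAt_subproblem h hs.β0_pos k w hv).gradient]
    have h1 := h.gradient_smoothAL_lip hd hm (s.beta_pos hs.β0_pos k) w.y hw.z_nonneg hu hv
    have e : ∀ a b : Vec d, a + c.ρ • (u - w.x) - (b + c.ρ • (v - w.x))
        = (a - b) + c.ρ • (u - v) := by intros; module
    rw [e]
    refine (norm_add_le _ _).trans ?_
    rw [norm_smul, Real.norm_of_nonneg h.rho_pos.le]
    have h2 : √m * c.Lg * ‖w.z‖ ≤ √m * c.Lg * P.Bp c s := by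
      have := h.Lg_nonneg hd hm
      have := hw.norm_z_le (h.Bp_pos hd hm s).le
      gcongr
    -- The multiplier bound makes the smoothness constant explicit, uniformly over all possible
    -- iterates.
    have h3 : (c.Lf + √m * c.Lg * ‖w.z‖ + s.β k * P.C2 c) + c.ρ ≤ P.subLip c s k := by
      unfold subLip C3 Setup.β
      linarith
    have h4 := mul_le_mul_of_nonneg_right h3 (norm_nonneg (u - v))
    linarith
  ht_cont := by
    have := h.h_cont
    unfold subproblem
    fun_prop
  ht_strong := strongConvexOn_add_half_normSq h.h_convex c.ρ w.x
  mu_pos := h.rho_pos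
  mu_le := h.rho_le_subLip hd hm hs.β0_pos k
  start_mem := hr.start_mem k
  L0_pos := hr.L0_pos k
  L0_le := hr.L0_le k
  gammau_eq := rfl
  gammad_ge := hr.γd_ge
  tol_pos := tol_pos h.rho_pos hs.β0_pos hε k

theorem zbar_sub_apply (hβ : 0 < s.β0) (k : ℕ) (z : Vec m) (x : Vec d) (i : Fin m) :
    P.zbar (s.β k) z x i - z i = s.β k * max (-(z i / s.β k)) (P.g i x) := by
  have hb := s.beta_pos hβ k
  rw [zbar_apply, mul_max_of_nonneg _ _ hb.le, mul_neg, mul_div_cancel₀ _ hb.ne', max_comm,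
    ← max_sub_sub_right, zero_sub, add_sub_cancel_left]

/-- The updated dual variables are convex combinations. -/
theorem outerStep_y (hβ : 0 < s.β0) (k : ℕ) (w : State d n m) :
    (P.outerStep c s r ε k w).y = w.y + (P.stepsize s k (P.outerStep c s r ε k w).x / s.β k)
      • (P.ybar (s.β k) w.y (P.outerStep c s r ε k w).x - w.y) := by
  have hb := s.beta_pos hβ k
  rw [ybar, add_sub_cancel_left, smul_smul, div_mul_cancel₀ _ hb.ne']
  rfl

theorem outerStep_z (hβ : 0 < s.β0) (k : ℕ) (w : State d n m) :
    (P.outerStep c s r ε k w).z = w.z + (P.stepsize s k (P.outerStep c s r ε k w).x / s.β k)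
      • (P.zbar (s.β k) w.z (P.outerStep c s r ε k w).x - w.z) := by
  have hb := s.beta_pos hβ k
  ext i
  rw [PiLp.add_apply, PiLp.smul_apply, PiLp.sub_apply, zbar_sub_apply hβ, smul_eq_mul,
    ← mul_assoc, div_mul_cancel₀ _ hb.ne']
  rfl

/-- The output of a subproblem is feasible for `X` and approximately stationary. -/
theorem outerStep_spec (hd : 0 < d) (hm : 0 < m) (h : P.Assumptions c) (hs : P.ValidSetup s)
    (hr : P.ValidSubroutine c s r) (hε : 0 < ε) (k : ℕ) {w : State d n m}
    (hw : P.Admissible c s w) : (P.outerStep c s r ε k w).x ∈ P.X ∧ ∃ ζ : Vec d,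
      ‖ζ‖ ≤ tol c s ε k ∧
      ζ ∈ subdiff P.X (fun u => (P.smoothAL (s.β k) w.y w.z u + c.ρ / 2 * ‖u - w.x‖ ^ 2)
        + (P.h u + c.ρ / 2 * ‖u - w.x‖ ^ 2)) (P.outerStep c s r ε k w).x := by
  have hreg := regular_subproblem hd hm h hs hr hε k hw
  obtain ⟨ζ, hζ, hn⟩ := hreg.exists_output_subgradient
  exact ⟨hreg.output_mem, ζ, hn, hζ⟩

theorem updated_multiplier_bound (hd : 0 < d) (hm : 0 < m) (h : P.Assumptions c)
    (hs : P.ValidSetup s) (hr : P.ValidSubroutine c s r) (hε : 0 < ε) (k : ℕ) {w : State d n m}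
    (hw : P.Admissible c s w) :
    ‖P.ybar (s.β k) w.y (P.outerStep c s r ε k w).x‖ ^ 2
      + ‖P.zbar (s.β k) w.z (P.outerStep c s r ε k w).x‖ ^ 2 ≤ P.Bp c s ^ 2 := by
  obtain ⟨hx, ζ, hn, hζ⟩ := outerStep_spec hd hm h hs hr hε k hw
  refine (h.multiplier_bound hd hm (s.beta_pos hs.β0_pos k) hw.y_mem w.z hw.x_mem hx
    (hn.trans (tol_le_one k)) hζ).trans (max_le hw.bound ?_)
  exact pow_le_pow_left₀ (h.theta_pos hd hm).le (le_max_right _ _) 2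

/-- As `α_k ≤ β_k`, the new multipliers are convex combinations, with weight `α_k/β_k`, of the old
and the full-step ones. Both lie in the ball of radius `B_p` and in the cone `z ≥ 0`. -/
theorem admissible_outerStep (hd : 0 < d) (hm : 0 < m) (h : P.Assumptions c)
    (hs : P.ValidSetup s) (hr : P.ValidSubroutine c s r) (hε : 0 < ε) (k : ℕ) {w : State d n m}
    (hw : P.Admissible c s w) : P.Admissible c s (P.outerStep c s r ε k w) := by
  have hb := s.beta_pos hs.β0_pos k
  obtain ⟨hx, -⟩ := outerStep_spec hd hm h hs hr hε k hw
  have hbd := updated_multiplier_bound hd hm h hs hr hε k hw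
  set t := P.stepsize s k (P.outerStep c s r ε k w).x / s.β k with ht
  have ht0 : 0 ≤ t := div_nonneg (stepsize_nonneg hs k _) hb.le
  have ht1 : t ≤ 1 := (div_le_one hb).2 (stepsize_le_beta P s k _)
  refine ⟨hx, ?_, fun i => ?_, ?_⟩
  · obtain ⟨u, hu⟩ := hw.y_mem
    refine ⟨u + (t * s.β k) • ((P.outerStep c s r ε k w).x - c.xfeas), ?_⟩
    rw [outerStep_y hs.β0_pos, ← ht, ybar, add_sub_cancel_left, res, ← h.slater_eq, ← app_sub,
      hu, app_add, app_smul, smul_smul]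
  · rw [outerStep_z hs.β0_pos, ← ht, PiLp.add_apply, PiLp.smul_apply, PiLp.sub_apply, zbar_apply,
      smul_eq_mul]
    have h1 := hw.z_nonneg i
    have h2 := le_max_right (w.z i + s.β k * P.g i (P.outerStep c s r ε k w).x) 0
    nlinarith
  · have h1 := normSq_convex_comb_le ht0 ht1 w.y
      (P.ybar (s.β k) w.y (P.outerStep c s r ε k w).x)
    have h2 := normSq_convex_comb_le ht0 ht1 w.z
      (P.zbar (s.β k) w.z (P.outerStep c s r ε k w).x)
    rw [ht, ← outerStep_y hs.β0_pos, ← ht] at h1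
    rw [ht, ← outerStep_z hs.β0_pos, ← ht] at h2
    have h3 := mul_le_mul_of_nonneg_left hbd ht0
    have h4 := mul_le_mul_of_nonneg_left hw.bound (sub_nonneg.2 ht1)
    linarith

theorem admissible_iterate (hd : 0 < d) (hm : 0 < m) (h : P.Assumptions c)
    (hs : P.ValidSetup s) (hr : P.ValidSubroutine c s r) (hε : 0 < ε) (k : ℕ) :
    P.Admissible c s (P.iterate c s r ε k) := by
  induction k with
  | zero =>
    refine ⟨hs.x0_mem, hs.y0_mem, hs.z0_nonneg, ?_⟩
    have h1 : √(‖s.y0‖ ^ 2 + ‖s.z0‖ ^ 2) ≤ P.Bp c s := le_max_left _ _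
    have h2 := pow_le_pow_left₀ (Real.sqrt_nonneg _) h1 2
    rwa [Real.sq_sqrt (by positivity)] at h2
  | succ k ih => exact admissible_outerStep hd hm h hs hr hε k ih

theorem regular_call (hd : 0 < d) (hm : 0 < m) (h : P.Assumptions c) (hs : P.ValidSetup s)
    (hr : P.ValidSubroutine c s r) (hε : 0 < ε) (k : ℕ) :
    (P.call c s r ε k).Regular (P.subLip c s k) :=
  regular_subproblem hd hm h hs hr hε k (admissible_iterate hd hm h hs hr hε k)

theorem posVec_sq_le {β t z : ℝ} (hz : 0 ≤ z) :
    β ^ 2 * max t 0 ^ 2 ≤ (max (z + β * t) 0 - z) ^ 2 ∨ β < 0 := by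
  rcases lt_or_ge β 0 with hβ | hβ
  · exact Or.inr hβ
  · left
    rcases le_total t 0 with ht | ht
    · rw [max_eq_right ht]
      simpa using sq_nonneg _
    · rw [max_eq_left ht, max_eq_left (by positivity)]
      exact le_of_eq (by ring)

/-- Primal feasibility after an outer iteration. -/
theorem beta_mul_infeas_le (hd : 0 < d) (hm : 0 < m) (h : P.Assumptions c)
    (hs : P.ValidSetup s) (hr : P.ValidSubroutine c s r) (hε : 0 < ε) (k : ℕ) {w : State d n m}
    (hw : P.Admissible c s w) :
    s.β k * P.infeas (P.outerStep c s r ε k w).x ≤ 2 * P.Bp c s := by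
  have hb := s.beta_pos hs.β0_pos k
  have hbd := updated_multiplier_bound hd hm h hs hr hε k hw
  set x := (P.outerStep c s r ε k w).x
  have hB := h.Bp_pos hd hm s
  refine abs_le_of_sq_le_sq' ?_ (by positivity) |>.2
  rw [mul_pow, infeas_sq, mul_add]
  -- The scaled violation is at most the displacement between two multiplier pairs of norm at most
  -- `B_p`.
  have h1 : s.β k ^ 2 * ‖P.res x‖ ^ 2 = ‖P.ybar (s.β k) w.y x - w.y‖ ^ 2 := by
    rw [ybar, add_sub_cancel_left, norm_smul, mul_pow, Real.norm_eq_abs, sq_abs]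
  have h2 : s.β k ^ 2 * ‖posVec (P.gvec x)‖ ^ 2 ≤ ‖P.zbar (s.β k) w.z x - w.z‖ ^ 2 := by
    rw [EuclideanSpace.real_norm_sq_eq, EuclideanSpace.real_norm_sq_eq, Finset.mul_sum]
    refine Finset.sum_le_sum fun i _ => ?_
    rw [PiLp.sub_apply, zbar_apply]
    exact (posVec_sq_le (hw.z_nonneg i)).resolve_right hb.le.not_gt
  have h3 := normSq_sub_le_two (P.ybar (s.β k) w.y x) w.y
  have h4 := normSq_sub_le_two (P.zbar (s.β k) w.z x) w.z
  have h5 := hw.bound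
  nlinarith

/-- Complementary slackness after an outer iteration. -/
theorem beta_mul_compl_le (hd : 0 < d) (hm : 0 < m) (h : P.Assumptions c)
    (hs : P.ValidSetup s) (hr : P.ValidSubroutine c s r) (hε : 0 < ε) (k : ℕ) {w : State d n m}
    (hw : P.Admissible c s w) :
    s.β k * ∑ i, |P.zbar (s.β k) w.z (P.outerStep c s r ε k w).x i
      * P.g i (P.outerStep c s r ε k w).x| ≤ 2 * P.Bp c s ^ 2 := by
  have hb := s.beta_pos hs.β0_pos k
  have hbd := updated_multiplier_bound hd hm h hs hr hε k hw
  set x := (P.outerStep c s r ε k w).x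
  -- Where `zbar_i > 0` one has `β g_i = zbar_i - z_i`, so `β |g_i| ≤ zbar_i + z_i`; the product
  -- with `zbar_i` is split by Young's inequality.
  have h1 : s.β k * ∑ i, |P.zbar (s.β k) w.z x i * P.g i x|
      ≤ 3 / 2 * ‖P.zbar (s.β k) w.z x‖ ^ 2 + 1 / 2 * ‖w.z‖ ^ 2 := by
    rw [EuclideanSpace.real_norm_sq_eq, EuclideanSpace.real_norm_sq_eq, Finset.mul_sum,
      Finset.mul_sum, Finset.mul_sum, ← Finset.sum_add_distrib]
    refine Finset.sum_le_sum fun i _ => ?_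
    have hz := hw.z_nonneg i
    rw [zbar_apply]
    rcases max_cases (w.z i + s.β k * P.g i x) 0 with ⟨h2, h3⟩ | ⟨h2, h3⟩ <;> rw [h2]
    · rw [abs_mul, abs_of_nonneg h3]
      have h4 : s.β k * |P.g i x| ≤ (w.z i + s.β k * P.g i x) + w.z i := by
        rw [← abs_of_pos hb, ← abs_mul, abs_of_pos hb, abs_le]
        constructor <;> linarith
      nlinarith [mul_le_mul_of_nonneg_left h4 h3, sq_nonneg (s.β k * P.g i x)]
    · simp
      positivity
  have h5 := hw.bound
  nlinarith [sq_nonneg ‖P.ybar (s.β k) w.y x‖, sq_nonneg ‖w.y‖]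

/-- The certificate is the full-step pair, not the damped one. The residual is `ζ - 2ρ (x^{k+1} -
x^k)`, and the tolerance `ε/8` leaves `7ε/8` for the proximal term. -/
theorem isKKT_outerStep (hd : 0 < d) (hm : 0 < m) (h : P.Assumptions c)
    (hs : P.ValidSetup s) (hr : P.ValidSubroutine c s r) (hε : 0 < ε) (k : ℕ) {w : State d n m}
    (hw : P.Admissible c s w) (h1 : 2 * P.Bp c s ≤ s.β k * ε)
    (h2 : 2 * P.Bp c s ^ 2 ≤ s.β k * ε)
    (h3 : 2 * c.ρ * ‖(P.outerStep c s r ε k w).x - w.x‖ ≤ 7 / 8 * ε) :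
    P.IsKKT c.ρ ε (P.outerStep c s r ε k w).x := by
  have hb := s.beta_pos hs.β0_pos k
  have hinf := beta_mul_infeas_le hd hm h hs hr hε k hw
  have hcom := beta_mul_compl_le hd hm h hs hr hε k hw
  obtain ⟨hx, ζ, hn, hζ⟩ := outerStep_spec hd hm h hs hr hε k hw
  set x := (P.outerStep c s r ε k w).x
  refine ⟨hx, P.ybar (s.β k) w.y x, P.zbar (s.β k) w.z x,
    fun i => by rw [zbar_apply]; exact le_max_right _ _, ?_,
    le_of_mul_le_mul_left (hinf.trans h1) hb, le_of_mul_le_mul_left (hcom.trans h2) hb⟩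
  obtain ⟨η, hη, hdec⟩ := h.exists_subgradient_decomposition hb w.y w.z w.x hx hζ
  have hmem : gradient P.f x + η ∈ weakSubdiff c.ρ P.X P.F x := by
    have hq := hasGradientAt_const_mul c.ρ (hasGradientAt_half_normSq (0 : Vec d) x)
    have hg := hasGradientAt_add (h.f_diff x hx).hasGradientAt hq
    have hc : ConvexOn ℝ P.X (fun u => P.f u + c.ρ * (1 / 2 * ‖u - 0‖ ^ 2)) := by
      refine ConvexOn.congr h.weaklyConvex fun u _ => ?_
      rw [sub_zero]; ring
    have := subdiff_add (gradient_mem_subdiff hg hc hx) hη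
    rw [sub_zero] at this
    intro x' hx'
    have h4 := this x' hx'
    simp only [sub_zero] at h4
    have e : gradient P.f x + η + c.ρ • x = gradient P.f x + c.ρ • x + η := by abel
    rw [e]
    simp only [F]
    linarith
  refine distZeroLE_of_mem (mem_image_of_mem _ hmem) ?_
  have e : gradient P.f x + η + ∑ i, P.zbar (s.β k) w.z x i • gradient (P.g i) x
      + app P.A.transpose (P.ybar (s.β k) w.y x) = ζ - (2 * c.ρ) • (x - w.x) := by
    rw [hdec]; abel
  rw [e]
  refine (norm_sub_le _ _).trans ?_
  have hρ := h.rho_pos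
  rw [norm_smul, Real.norm_of_nonneg (by positivity)]
  linarith [tol_le (c := c) (s := s) (ε := ε) k]

end Problem

/-! ## Decrease of the augmented Lagrangian and correctness -/

/-- Telescoping form of the convergence of `∑ 1/(x log² x)`. It uses `log (x+1) ≤ 2 log x` and `log
(x+1) - log x ≥ 1/(x+1) ≥ 2/(3x)`. -/
theorem one_div_mul_log_sq_le {x : ℝ} (hx : 2 ≤ x) :
    1 / (x * Real.log x ^ 2) ≤ 3 * (1 / Real.log x - 1 / Real.log (x + 1)) := by
  have h0 : 0 < Real.log x := Real.log_pos (by linarith)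
  have h1 : Real.log (x + 1) ≤ 2 * Real.log x := by
    rw [← Real.log_rpow (by linarith)]
    exact Real.log_le_log (by linarith) (by norm_num; nlinarith)
  have h2 : 1 / (x + 1) ≤ Real.log (x + 1) - Real.log x := by
    have h3 := Real.one_sub_inv_le_log_of_pos (show 0 < (x + 1) / x by positivity)
    rw [Real.log_div (by linarith) (by linarith)] at h3
    refine le_trans (le_of_eq ?_) h3
    field_simp
    ring
  have h3 : Real.log x < Real.log (x + 1) := Real.log_lt_log (by linarith) (by linarith)
  have h4 : 0 < Real.log (x + 1) := h0.trans h3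
  have e : 3 * (1 / Real.log x - 1 / Real.log (x + 1))
      = 3 * (Real.log (x + 1) - Real.log x) / (Real.log x * Real.log (x + 1)) := by
    field_simp
  rw [e, div_le_div_iff₀ (by positivity) (by positivity)]
  have h5 : 1 / (2 * x) * (2 * x) = 1 := by field_simp
  have h6 : 2 ≤ 3 * (Real.log (x + 1) - Real.log x) * x := by
    have h7 : (2 : ℝ) ≤ 3 * (1 / (x + 1)) * x := by
      rw [mul_one_div, div_mul_eq_mul_div, le_div_iff₀ (by linarith)]
      linarith
    refine h7.trans ?_
    gcongr
  calc 1 * (Real.log x * Real.log (x + 1)) ≤ Real.log x * (2 * Real.log x) := by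
        rw [one_mul]; gcongr
    _ = 2 * Real.log x ^ 2 := by ring
    _ ≤ 3 * (Real.log (x + 1) - Real.log x) * x * Real.log x ^ 2 := by gcongr
    _ = _ := by ring

theorem Setup.v_div_beta_le {d n m : ℕ} {s : Setup d n m} (hβ : 0 < s.β0) (hv : 0 < s.v0) {k : ℕ}
    (hk : 1 ≤ k) : s.v k / s.β k
      ≤ 3 * (s.v0 / s.β0) * (1 / Real.log (k + 1) - 1 / Real.log ((k + 1 : ℕ) + 1)) := by
  have hk' : (1 : ℝ) ≤ k := by exact_mod_cast hk
  have h1 := one_div_mul_log_sq_le (show (2 : ℝ) ≤ k + 1 by linarith)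
  have h2 : s.v k / s.β k = s.v0 / s.β0 * (1 / (((k : ℝ) + 1) * Real.log (k + 1) ^ 2)) := by
    have h3 : √((k : ℝ) + 1) * √((k : ℝ) + 1) = k + 1 := Real.mul_self_sqrt (by positivity)
    unfold Setup.v Setup.β
    rw [if_neg (by omega)]
    calc _ = s.v0 / s.β0 * (1 / ((√((k : ℝ) + 1) * √((k : ℝ) + 1)) * Real.log (k + 1) ^ 2)) := by
          field_simp
      _ = _ := by rw [h3]
  rw [h2]
  push_cast
  calc _ ≤ _ := mul_le_mul_of_nonneg_left h1 (by positivity)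
    _ = _ := by ring

theorem Setup.beta_succ_le {d n m : ℕ} {s : Setup d n m} (hβ : 0 < s.β0) (k : ℕ) :
    s.β (k + 1) ≤ 3 / 2 * s.β k := by
  unfold Setup.β
  have h1 : √((k + 1 : ℕ) + 1) ≤ 3 / 2 * √((k : ℝ) + 1) := by
    rw [show (3 / 2 : ℝ) = √(9 / 4) by rw [show (9 / 4 : ℝ) = (3 / 2) ^ 2 by norm_num,
      Real.sqrt_sq (by norm_num)], ← Real.sqrt_mul (by norm_num)]
    apply Real.sqrt_le_sqrt
    push_cast
    have : (0 : ℝ) ≤ k := Nat.cast_nonneg k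
    linarith
  nlinarith

/-- For `g ≥ 0` expand the square and use `α ≤ β`; for `g ≤ 0` the multiplier does not increase, so
neither does the penalty. -/
theorem max_sq_dual_le {β z z' g α : ℝ} (hβ : 0 < β) (hz : 0 ≤ z) (hα : 0 ≤ α) (hαβ : α ≤ β)
    (hz' : z' = z + α * max (-(z / β)) g) :
    1 / (2 * β) * max (z' + β * g) 0 ^ 2 ≤ 1 / (2 * β) * max (z + β * g) 0 ^ 2
      + 3 / 2 * (α * max g 0 ^ 2) + α / β * (max g 0 * z) := by
  have hzβ : 0 ≤ z / β := by positivity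
  rcases le_total 0 g with hg | hg
  · rw [max_eq_right (by linarith)] at hz'
    rw [hz', max_eq_left (by positivity), max_eq_left (by positivity), max_eq_left hg]
    have h1 : 1 / (2 * β) * (α * g) ^ 2 ≤ 1 / 2 * (α * g ^ 2) := by
      rw [div_mul_eq_mul_div, div_le_iff₀ (by positivity)]
      have : α * (α * g ^ 2) ≤ β * (α * g ^ 2) := by gcongr
      linarith
    have e : 1 / (2 * β) * (z + α * g + β * g) ^ 2 = 1 / (2 * β) * (z + β * g) ^ 2
        + 1 / (2 * β) * (α * g) ^ 2 + α * g ^ 2 + α / β * (g * z) := by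
      field_simp; ring
    rw [e]
    linarith
  · have h1 : z' ≤ z := by
      have : max (-(z / β)) g ≤ 0 := max_le (by linarith) hg
      rw [hz']
      nlinarith
    rw [max_eq_right hg]
    have : max (z' + β * g) 0 ≤ max (z + β * g) 0 := by gcongr
    have h3 : 1 / (2 * β) * max (z' + β * g) 0 ^ 2 ≤ 1 / (2 * β) * max (z + β * g) 0 ^ 2 := by
      gcongr
    simpa using h3

theorem max_sq_penalty_le {β β' z g : ℝ} (hβ : 0 < β) (hββ : β ≤ β') (hz : 0 ≤ z) :
    1 / (2 * β') * max (z + β' * g) 0 ^ 2 ≤ 1 / (2 * β) * max (z + β * g) 0 ^ 2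
      + (β' - β) / 2 * max g 0 ^ 2 := by
  have hβ' := hβ.trans_le hββ
  have hinv : 1 / (2 * β') ≤ 1 / (2 * β) := by gcongr
  rcases le_total 0 g with hg | hg
  · rw [max_eq_left (by positivity), max_eq_left (by positivity), max_eq_left hg]
    have e : ∀ b : ℝ, 0 < b → 1 / (2 * b) * (z + b * g) ^ 2
        = 1 / (2 * b) * z ^ 2 + z * g + b / 2 * g ^ 2 := by
      intro b hb
      field_simp
      ring
    rw [e β hβ, e β' hβ']
    have := mul_le_mul_of_nonneg_right hinv (sq_nonneg z)
    linarith
  · rw [max_eq_right hg]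
    have h1 : max (z + β' * g) 0 ≤ max (z + β * g) 0 := by
      have : β' * g ≤ β * g := mul_le_mul_of_nonpos_right hββ hg
      gcongr
    have h2 : 1 / (2 * β') * max (z + β' * g) 0 ^ 2 ≤ 1 / (2 * β) * max (z + β * g) 0 ^ 2 := by
      gcongr
    simpa using h2

/-! ### Merit function, potential and correctness -/

namespace Problem

variable {d n m : ℕ} {P : Problem d n m} {c : Constants d} {s : Setup d n m} {r : Subroutine d}
  {ε : ℝ}

/-- The augmented Lagrangian without the term `-‖z‖² / (2 β)`. -/
noncomputable def merit (P : Problem d n m) (β : ℝ) (y : Vec n) (z : Vec m) (x : Vec d) : ℝ :=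
  P.F x + ⟪y, P.res x⟫ + β / 2 * ‖P.res x‖ ^ 2
    + ∑ i, 1 / (2 * β) * max (z i + β * P.g i x) 0 ^ 2

theorem smoothAL_add_h {β : ℝ} (hβ : 0 < β) (y : Vec n) (z : Vec m) (x : Vec d) :
    P.smoothAL β y z x + P.h x = P.merit β y z x - ‖z‖ ^ 2 / (2 * β) := by
  rw [smoothAL, normSq_posVec_scaled hβ, merit, F]
  ring

theorem normSq_posVec_gvec (P : Problem d n m) (x : Vec d) :
    ‖posVec (P.gvec x)‖ ^ 2 = ∑ i, max (P.g i x) 0 ^ 2 := by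
  rw [EuclideanSpace.real_norm_sq_eq]
  rfl

theorem sum_max_mul_le (P : Problem d n m) (z : Vec m) (x : Vec d) :
    ∑ i, max (P.g i x) 0 * z i ≤ ‖posVec (P.gvec x)‖ * ‖z‖ := by
  have h1 := real_inner_le_norm (posVec (P.gvec x)) z
  have h2 : ⟪posVec (P.gvec x), z⟫ = ∑ i, max (P.g i x) 0 * z i := by
    rw [PiLp.inner_apply]
    refine Finset.sum_congr rfl fun i _ => ?_
    simp [posVec, gvec, mul_comm]
  rwa [h2] at h1

theorem norm_res_le_infeas (P : Problem d n m) (x : Vec d) : ‖P.res x‖ ≤ P.infeas x :=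
  Real.le_sqrt_of_sq_le (by nlinarith [sq_nonneg ‖posVec (P.gvec x)‖])

theorem norm_posVec_le_infeas (P : Problem d n m) (x : Vec d) :
    ‖posVec (P.gvec x)‖ ≤ P.infeas x :=
  Real.le_sqrt_of_sq_le (by nlinarith [sq_nonneg ‖P.res x‖])

/-- Sufficient decrease in the primal variable. -/
theorem primal_decrease (hd : 0 < d) (hm : 0 < m) (h : P.Assumptions c)
    (hs : P.ValidSetup s) (hr : P.ValidSubroutine c s r) (hε : 0 < ε) (k : ℕ) {w : State d n m}
    (hw : P.Admissible c s w) :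
    3 / 2 * c.ρ * ‖(P.outerStep c s r ε k w).x - w.x‖ ^ 2
        - tol c s ε k * ‖(P.outerStep c s r ε k w).x - w.x‖
      ≤ P.merit (s.β k) w.y w.z w.x - P.merit (s.β k) w.y w.z (P.outerStep c s r ε k w).x := by
  have hb := s.beta_pos hs.β0_pos k
  obtain ⟨hx, ζ, hn, hζ⟩ := outerStep_spec hd hm h hs hr hε k hw
  set x := (P.outerStep c s r ε k w).x
  have hst := (regular_subproblem hd hm h hs hr hε k hw).phi_strong
  -- The factor `3/2` is the sum of `ρ` from the two proximal terms, which vanish at the old point,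
  -- and `ρ/2` from quadratic growth.
  have h1 := subdiff_growth hst hx hζ hw.x_mem
  have e1 := smoothAL_add_h (P := P) hb w.y w.z x
  have e2 := smoothAL_add_h (P := P) hb w.y w.z w.x
  have h2 : -(tol c s ε k * ‖x - w.x‖) ≤ ⟪ζ, w.x - x⟫ := by
    have h3 := neg_le_of_abs_le (abs_real_inner_le_norm ζ (w.x - x))
    rw [norm_sub_rev] at h3
    have := mul_le_mul_of_nonneg_right hn (norm_nonneg (x - w.x))
    linarith
  simp only [subproblem, sub_self, norm_zero] at h1
  rw [norm_sub_rev w.x x] at h1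
  nlinarith

/-- Increase of the merit function caused by the dual step. -/
theorem dual_increase (hd : 0 < d) (hm : 0 < m) (h : P.Assumptions c)
    (hs : P.ValidSetup s) (hr : P.ValidSubroutine c s r) (hε : 0 < ε) (k : ℕ) {w : State d n m}
    (hw : P.Admissible c s w) :
    P.merit (s.β k) (P.outerStep c s r ε k w).y (P.outerStep c s r ε k w).z
        (P.outerStep c s r ε k w).x
      ≤ P.merit (s.β k) w.y w.z (P.outerStep c s r ε k w).x
        + 4 * P.Bp c s * (s.v k / s.β k) := by
  have hb := s.beta_pos hs.β0_pos k
  have hinf := beta_mul_infeas_le hd hm h hs hr hε k hw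
  have hB := h.Bp_pos hd hm s
  have hy : (P.outerStep c s r ε k w).y = w.y + P.stepsize s k (P.outerStep c s r ε k w).x
    • P.res (P.outerStep c s r ε k w).x := rfl
  have hz : ∀ i, (P.outerStep c s r ε k w).z i = w.z i
    + P.stepsize s k (P.outerStep c s r ε k w).x * max (-(w.z i / s.β k))
      (P.g i (P.outerStep c s r ε k w).x) := fun i => rfl
  set x := (P.outerStep c s r ε k w).x
  have hα0 := stepsize_nonneg hs k x
  have hαβ := stepsize_le_beta P s k x
  have hαi := stepsize_mul_infeas_le hs k x
  set α := P.stepsize s k x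
  have h1 := Finset.sum_le_sum fun i (_ : i ∈ Finset.univ) =>
    max_sq_dual_le hb (hw.z_nonneg i) hα0 hαβ (hz i)
  rw [Finset.sum_add_distrib, Finset.sum_add_distrib, ← Finset.mul_sum _ _ (3 / 2 : ℝ),
    ← Finset.mul_sum _ _ α, ← Finset.mul_sum _ _ (α / s.β k), ← normSq_posVec_gvec] at h1
  have h2 : α / s.β k * ∑ i, max (P.g i x) 0 * w.z i ≤ s.v k * P.Bp c s / s.β k := by
    have h3 : ∑ i, max (P.g i x) 0 * w.z i ≤ P.infeas x * P.Bp c s :=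
      (sum_max_mul_le P w.z x).trans (mul_le_mul (norm_posVec_le_infeas P x)
        (hw.norm_z_le hB.le) (norm_nonneg _) (P.infeas_nonneg x))
    rw [div_mul_eq_mul_div]
    refine div_le_div_of_nonneg_right ?_ hb.le
    calc _ ≤ α * (P.infeas x * P.Bp c s) := mul_le_mul_of_nonneg_left h3 hα0
      _ = α * P.infeas x * P.Bp c s := by ring
      _ ≤ _ := mul_le_mul_of_nonneg_right hαi hB.le
  -- One factor of the violation is damped by `α · infeas ≤ v_k`, the other is at most `2 B_p/β_k`.
  -- With weight `3/2` this gives `3`, and the cross term gives `1`; hence the `4`.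
  have h4 : α * P.infeas x ^ 2 ≤ 2 * (s.v k * P.Bp c s / s.β k) := by
    have h5 : P.infeas x ≤ 2 * P.Bp c s / s.β k := by
      rw [le_div_iff₀ hb]; linarith
    calc α * P.infeas x ^ 2 = α * P.infeas x * P.infeas x := by ring
      _ ≤ s.v k * (2 * P.Bp c s / s.β k) :=
        mul_le_mul hαi h5 (P.infeas_nonneg x) (Setup.v_nonneg hs.v0_pos k)
      _ = _ := by ring
  rw [infeas_sq] at h4
  have h6 : 0 ≤ α * ‖P.res x‖ ^ 2 := by positivity
  have e : 4 * P.Bp c s * (s.v k / s.β k) = 4 * (s.v k * P.Bp c s / s.β k) := by ring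
  rw [e, merit, merit, hy, inner_add_left, inner_smul_left, real_inner_self_eq_norm_sq]
  simp only [conj_trivial]
  linarith

/-- Increase of the merit function caused by a larger penalty parameter. -/
theorem penalty_increase {β β' : ℝ} (hβ : 0 < β) (hββ : β ≤ β') (y : Vec n) {z : Vec m}
    (hz : ∀ i, 0 ≤ z i) (x : Vec d) :
    P.merit β' y z x ≤ P.merit β y z x + (β' - β) / 2 * P.infeas x ^ 2 := by
  have h1 := Finset.sum_le_sum fun i (_ : i ∈ Finset.univ) =>
    max_sq_penalty_le (g := P.g i x) hβ hββ (hz i)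
  rw [Finset.sum_add_distrib, ← Finset.mul_sum _ _ ((β' - β) / 2), ← normSq_posVec_gvec] at h1
  rw [infeas_sq, merit, merit]
  linarith

/-- The merit function along the iterates, with the terms that account for its increases. -/
noncomputable def potential (P : Problem d n m) (c : Constants d) (s : Setup d n m)
    (r : Subroutine d) (ε : ℝ) (k : ℕ) : ℝ :=
  P.merit (s.β k) (P.iterate c s r ε k).y (P.iterate c s r ε k).z (P.iterate c s r ε k).x
    + 12 * P.Bp c s * (s.v0 / s.β0) * (1 / Real.log (k + 1)) + 3 * P.Bp c s ^ 2 * (1 / s.β k)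

theorem potential_decrease (hd : 0 < d) (hm : 0 < m) (h : P.Assumptions c)
    (hs : P.ValidSetup s) (hr : P.ValidSubroutine c s r) (hε : 0 < ε) {k : ℕ} (hk : 1 ≤ k) :
    3 / 2 * c.ρ * ‖(P.iterate c s r ε (k + 1)).x - (P.iterate c s r ε k).x‖ ^ 2
        - tol c s ε k * ‖(P.iterate c s r ε (k + 1)).x - (P.iterate c s r ε k).x‖
      ≤ P.potential c s r ε k - P.potential c s r ε (k + 1) := by
  have hw := admissible_iterate hd hm h hs hr hε k
  have hw' := admissible_outerStep hd hm h hs hr hε k hw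
  have hB := h.Bp_pos hd hm s
  have hb := s.beta_pos hs.β0_pos k
  have hb' := s.beta_pos hs.β0_pos (k + 1)
  have hmono := Setup.beta_mono hs.β0_pos (Nat.le_succ k)
  have hratio := Setup.beta_succ_le hs.β0_pos k
  have h1 := primal_decrease hd hm h hs hr hε k hw
  have h2 := dual_increase hd hm h hs hr hε k hw
  have h3 := penalty_increase (P := P) hb hmono (P.outerStep c s r ε k (P.iterate c s r ε k)).y
    hw'.z_nonneg (P.outerStep c s r ε k (P.iterate c s r ε k)).x
  have h4 := mul_le_mul_of_nonneg_left (Setup.v_div_beta_le hs.β0_pos hs.v0_pos hk)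
    (show 0 ≤ 4 * P.Bp c s by positivity)
  have hinf := beta_mul_infeas_le hd hm h hs hr hε k hw
  -- The violation is of order `1/β_k`, and `β_{k+1} ≤ 3/2 β_k` turns `(β_{k+1} - β_k)/β_k²` into a
  -- difference of reciprocals, which telescopes.
  have h5 : (s.β (k + 1) - s.β k) / 2
      * P.infeas (P.outerStep c s r ε k (P.iterate c s r ε k)).x ^ 2
      ≤ 3 * P.Bp c s ^ 2 * (1 / s.β k - 1 / s.β (k + 1)) := by
    have h6 : P.infeas (P.outerStep c s r ε k (P.iterate c s r ε k)).x
        ≤ 2 * P.Bp c s / s.β k := by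
      rw [le_div_iff₀ hb]; linarith
    have hδ : 0 ≤ s.β (k + 1) - s.β k := sub_nonneg.2 hmono
    calc _ ≤ (s.β (k + 1) - s.β k) / 2 * (2 * P.Bp c s / s.β k) ^ 2 := by
          have := P.infeas_nonneg (P.outerStep c s r ε k (P.iterate c s r ε k)).x
          gcongr
      _ = 2 * P.Bp c s ^ 2 * ((s.β (k + 1) - s.β k) * s.β (k + 1))
            / (s.β k ^ 2 * s.β (k + 1)) := by
          field_simp
      _ ≤ 2 * P.Bp c s ^ 2 * ((s.β (k + 1) - s.β k) * (3 / 2 * s.β k))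
            / (s.β k ^ 2 * s.β (k + 1)) := by gcongr
      _ = _ := by field_simp
  unfold potential
  have e : P.iterate c s r ε (k + 1) = P.outerStep c s r ε k (P.iterate c s r ε k) := rfl
  rw [e]
  linarith

theorem abs_F_le (h : P.Assumptions c) {x : Vec d} (hx : x ∈ P.X) :
    |P.F x| ≤ sSup ((fun x => |P.F x|) '' P.X) :=
  le_csSup (h.compact.image_of_continuousOn h.F_cont.abs).bddAbove ⟨x, hx, rfl⟩

theorem sSup_abs_F_nonneg (h : P.Assumptions c) : 0 ≤ sSup ((fun x => |P.F x|) '' P.X) :=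
  (abs_nonneg _).trans (abs_F_le h h.xfeas_mem)

theorem potential_lower (hd : 0 < d) (hm : 0 < m) (h : P.Assumptions c)
    (hs : P.ValidSetup s) (hr : P.ValidSubroutine c s r) (hε : 0 < ε) (k : ℕ) :
    -sSup ((fun x => |P.F x|) '' P.X) - P.Bp c s ^ 2 / (2 * s.β0)
      ≤ P.potential c s r ε k := by
  have hw := admissible_iterate hd hm h hs hr hε k
  have hB := h.Bp_pos hd hm s
  have hb := s.beta_pos hs.β0_pos k
  have hβ0 := hs.β0_pos
  have hv0 := hs.v0_pos
  have hF := neg_le_of_abs_le (abs_F_le h hw.x_mem)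
  unfold potential merit
  set w := P.iterate c s r ε k
  have h1 : 0 ≤ Real.log ((k : ℝ) + 1) := Real.log_nonneg (by linarith [Nat.cast_nonneg (α := ℝ) k])
  have h2 : 0 ≤ 12 * P.Bp c s * (s.v0 / s.β0) * (1 / Real.log (k + 1)) := by positivity
  have h3 : 0 ≤ 3 * P.Bp c s ^ 2 * (1 / s.β k) := by positivity
  have h4 : 0 ≤ ∑ i, 1 / (2 * s.β k) * max (w.z i + s.β k * P.g i w.x) 0 ^ 2 :=
    Finset.sum_nonneg fun i _ => by positivity
  -- Completing the square in the residual: the penalty compensates the linear term up to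
  -- `‖y‖²/(2β)`.
  have h5 : -(P.Bp c s ^ 2 / (2 * s.β k)) ≤ ⟪w.y, P.res w.x⟫ + s.β k / 2 * ‖P.res w.x‖ ^ 2 := by
    have h6 := neg_le_of_abs_le (abs_real_inner_le_norm w.y (P.res w.x))
    have h7 : ‖w.y‖ ^ 2 ≤ P.Bp c s ^ 2 := by nlinarith [hw.bound, sq_nonneg ‖w.z‖]
    have h8 : ‖w.y‖ ^ 2 / (2 * s.β k) ≤ P.Bp c s ^ 2 / (2 * s.β k) := by gcongr
    have h9 : 0 ≤ (‖w.y‖ - s.β k * ‖P.res w.x‖) ^ 2 / (2 * s.β k) := by positivity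
    have e : (‖w.y‖ - s.β k * ‖P.res w.x‖) ^ 2 / (2 * s.β k) = ‖w.y‖ ^ 2 / (2 * s.β k)
        - ‖w.y‖ * ‖P.res w.x‖ + s.β k / 2 * ‖P.res w.x‖ ^ 2 := by
      field_simp; ring
    linarith
  have h10 : P.Bp c s ^ 2 / (2 * s.β k) ≤ P.Bp c s ^ 2 / (2 * s.β0) := by
    have : s.β0 ≤ s.β k := by simpa [Setup.β] using Setup.beta_mono hs.β0_pos (Nat.zero_le k)
    gcongr
  linarith

theorem potential_upper (hd : 0 < d) (hm : 0 < m) (h : P.Assumptions c)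
    (hs : P.ValidSetup s) (hr : P.ValidSubroutine c s r) (hε : 0 < ε) (k : ℕ) :
    P.potential c s r ε (k + 1) ≤ sSup ((fun x => |P.F x|) '' P.X)
      + 21 / 2 * (P.Bp c s ^ 2 / s.β0) + 20 * P.Bp c s * (s.v0 / s.β0) := by
  have hw := admissible_iterate hd hm h hs hr hε (k + 1)
  have hinf := beta_mul_infeas_le hd hm h hs hr hε k (admissible_iterate hd hm h hs hr hε k)
  have hB := h.Bp_pos hd hm s
  have hb := s.beta_pos hs.β0_pos k
  have hb' := s.beta_pos hs.β0_pos (k + 1)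
  have hratio := Setup.beta_succ_le hs.β0_pos k
  have hβ0 := hs.β0_pos
  have hv0 := hs.v0_pos
  have hF := le_of_abs_le (abs_F_le h hw.x_mem)
  have hle : ∀ j, s.β0 ≤ s.β j := fun j => by
    simpa [Setup.β] using Setup.beta_mono hs.β0_pos (Nat.zero_le j)
  rw [show (P.outerStep c s r ε k (P.iterate c s r ε k)) = P.iterate c s r ε (k + 1) from rfl]
    at hinf
  unfold potential merit
  set w := P.iterate c s r ε (k + 1)
  have hinf0 := P.infeas_nonneg w.x
  have h1 : Real.log 2 ≤ Real.log (((k + 1 : ℕ) : ℝ) + 1) := by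
    apply Real.log_le_log two_pos
    push_cast
    linarith [Nat.cast_nonneg (α := ℝ) k]
  have hlog2 : 0.6 < Real.log 2 := by linarith [Real.log_two_gt_d9]
  have h2 : 12 * P.Bp c s * (s.v0 / s.β0) * (1 / Real.log (((k + 1 : ℕ) : ℝ) + 1))
      ≤ 20 * P.Bp c s * (s.v0 / s.β0) := by
    have h3 : 1 / Real.log (((k + 1 : ℕ) : ℝ) + 1) ≤ 5 / 3 := by
      rw [div_le_iff₀ (by linarith)]
      linarith
    calc _ ≤ 12 * P.Bp c s * (s.v0 / s.β0) * (5 / 3) := by gcongr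
      _ = _ := by ring
  have h3 : 3 * P.Bp c s ^ 2 * (1 / s.β (k + 1)) ≤ 3 * (P.Bp c s ^ 2 / s.β0) := by
    have := hle (k + 1)
    calc _ ≤ 3 * P.Bp c s ^ 2 * (1 / s.β0) := by gcongr
      _ = _ := by ring
  have h4 : ∑ i, 1 / (2 * s.β (k + 1)) * max (w.z i + s.β (k + 1) * P.g i w.x) 0 ^ 2
      ≤ 1 / 2 * (‖w.z‖ ^ 2 / s.β (k + 1)) + ‖posVec (P.gvec w.x)‖ * ‖w.z‖
        + s.β (k + 1) / 2 * ‖posVec (P.gvec w.x)‖ ^ 2 := by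
    have h5 : ∀ i, 1 / (2 * s.β (k + 1)) * max (w.z i + s.β (k + 1) * P.g i w.x) 0 ^ 2
        ≤ 1 / (2 * s.β (k + 1)) * w.z i ^ 2 + max (P.g i w.x) 0 * w.z i
          + s.β (k + 1) / 2 * max (P.g i w.x) 0 ^ 2 := by
      intro i
      have := hw.z_nonneg i
      have h6 : max (w.z i + s.β (k + 1) * P.g i w.x) 0
          ≤ w.z i + s.β (k + 1) * max (P.g i w.x) 0 := by
        refine max_le ?_ (by positivity)
        gcongr
        exact le_max_left _ _
      calc _ ≤ 1 / (2 * s.β (k + 1)) * (w.z i + s.β (k + 1) * max (P.g i w.x) 0) ^ 2 := by gcongr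
        _ = _ := by field_simp; ring
    refine (Finset.sum_le_sum fun i _ => h5 i).trans ?_
    rw [Finset.sum_add_distrib, Finset.sum_add_distrib, ← Finset.mul_sum, ← Finset.mul_sum,
      ← normSq_posVec_gvec, ← EuclideanSpace.real_norm_sq_eq]
    have h6 := sum_max_mul_le P w.z w.x
    have e : 1 / (2 * s.β (k + 1)) * ‖w.z‖ ^ 2 = 1 / 2 * (‖w.z‖ ^ 2 / s.β (k + 1)) := by
      field_simp
    linarith
  -- The point was produced with penalty `β_k`, while the potential uses `β_{k+1} ≤ 3/2 β_k`.
  have hI : P.infeas w.x ≤ 2 * (P.Bp c s / s.β k) := by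
    rw [← mul_div_assoc, le_div_iff₀ hb]
    linarith
  have hq : P.Bp c s ^ 2 / s.β k ≤ P.Bp c s ^ 2 / s.β0 := by
    have := hle k
    gcongr
  have h7 : ⟪w.y, P.res w.x⟫ ≤ P.Bp c s * P.infeas w.x :=
    (real_inner_le_norm _ _).trans (mul_le_mul
      (abs_le_of_sq_le_sq' (by nlinarith [hw.bound, sq_nonneg ‖w.z‖]) hB.le).2
      (norm_res_le_infeas P w.x) (norm_nonneg _) hB.le)
  have h8 : ‖posVec (P.gvec w.x)‖ * ‖w.z‖ ≤ P.Bp c s * P.infeas w.x := by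
    rw [mul_comm]
    exact mul_le_mul (hw.norm_z_le hB.le) (norm_posVec_le_infeas P w.x) (norm_nonneg _) hB.le
  have h9 : P.Bp c s * P.infeas w.x ≤ 2 * (P.Bp c s ^ 2 / s.β k) := by
    calc _ ≤ P.Bp c s * (2 * (P.Bp c s / s.β k)) := by gcongr
      _ = _ := by ring
  have h10 : ‖w.z‖ ^ 2 / s.β (k + 1) ≤ P.Bp c s ^ 2 / s.β0 := by
    have := hle (k + 1)
    have := hw.norm_z_le hB.le
    gcongr
  have h11 : s.β (k + 1) / 2 * ‖P.res w.x‖ ^ 2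
      + s.β (k + 1) / 2 * ‖posVec (P.gvec w.x)‖ ^ 2 ≤ 3 * (P.Bp c s ^ 2 / s.β k) := by
    rw [← mul_add, ← infeas_sq]
    calc _ ≤ (3 / 2 * s.β k) / 2 * (2 * (P.Bp c s / s.β k)) ^ 2 := by gcongr
      _ = _ := by field_simp
  linarith

/-- Inserting `C_p ≥ 4 B_p + 2` in `C_x` shows that it exceeds what the bounds on the potential
require. The term `14/β₀` makes it strictly positive. -/
theorem Cx_lower (hd : 0 < d) (hm : 0 < m) (h : P.Assumptions c) (hs : P.ValidSetup s) :
    2 * sSup ((fun x => |P.F x|) '' P.X) + 56 * (P.Bp c s ^ 2 / s.β0)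
      + 40 * P.Bp c s * (s.v0 / s.β0) + 14 / s.β0 ≤ P.Cx c s := by
  have hβ0 := hs.β0_pos
  have hv0 := hs.v0_pos
  have hB := h.Bp_pos hd hm s
  have hC := Assumptions.four_mul_Bp_add_two_le P c s
  have h1 : 4 * (56 * P.Bp c s ^ 2 + 14) ≤ 14 * P.Cp c s ^ 2 + 8 * P.Bp c s * P.Cp c s
      + 7 * P.Bp c s ^ 2 := by
    nlinarith
  have h2 : 56 * (P.Bp c s ^ 2 / s.β0) + 14 / s.β0
      ≤ 1 / (4 * s.β0) * (14 * P.Cp c s ^ 2 + 8 * P.Bp c s * P.Cp c s + 7 * P.Bp c s ^ 2) := by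
    calc _ = 1 / (4 * s.β0) * (4 * (56 * P.Bp c s ^ 2 + 14)) := by field_simp
      _ ≤ _ := by gcongr
  have h3 : 40 * P.Bp c s * (s.v0 / s.β0)
      ≤ (10 * P.Cp c s + 4 * P.Bp c s) * (s.v0 / s.β0) := by
    gcongr
    linarith
  have h4 : 0 ≤ s.β0 / 2
      * (‖P.res s.x0‖ ^ 2 + ‖posVec (P.gvec s.x0 + (1 / s.β0) • s.z0)‖ ^ 2) := by positivity
  have h5 := abs_nonneg ⟪s.y0, P.res s.x0⟫
  unfold Cx
  linarith

theorem Cx_pos (hd : 0 < d) (hm : 0 < m) (h : P.Assumptions c) (hs : P.ValidSetup s) :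
    0 < P.Cx c s := by
  have hβ0 := hs.β0_pos
  have hv0 := hs.v0_pos
  have hB := h.Bp_pos hd hm s
  have h0 := sSup_abs_F_nonneg h
  refine lt_of_lt_of_le ?_ (Cx_lower hd hm h hs)
  positivity

/-- The cumulative decrease of the potential is bounded by `Cx`. -/
theorem potential_sub_le (hd : 0 < d) (hm : 0 < m) (h : P.Assumptions c)
    (hs : P.ValidSetup s) (hr : P.ValidSubroutine c s r) (hε : 0 < ε) (j k : ℕ) :
    P.potential c s r ε (j + 1) - P.potential c s r ε k ≤ P.Cx c s := by
  have h1 := potential_upper hd hm h hs hr hε j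
  have h2 := potential_lower hd hm h hs hr hε k
  have h3 := Cx_lower hd hm h hs
  have hβ0 := hs.β0_pos
  have hv0 := hs.v0_pos
  have hB := h.Bp_pos hd hm s
  have h4 : 0 ≤ P.Bp c s ^ 2 / s.β0 := by positivity
  have h5 : 0 ≤ P.Bp c s * (s.v0 / s.β0) := by positivity
  have h6 : 0 < 14 / s.β0 := by positivity
  have e : P.Bp c s ^ 2 / (2 * s.β0) = 1 / 2 * (P.Bp c s ^ 2 / s.β0) := by field_simp
  linarith

theorem le_beta_of_K1_le (hd : 0 < d) (hm : 0 < m) (h : P.Assumptions c) (hs : P.ValidSetup s)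
    (hε : 0 < ε) {k : ℕ} (hk : P.K1 c s ε ≤ k) :
    2 * P.Bp c s ≤ s.β k * ε ∧ 2 * P.Bp c s ^ 2 ≤ s.β k * ε := by
  have hβ0 := hs.β0_pos
  have hB := h.Bp_pos hd hm s
  have hC := Assumptions.four_mul_Bp_add_two_le P c s
  have h1 : max (P.Cp c s ^ 2 / (s.β0 ^ 2 * ε ^ 2))
      ((4 * P.Bp c s + 5 * P.Cp c s ^ 2) ^ 2 / (16 * s.β0 ^ 2 * ε ^ 2)) ≤ (k : ℝ) + 1 :=
    (Nat.le_ceil _).trans (le_trans (b := (k : ℝ)) (Nat.cast_le.2 hk) (by linarith))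
  obtain ⟨h2, h3⟩ := max_le_iff.1 h1
  rw [div_le_iff₀ (by positivity)] at h2 h3
  have hsq : (s.β k * ε) ^ 2 = ((k : ℝ) + 1) * (s.β0 ^ 2 * ε ^ 2) := by
    unfold Setup.β
    rw [mul_pow, mul_pow, Real.sq_sqrt (by positivity)]
    ring
  have hb := s.beta_pos hs.β0_pos k
  have h4 : P.Cp c s ≤ s.β k * ε :=
    (abs_le_of_sq_le_sq' (by rw [hsq]; exact h2) (by positivity)).2
  have h5 : (4 * P.Bp c s + 5 * P.Cp c s ^ 2) / 4 ≤ s.β k * ε := by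
    refine (abs_le_of_sq_le_sq' ?_ (by positivity)).2
    rw [hsq, div_pow]
    linarith
  constructor
  · linarith
  · nlinarith

theorem K1_pos (hd : 0 < d) (hm : 0 < m) (h : P.Assumptions c) (hs : P.ValidSetup s)
    (hε : 0 < ε) : 0 < P.K1 c s ε := by
  have hβ0 := hs.β0_pos
  have hB := h.Bp_pos hd hm s
  have hC := Assumptions.four_mul_Bp_add_two_le P c s
  have hC0 : 0 < P.Cp c s := by linarith
  exact Nat.ceil_pos.2 (lt_max_of_lt_left (by positivity))

/-- Correctness: an `ε`-KKT point is found within `K` outer iterations. -/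
theorem exists_isKKT (hd : 0 < d) (hm : 0 < m) (h : P.Assumptions c)
    (hs : P.ValidSetup s) (hr : P.ValidSubroutine c s r) (hε : 0 < ε) :
    ∃ k < P.K c s ε, P.IsKKT c.ρ ε (P.iterate c s r ε (k + 1)).x := by
  have hρ := h.rho_pos
  have hCx := Cx_pos hd hm h hs
  by_contra hcon
  push Not at hcon
  -- The argument starts at an index at least `1`: the upper bound on the potential refers to an
  -- output of the subroutine, and `1/log(k+1)` has the junk value `0` at `k = 0`.
  obtain ⟨j, hj⟩ := Nat.exists_eq_succ_of_ne_zero (K1_pos hd hm h hs hε).ne'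
  have hterm : ∀ i ∈ Finset.range (P.K2 c s ε), 1 / 5 * (23 / 20) * (ε ^ 2 / c.ρ)
      ≤ P.potential c s r ε (P.K1 c s ε + i) - P.potential c s r ε (P.K1 c s ε + (i + 1)) := by
    intro i hi
    have hi' := Finset.mem_range.1 hi
    have hw := admissible_iterate hd hm h hs hr hε (P.K1 c s ε + i)
    have hbad := hcon (P.K1 c s ε + i) (by unfold K; omega)
    have hβ := le_beta_of_K1_le hd hm h hs hε (Nat.le_add_right (P.K1 c s ε) i)
    have hdec := potential_decrease hd hm h hs hr hε (k := P.K1 c s ε + i) (by omega)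
    have hlarge : 7 / 8 * ε < 2 * c.ρ * ‖(P.iterate c s r ε (P.K1 c s ε + i + 1)).x
        - (P.iterate c s r ε (P.K1 c s ε + i)).x‖ := by
      by_contra hle
      exact hbad (isKKT_outerStep hd hm h hs hr hε _ hw hβ.1 hβ.2 (not_lt.1 hle))
    refine le_trans ?_ hdec
    set Δ := ‖(P.iterate c s r ε (P.K1 c s ε + i + 1)).x
        - (P.iterate c s r ε (P.K1 c s ε + i)).x‖
    have hΔ : 7 / 16 * (ε / c.ρ) ≤ Δ := by
      rw [← mul_div_assoc, div_le_iff₀ hρ]; linarith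
    have htol := mul_le_mul_of_nonneg_right (tol_le (c := c) (s := s) (ε := ε) (P.K1 c s ε + i))
      (show 0 ≤ Δ from norm_nonneg _)
    have e1 : ε ^ 2 / c.ρ = c.ρ * (ε / c.ρ) ^ 2 := by field_simp
    have e2 : ε / 8 * Δ = c.ρ * (ε / c.ρ * Δ / 8) := by field_simp
    have hx : 0 < ε / c.ρ := by positivity
    -- At `Δ = 7/16 · ε/ρ` the right side is about `0.232 (ε/ρ)²`, and it increases from there on.
    -- Each failing step thus costs more than `ε²/(5ρ)`, and `K₂` of them exceed `C_x`.
    have key : 23 / 100 * (ε / c.ρ) ^ 2 ≤ 3 / 2 * Δ ^ 2 - ε / c.ρ * Δ / 8 := by nlinarith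
    have := mul_le_mul_of_nonneg_left key hρ.le
    rw [e1]
    linarith
  have hsum := Finset.sum_le_sum hterm
  rw [Finset.sum_range_sub' (fun i => P.potential c s r ε (P.K1 c s ε + i)), Finset.sum_const,
    Finset.card_range, nsmul_eq_mul, add_zero] at hsum
  have hle : P.potential c s r ε (P.K1 c s ε) - P.potential c s r ε (P.K1 c s ε + P.K2 c s ε)
      ≤ P.Cx c s := by
    rw [hj]
    exact potential_sub_le hd hm h hs hr hε j _
  have hK2 : 5 * P.Cx c s * c.ρ / ε ^ 2 ≤ P.K2 c s ε := Nat.le_ceil _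
  have h1 : 5 * P.Cx c s * c.ρ / ε ^ 2 * (1 / 5 * (23 / 20) * (ε ^ 2 / c.ρ))
      ≤ P.K2 c s ε * (1 / 5 * (23 / 20) * (ε ^ 2 / c.ρ)) := by gcongr
  have e : 5 * P.Cx c s * c.ρ / ε ^ 2 * (1 / 5 * (23 / 20) * (ε ^ 2 / c.ρ))
      = 23 / 20 * P.Cx c s := by field_simp
  rw [e] at h1
  linarith

/-- The bound on the total number of proximal gradient steps. -/
theorem sum_numIter_le (hd : 0 < d) (hm : 0 < m) (h : P.Assumptions c)
    (hs : P.ValidSetup s) (hr : P.ValidSubroutine c s r) (hε : 0 < ε) :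
    ((∑ k ∈ Finset.range (P.K c s ε), (P.call c s r ε k).numIter : ℕ) : ℝ)
      ≤ P.totalBound c s ε := by
  have hρ := h.rho_pos
  have hβ0 := hs.β0_pos
  have hC3 := h.rho_le_C3 hd hm s
  have hC2 := h.C2_nonneg hd hm
  have hC3' : 0 < P.C3 c s := hρ.trans_le hC3
  have hD := (h.diam_pos hd).le
  have hlog2 : 0 < Real.log 2 := Real.log_pos one_lt_two
  have hterm : ∀ k ∈ Finset.range (P.K c s ε), ((P.call c s r ε k).numIter : ℝ) ≤ 2 +
      (2 * √(P.C3 c s / c.ρ) + 2 * √(√(P.K c s ε) * s.β0 * P.C2 c / c.ρ) + 1 / Real.log 2) *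
      Real.posLog (9 * (tol c s ε (P.K c s ε))⁻¹ * P.diam * √(1 / c.ρ) *
        (P.C3 c s + √(P.K c s ε) * s.β0 * P.C2 c) ^ (3 / 2 : ℝ)) := by
    intro k hk
    have hk' := Finset.mem_range.1 hk
    have hkK : (k : ℝ) + 1 ≤ P.K c s ε := by exact_mod_cast hk'
    have hreg := regular_call hd hm h hs hr hε k
    have h1 := hreg.numIter_le_log h.norm_sub_le_diam
    have e1 : (P.call c s r ε k).μ = c.ρ := rfl
    have e2 : (P.call c s r ε k).Δ = tol c s ε k := rfl
    rw [e1, e2] at h1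
    have htol := tol_antitone (ε := ε) hρ hβ0 hk'.le
    have htp := tol_pos hρ hβ0 hε (P.K c s ε)
    have hsub : P.subLip c s k ≤ P.C3 c s + √(P.K c s ε) * s.β0 * P.C2 c := by
      unfold subLip
      gcongr
    have hsub0 : 0 < P.subLip c s k := hρ.trans_le (h.rho_le_subLip hd hm hβ0 k)
    -- Subadditivity of the square root separates `C₃` from the part that grows with `k`.
    have hsq : √(P.subLip c s k / c.ρ)
        ≤ √(P.C3 c s / c.ρ) + √(√(P.K c s ε) * s.β0 * P.C2 c / c.ρ) := by
      refine le_trans (Real.sqrt_le_sqrt (div_le_div_of_nonneg_right hsub hρ.le)) ?_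
      rw [add_div]
      refine Real.sqrt_le_iff.2 ⟨by positivity, ?_⟩
      have h2 := Real.sq_sqrt (show 0 ≤ P.C3 c s / c.ρ by positivity)
      have h3 := Real.sq_sqrt (show 0 ≤ √(P.K c s ε) * s.β0 * P.C2 c / c.ρ by positivity)
      have h4 := mul_nonneg (Real.sqrt_nonneg (P.C3 c s / c.ρ))
        (Real.sqrt_nonneg (√(P.K c s ε) * s.β0 * P.C2 c / c.ρ))
      nlinarith
    refine h1.trans ?_
    have htk := htp.trans_le htol
    gcongr
    · exact Real.posLog_nonneg
    · linarith
  push_cast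
  refine (Finset.sum_le_sum hterm).trans (le_of_eq ?_)
  rw [Finset.sum_const, Finset.card_range, nsmul_eq_mul, totalBound]
  ring

end Problem

/-! ## The order of the complexity bound -/

theorem one_le_two_mul_log_inv {ε : ℝ} (hε : 0 < ε) (hε2 : ε ≤ 1 / 2) :
    1 ≤ 2 * Real.log (1 / ε) := by
  have h1 : Real.log 2 ≤ Real.log (1 / ε) :=
    Real.log_le_log two_pos ((le_div_iff₀ hε).2 (by linarith))
  linarith [Real.log_two_gt_d9]

theorem rpow_neg_five_halves {ε : ℝ} (hε : 0 < ε) :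
    ε ^ (-(5 / 2) : ℝ) = 1 / ε ^ 2 * √(1 / ε) := by
  rw [show (-(5 / 2) : ℝ) = -2 + -(1 / 2) by norm_num, Real.rpow_add hε, Real.rpow_neg hε.le,
    Real.rpow_neg hε.le, ← Real.sqrt_eq_rpow, one_div, one_div, Real.sqrt_inv]
  norm_num

theorem one_div_sq_le_rpow {ε : ℝ} (hε : 0 < ε) (hε1 : ε ≤ 1) :
    1 / ε ^ 2 ≤ ε ^ (-(5 / 2) : ℝ) := by
  rw [rpow_neg_five_halves hε]
  refine le_mul_of_one_le_right (by positivity) ?_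
  rw [Real.one_le_sqrt, le_div_iff₀ hε]
  linarith

theorem sqrt_le_one_add {x : ℝ} (hx : 0 ≤ x) : √x ≤ 1 + x :=
  Real.sqrt_le_iff.2 ⟨by positivity, by nlinarith⟩

/-- The constant in the order bound of `totalBound`. -/
noncomputable def orderConst (M : ℝ) : ℝ :=
  M * (4 + 6 * M ^ 2 * (2 * Real.log (1008 * M ^ 10) + 10))

/-- The crude bound `log R ≤ R` suffices, and `1 ≤ 2 log (1/ε)` lets the constants be absorbed in
the factor `log (1/ε)`. -/
theorem posLog_le_of_le {M R Y ε : ℝ} (hM : 1 ≤ M) (hR : 1 ≤ R) (hε : 0 < ε) (hε2 : ε ≤ 1 / 2)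
    (hY0 : 0 ≤ Y) (hY : Y ≤ M * R ^ 5 * (1 / ε) ^ 3) :
    Real.posLog Y ≤ (2 * Real.log M + 10) * ((1 + R) * Real.log (1 / ε)) := by
  have hlog := one_le_two_mul_log_inv hε hε2
  have hinvε : 1 ≤ 1 / ε := by rw [le_div_iff₀ hε]; linarith
  refine (Real.posLog_le_posLog hY0 hY).trans ?_
  have hge : 1 ≤ M * R ^ 5 * (1 / ε) ^ 3 :=
    one_le_mul_of_one_le_of_one_le (one_le_mul_of_one_le_of_one_le hM (one_le_pow₀ hR))
      (one_le_pow₀ hinvε)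
  rw [Real.posLog_eq_log (hge.trans (le_abs_self _)), Real.log_mul (by positivity) (by positivity),
    Real.log_mul (by positivity) (by positivity), Real.log_pow, Real.log_pow]
  have hlogR : Real.log R ≤ R := (Real.log_le_sub_one_of_pos (by linarith)).trans (by linarith)
  have hlogM : 0 ≤ Real.log M := Real.log_nonneg hM
  generalize Real.log (1 / ε) = l at hlog ⊢
  generalize Real.log M = b at hlogM ⊢
  have h5 : R ≤ R * (2 * l) := le_mul_of_one_le_right (by linarith) hlog
  have h6 : b ≤ b * (2 * l) := le_mul_of_one_le_right hlogM hlog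
  have h7 : 0 ≤ b * (R * l) := mul_nonneg hlogM (mul_nonneg (by linarith) (by linarith))
  push_cast
  linarith

/-- The exponent `3/2` is raised to `2` to stay with integer powers; only the logarithm is affected.
The constant is `1008 = 9 · 14 · 2 · 4`. -/
theorem posLog_le_of_bounds {M R ε T D ρ Z : ℝ} (hM : 1 ≤ M) (hR : 1 ≤ R) (hε : 0 < ε)
    (hε2 : ε ≤ 1 / 2) (hT0 : 0 ≤ T) (hT : T ≤ 14 * M ^ 2 * (R / ε)) (hD0 : 0 ≤ D) (hD : D ≤ M)
    (hρ0 : 0 < ρ) (hρ : 1 / ρ ≤ M) (hZ0 : 0 ≤ Z) (hZ : Z ≤ 2 * M ^ 3 * (R ^ 2 / ε)) :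
    Real.posLog (9 * T * D * √(1 / ρ) * Z ^ (3 / 2 : ℝ))
      ≤ (2 * Real.log (1008 * M ^ 10) + 10) * ((1 + R) * Real.log (1 / ε)) := by
  have hM10 : 1 ≤ M ^ 10 := one_le_pow₀ hM
  have hR2ε : 1 ≤ R ^ 2 / ε := by rw [le_div_iff₀ hε]; nlinarith
  have hM3 : 1 ≤ M ^ 3 := one_le_pow₀ hM
  have hZ1 : 1 ≤ 2 * M ^ 3 * (R ^ 2 / ε) :=
    one_le_mul_of_one_le_of_one_le (by linarith) hR2ε
  have hZp : Z ^ (3 / 2 : ℝ) ≤ (2 * M ^ 3 * (R ^ 2 / ε)) ^ 2 :=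
    calc Z ^ (3 / 2 : ℝ) ≤ (2 * M ^ 3 * (R ^ 2 / ε)) ^ (3 / 2 : ℝ) :=
          Real.rpow_le_rpow hZ0 hZ (by norm_num)
      _ ≤ (2 * M ^ 3 * (R ^ 2 / ε)) ^ (2 : ℝ) :=
          Real.rpow_le_rpow_of_exponent_le hZ1 (by norm_num)
      _ = _ := Real.rpow_two _
  have hsρ : √(1 / ρ) ≤ 2 * M := (sqrt_le_one_add (by positivity)).trans (by linarith)
  refine posLog_le_of_le (by linarith) hR hε hε2 (by positivity) ?_
  calc _ ≤ 9 * (14 * M ^ 2 * (R / ε)) * M * (2 * M) * (2 * M ^ 3 * (R ^ 2 / ε)) ^ 2 := by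
        gcongr
    _ = _ := by ring

/-- Here `√N` is of order `R/ε` and `β/ρ` is bounded, so the second root is of order `√(R/ε)` and
dominates. -/
theorem sqrt_sum_le_of_bounds {M R ε N β C₂ C₃ ρ : ℝ} (hM : 1 ≤ M) (hR : 1 ≤ R) (hε : 0 < ε)
    (hε1 : ε ≤ 1) (hρ : 0 < ρ) (hN : N ≤ M * R ^ 2 / ε ^ 2) (h3 : C₃ / ρ ≤ M) (hC2 : 0 ≤ C₂)
    (h2 : C₂ ≤ M) (hβ0 : 0 ≤ β) (hβ : β / ρ ≤ M) :
    2 * √(C₃ / ρ) + 2 * √(√N * β * C₂ / ρ) + 1 / Real.log 2 ≤ 6 * M ^ 2 * √(R / ε) := by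
  have hRε : 1 ≤ R / ε := by rw [le_div_iff₀ hε]; linarith
  have hq1 : 1 ≤ √(R / ε) := Real.one_le_sqrt.2 hRε
  have hMM : M ≤ M ^ 2 := le_self_pow₀ hM (by norm_num)
  have hS1 : √(C₃ / ρ) ≤ M := Real.sqrt_le_iff.2 ⟨by linarith, h3.trans hMM⟩
  have hS2 : √(√N * β * C₂ / ρ) ≤ M ^ 2 * √(R / ε) := by
    refine Real.sqrt_le_iff.2 ⟨by positivity, ?_⟩
    have hsq : √N ≤ M * (R / ε) := by
      refine Real.sqrt_le_iff.2 ⟨by positivity, hN.trans ?_⟩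
      calc M * R ^ 2 / ε ^ 2 ≤ M ^ 2 * R ^ 2 / ε ^ 2 := by gcongr
        _ = _ := by ring
    rw [mul_pow, Real.sq_sqrt (by positivity)]
    calc √N * β * C₂ / ρ = √N * (β / ρ) * C₂ := by ring
      _ ≤ M * (R / ε) * M * M := by gcongr
      _ = M ^ 3 * (R / ε) := by ring
      _ ≤ M ^ 4 * (R / ε) :=
          mul_le_mul_of_nonneg_right (pow_le_pow_right₀ hM (by norm_num)) (by linarith)
      _ = _ := by ring
  have h4 : 1 / Real.log 2 ≤ 2 := by
    rw [div_le_iff₀ (Real.log_pos one_lt_two)]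
    linarith [Real.log_two_gt_d9]
  have h5 : M ≤ M ^ 2 * √(R / ε) := hMM.trans (le_mul_of_one_le_right (by positivity) hq1)
  linarith

/-- The stray `2N` is multiplied by `√(R/ε) (1 + R) · 2 log (1/ε) ≥ 1` to match the main term; this
produces the `4` in `orderConst`. -/
theorem order_assembly {M R ε N S Y : ℝ} (hM : 1 ≤ M) (hR : 1 ≤ R) (hε : 0 < ε)
    (hε2 : ε ≤ 1 / 2) (hN0 : 0 ≤ N) (hN : N ≤ M * R ^ 2 / ε ^ 2)
    (hS : S ≤ 6 * M ^ 2 * √(R / ε)) (hY0 : 0 ≤ Y)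
    (hY : Y ≤ (2 * Real.log (1008 * M ^ 10) + 10) * ((1 + R) * Real.log (1 / ε))) :
    2 * N + N * S * Y
      ≤ orderConst M * (R ^ 2 * √R * (1 + R)) * ε ^ (-(5 / 2) : ℝ) * Real.log (1 / ε) := by
  have hlog := one_le_two_mul_log_inv hε hε2
  have hRε : 1 ≤ R / ε := by rw [le_div_iff₀ hε]; linarith
  have hq1 : 1 ≤ √(R / ε) := Real.one_le_sqrt.2 hRε
  have hqe : √(R / ε) = √R * √(1 / ε) := by
    rw [← Real.sqrt_mul (by linarith), mul_one_div]
  have hM10 : 1 ≤ M ^ 10 := one_le_pow₀ hM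
  have hlogM : 0 ≤ Real.log (1008 * M ^ 10) := Real.log_nonneg (by linarith)
  rw [orderConst, rpow_neg_five_halves hε, mul_assoc N]
  generalize Real.log (1 / ε) = l at hlog hY ⊢
  generalize Real.log (1008 * M ^ 10) = b at hlogM hY ⊢
  have hl0 : 0 ≤ l := by linarith
  have hprod : S * Y ≤ 6 * M ^ 2 * √(R / ε) * ((2 * b + 10) * ((1 + R) * l)) :=
    mul_le_mul hS hY hY0 (by positivity)
  have hone : 1 ≤ √(R / ε) * ((1 + R) * (2 * l)) :=
    one_le_mul_of_one_le_of_one_le hq1 (one_le_mul_of_one_le_of_one_le (by linarith) hlog)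
  calc _ ≤ 2 * N * (√(R / ε) * ((1 + R) * (2 * l)))
        + N * (6 * M ^ 2 * √(R / ε) * ((2 * b + 10) * ((1 + R) * l))) :=
        add_le_add (le_mul_of_one_le_right (by positivity) hone)
          (mul_le_mul_of_nonneg_left hprod hN0)
    _ = N * ((4 + 6 * M ^ 2 * (2 * b + 10)) * (√(R / ε) * ((1 + R) * l))) := by ring
    _ ≤ M * R ^ 2 / ε ^ 2 * ((4 + 6 * M ^ 2 * (2 * b + 10)) * (√(R / ε) * ((1 + R) * l))) :=
        mul_le_mul_of_nonneg_right hN (by positivity)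
    _ = _ := by
        rw [hqe]
        ring

/-! ### The complexity bound in terms of bounds on the data -/

namespace Problem

variable {d n m : ℕ} {P : Problem d n m} {c : Constants d} {s : Setup d n m}

theorem smoothness_le {M R N β ε C₂ C₃ : ℝ} (hM : 1 ≤ M) (hR : 1 ≤ R) (hε : 0 < ε) (hε1 : ε ≤ 1)
    (hβ : 0 ≤ β) (hC2 : 0 ≤ C₂) (hN : N ≤ M * R ^ 2 / ε ^ 2) (h3 : C₃ ≤ M * R) (h2 : C₂ ≤ M)
    (hβM : β ≤ M * R) : C₃ + √N * β * C₂ ≤ 2 * M ^ 3 * (R ^ 2 / ε) := by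
  have hsq : √N ≤ M * (R / ε) := by
    refine Real.sqrt_le_iff.2 ⟨by positivity, hN.trans ?_⟩
    calc M * R ^ 2 / ε ^ 2 ≤ M ^ 2 * R ^ 2 / ε ^ 2 := by gcongr; nlinarith
      _ = _ := by ring
  have h4 : √N * β * C₂ ≤ M * (R / ε) * (M * R) * M := by gcongr
  have h5 : M * R ≤ M ^ 3 * (R ^ 2 / ε) := by
    have : R ≤ R ^ 2 / ε := by
      rw [le_div_iff₀ hε]
      nlinarith
    have hM3 : M ≤ M ^ 3 := le_self_pow₀ hM (by norm_num)
    gcongr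
  calc _ ≤ M ^ 3 * (R ^ 2 / ε) + M * (R / ε) * (M * R) * M := by linarith
    _ = _ := by ring

theorem inv_tol_le {M R ε : ℝ} (hM : 1 ≤ M) (hR : 1 ≤ R) (hε : 0 < ε) (hε1 : ε ≤ 1)
    (hρ : 0 < c.ρ) (hβ : 0 < s.β0) {k : ℕ} (hk : (k : ℝ) ≤ M * R ^ 2 / ε ^ 2)
    (hβρ : s.β0 / c.ρ ≤ M) : (tol c s ε k)⁻¹ ≤ 14 * M ^ 2 * (R / ε) := by
  have hb := s.beta_pos hβ k
  have hRε : 1 ≤ R / ε := by rw [le_div_iff₀ hε]; linarith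
  have hq : √((k : ℝ) + 1) ≤ 2 * M * (R / ε) := by
    refine Real.sqrt_le_iff.2 ⟨by positivity, ?_⟩
    have h1 : M * R ^ 2 / ε ^ 2 = M * (R / ε) ^ 2 := by ring
    have h2 : 1 ≤ (R / ε) ^ 2 := one_le_pow₀ hRε
    rw [h1] at hk
    have h3 : M * (R / ε) ^ 2 ≤ M ^ 2 * (R / ε) ^ 2 := by gcongr; nlinarith
    have h4 : 1 ≤ M ^ 2 * (R / ε) ^ 2 := one_le_mul_of_one_le_of_one_le (one_le_pow₀ hM) h2
    nlinarith
  have h1 : √(2 * s.β k / c.ρ) ≤ 1 + 4 * M ^ 2 * (R / ε) := by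
    refine (sqrt_le_one_add (by positivity)).trans ?_
    have : 2 * s.β k / c.ρ = 2 * (s.β0 / c.ρ) * √((k : ℝ) + 1) := by unfold Setup.β; ring
    rw [this]
    have : 2 * (s.β0 / c.ρ) * √((k : ℝ) + 1) ≤ 2 * M * (2 * M * (R / ε)) := by gcongr
    linarith
  have hM2 : 1 ≤ M ^ 2 := one_le_pow₀ hM
  have hMR : R / ε ≤ M ^ 2 * (R / ε) := le_mul_of_one_le_left (by positivity) hM2
  have h8 : 8 / ε ≤ 8 * (M ^ 2 * (R / ε)) := by
    have : 1 / ε ≤ R / ε := by gcongr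
    calc 8 / ε = 8 * (1 / ε) := by ring
      _ ≤ _ := by linarith
  have hpos := tol_pos hρ hβ hε k
  rw [inv_le_comm₀ hpos (by positivity)]
  unfold tol
  refine le_min ?_ (le_min ?_ ?_)
  · rw [inv_le_comm₀ (by positivity) (by positivity), inv_div]
    linarith [mul_pos (by positivity : 0 < M ^ 2) (by positivity : 0 < R / ε)]
  · rw [inv_le_comm₀ (by positivity) (by positivity), ← Real.sqrt_inv, inv_div]
    linarith
  · exact inv_le_one_of_one_le₀ (by linarith)

/-- The order of `totalBound` when the data are of the order of powers of `R`. -/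
theorem totalBound_le_of_bounds {M R ε : ℝ} (hM : 1 ≤ M) (hR : 1 ≤ R) (hε : 0 < ε)
    (hε2 : ε ≤ 1 / 2) (hρ : 0 < c.ρ) (hβ : 0 < s.β0) (hC3 : 0 ≤ P.C3 c s) (hC2 : 0 ≤ P.C2 c)
    (hD : 0 ≤ P.diam) (hK : (P.K c s ε : ℝ) ≤ M * R ^ 2 / ε ^ 2) (h3 : P.C3 c s ≤ M * R)
    (h3ρ : P.C3 c s / c.ρ ≤ M) (h2 : P.C2 c ≤ M) (hβM : s.β0 ≤ M * R) (hβρ : s.β0 / c.ρ ≤ M)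
    (hρM : 1 / c.ρ ≤ M) (hDM : P.diam ≤ M) :
    P.totalBound c s ε
      ≤ orderConst M * (R ^ 2 * √R * (1 + R)) * ε ^ (-(5 / 2) : ℝ) * Real.log (1 / ε) := by
  have hε1 : ε ≤ 1 := by linarith
  have hZ := smoothness_le hM hR hε hε1 hβ.le hC2 hK h3 h2 hβM
  have hT := inv_tol_le hM hR hε hε1 hρ hβ hK hβρ
  have htp := tol_pos hρ hβ hε (P.K c s ε)
  have hP := posLog_le_of_bounds hM hR hε hε2 (inv_nonneg.2 htp.le) hT hD hDM hρ hρM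
    (by positivity) hZ
  have hS := sqrt_sum_le_of_bounds hM hR hε hε1 hρ hK h3ρ hC2 h2 hβ.le hβρ
  exact order_assembly hM hR hε hε2 (Nat.cast_nonneg _) hK hS
    Real.posLog_nonneg hP

theorem K_le_of_bounds {M₁ M₂ ε : ℝ} (hε : 0 < ε) (hε1 : ε ≤ 1)
    (h1 : max (P.Cp c s ^ 2 / s.β0 ^ 2) ((4 * P.Bp c s + 5 * P.Cp c s ^ 2) ^ 2 / (16 * s.β0 ^ 2))
      ≤ M₁) (h2 : 5 * P.Cx c s * c.ρ ≤ M₂) (hC : 0 ≤ P.Cx c s) (hρ : 0 ≤ c.ρ) :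
    (P.K c s ε : ℝ) ≤ (M₁ + M₂ + 2) / ε ^ 2 := by
  have hinv : 1 ≤ 1 / ε ^ 2 := by
    rw [le_div_iff₀ (by positivity), one_mul]
    exact pow_le_one₀ hε.le hε1
  have e1 : P.Cp c s ^ 2 / (s.β0 ^ 2 * ε ^ 2) = P.Cp c s ^ 2 / s.β0 ^ 2 / ε ^ 2 := by
    rw [div_div]
  have e2 : (4 * P.Bp c s + 5 * P.Cp c s ^ 2) ^ 2 / (16 * s.β0 ^ 2 * ε ^ 2)
      = (4 * P.Bp c s + 5 * P.Cp c s ^ 2) ^ 2 / (16 * s.β0 ^ 2) / ε ^ 2 := by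
    rw [div_div]
  have h3 : max (P.Cp c s ^ 2 / (s.β0 ^ 2 * ε ^ 2))
      ((4 * P.Bp c s + 5 * P.Cp c s ^ 2) ^ 2 / (16 * s.β0 ^ 2 * ε ^ 2)) ≤ M₁ / ε ^ 2 := by
    rw [e1, e2]
    refine max_le ?_ ?_ <;> refine div_le_div_of_nonneg_right ?_ (by positivity)
    · exact (le_max_left _ _).trans h1
    · exact (le_max_right _ _).trans h1
  have h4 : (P.K1 c s ε : ℝ) ≤ M₁ / ε ^ 2 + 1 :=
    (Nat.ceil_lt_add_one (le_max_of_le_left (by positivity))).le.trans (by linarith)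
  have h5 : (P.K2 c s ε : ℝ) ≤ M₂ / ε ^ 2 + 1 := by
    refine (Nat.ceil_lt_add_one (by positivity)).le.trans ?_
    have : 5 * P.Cx c s * c.ρ / ε ^ 2 ≤ M₂ / ε ^ 2 := by gcongr
    linarith
  unfold K
  push_cast
  have e : (M₁ + M₂ + 2) / ε ^ 2 = M₁ / ε ^ 2 + M₂ / ε ^ 2 + 2 * (1 / ε ^ 2) := by ring
  rw [e]
  linarith

/-- Uniform bounds for a fixed problem. -/
theorem exists_uniform_bound (hd : 0 < d) (hm : 0 < m) (h : P.Assumptions c)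
    (hs : P.ValidSetup s) : ∃ M : ℝ, 1 ≤ M ∧ P.C3 c s ≤ M ∧ P.C3 c s / c.ρ ≤ M ∧ P.C2 c ≤ M ∧
      s.β0 ≤ M ∧ s.β0 / c.ρ ≤ M ∧ 1 / c.ρ ≤ M ∧ P.diam ≤ M ∧
      ∀ ε : ℝ, 0 < ε → ε ≤ 1 → (P.K c s ε : ℝ) ≤ M / ε ^ 2 := by
  have hβ := hs.β0_pos
  have hρ := h.rho_pos
  have hC3 : 0 ≤ P.C3 c s := hρ.le.trans (h.rho_le_C3 hd hm s)
  have hC2 := h.C2_nonneg hd hm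
  have hD := (h.diam_pos hd).le
  have hCx := (Cx_pos hd hm h hs).le
  obtain ⟨a, ha⟩ : ∃ a, a = max (P.Cp c s ^ 2 / s.β0 ^ 2)
    ((4 * P.Bp c s + 5 * P.Cp c s ^ 2) ^ 2 / (16 * s.β0 ^ 2)) := ⟨_, rfl⟩
  have ha0 : 0 ≤ a := by rw [ha]; exact le_max_of_le_left (by positivity)
  have h1 : 0 ≤ P.C3 c s / c.ρ := by positivity
  have h2 : 0 ≤ s.β0 / c.ρ := by positivity
  have h3 : 0 ≤ 1 / c.ρ := by positivity
  have h4 : 0 ≤ 5 * P.Cx c s * c.ρ := by positivity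
  -- All quantities are nonnegative, so their sum dominates each of them.
  refine ⟨(a + 5 * P.Cx c s * c.ρ + 2) + P.C3 c s + P.C3 c s / c.ρ + P.C2 c + s.β0 + s.β0 / c.ρ
    + 1 / c.ρ + P.diam, by linarith, by linarith, by linarith, by linarith, by linarith,
    by linarith, by linarith, by linarith, fun ε hε hε1 => ?_⟩
  refine (K_le_of_bounds hε hε1 ha.ge le_rfl hCx hρ.le).trans ?_
  refine div_le_div_of_nonneg_right ?_ (by positivity)
  linarith

theorem exists_totalBound_le (hd : 0 < d) (hm : 0 < m) (h : P.Assumptions c)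
    (hs : P.ValidSetup s) : ∃ C : ℝ, ∀ ε : ℝ, 0 < ε → ε ≤ 1 / 2 →
      P.totalBound c s ε ≤ C * ε ^ (-(5 / 2) : ℝ) * Real.log (1 / ε) := by
  obtain ⟨M, hM, h3, h3ρ, h2, hβM, hβρ, hρM, hDM, hK⟩ := exists_uniform_bound hd hm h hs
  -- The problem is fixed, so the scale is `R = 1`.
  refine ⟨orderConst M * (1 ^ 2 * √1 * (1 + 1)), fun ε hε hε2 => ?_⟩
  exact totalBound_le_of_bounds hM le_rfl hε hε2 h.rho_pos hs.β0_pos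
    (h.rho_pos.le.trans (h.rho_le_C3 hd hm s)) (h.C2_nonneg hd hm) (h.diam_pos hd).le
    (by simpa using hK ε hε (by linarith)) (by simpa using h3) h3ρ h2 (by simpa using hβM) hβρ
    hρM hDM

/-- The number of trial steps has the same order. -/
theorem exists_numTrials_le (hd : 0 < d) (hm : 0 < m) (h : P.Assumptions c)
    (hs : P.ValidSetup s) (γd Lmin : ℝ) (hL : 0 < Lmin) : ∃ C : ℝ, ∀ r : Subroutine d,
      P.ValidSubroutine c s r → r.γd = γd → (∀ k, Lmin ≤ r.L0 k) → ∀ ε : ℝ, 0 < ε → ε ≤ 1 / 2 →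
      ((∑ k ∈ Finset.range (P.K c s ε), (P.call c s r ε k).numTrials : ℕ) : ℝ)
        ≤ C * ε ^ (-(5 / 2) : ℝ) * Real.log (1 / ε) := by
  obtain ⟨M, hM, h3, -, h2, hβM, -, -, -, hK⟩ := exists_uniform_bound hd hm h hs
  obtain ⟨C, hC⟩ := exists_totalBound_le hd hm h hs
  obtain ⟨a, ha⟩ : ∃ a, a = (2 * |Real.log (4 * M ^ 3 / Lmin)| + 1) / Real.log 2 := ⟨_, rfl⟩
  refine ⟨(1 + Real.log γd / Real.log 2) * C + M * a, fun r hr hγ hLr ε hε hε2 => ?_⟩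
  have hε1 : ε ≤ 1 := by linarith
  have hlog2 : 0 < Real.log 2 := Real.log_pos one_lt_two
  have hl := one_le_two_mul_log_inv hε hε2
  have hl0 : 0 < Real.log (1 / ε) := by linarith
  have ha0 : 0 ≤ a := by rw [ha]; positivity
  have hγ2 : 2 ≤ γd := hγ ▸ hr.γd_ge
  have hlogγ : 0 ≤ Real.log γd := Real.log_nonneg (by linarith)
  have hβ := hs.β0_pos
  have hC2 := h.C2_nonneg hd hm
  have hterm : ∀ k ∈ Finset.range (P.K c s ε), ((P.call c s r ε k).numTrials : ℝ)
      ≤ (1 + Real.log γd / Real.log 2) * (P.call c s r ε k).numIter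
        + a * Real.log (1 / ε) := by
    intro k hk
    have hk' : (k : ℝ) + 1 ≤ P.K c s ε := by exact_mod_cast Finset.mem_range.1 hk
    have h1 := (regular_call hd hm h hs hr hε k).numTrials_le
    have e1 : (P.call c s r ε k).γd = γd := hγ
    have e2 : (P.call c s r ε k).L0 = r.L0 k := rfl
    rw [e1, e2] at h1
    refine h1.trans (add_le_add_right ?_ _)
    have hsub0 : 0 < P.subLip c s k := h.rho_pos.trans_le (h.rho_le_subLip hd hm hβ k)
    have hL0 := hr.L0_pos k
    have hsub : P.subLip c s k ≤ 2 * M ^ 3 * (1 / ε) := by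
      have h4 : P.subLip c s k ≤ P.C3 c s + √(P.K c s ε) * s.β0 * P.C2 c := by
        unfold subLip
        gcongr
      have h5 := smoothness_le hM le_rfl hε hε1 hβ.le hC2 (by simpa using hK ε hε hε1)
        (by simpa using h3) h2 (by simpa using hβM)
      rw [one_pow] at h5
      exact h4.trans h5
    rw [ha, div_mul_eq_mul_div]
    refine div_le_div_of_nonneg_right ?_ hlog2.le
    -- The range of the line search enters only through a logarithm of order `log (1/ε)`, so the `K`
    -- calls add `O(ε⁻² log (1/ε))`.
    have h6 : 2 * P.subLip c s k / r.L0 k ≤ 4 * M ^ 3 / Lmin * (1 / ε) := by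
      calc _ ≤ 2 * (2 * M ^ 3 * (1 / ε)) / Lmin := by
            have := hLr k
            gcongr
        _ = _ := by ring
    refine (Real.log_le_log (by positivity) h6).trans ?_
    rw [Real.log_mul (by positivity) (by positivity)]
    nlinarith [le_abs_self (Real.log (4 * M ^ 3 / Lmin)), abs_nonneg (Real.log (4 * M ^ 3 / Lmin))]
  push_cast
  refine (Finset.sum_le_sum hterm).trans ?_
  rw [Finset.sum_add_distrib, ← Finset.mul_sum, Finset.sum_const, Finset.card_range, nsmul_eq_mul]
  have h7 := sum_numIter_le hd hm h hs hr hε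
  push_cast at h7
  have h8 := mul_le_mul_of_nonneg_left (h7.trans (hC ε hε hε2))
    (show 0 ≤ 1 + Real.log γd / Real.log 2 by positivity)
  have h9 : (P.K c s ε : ℝ) ≤ M * ε ^ (-(5 / 2) : ℝ) := by
    refine (hK ε hε hε1).trans ?_
    calc M / ε ^ 2 = M * (1 / ε ^ 2) := by ring
      _ ≤ _ := mul_le_mul_of_nonneg_left (one_div_sq_le_rpow hε hε1) (by linarith)
  have h10 := mul_le_mul_of_nonneg_right h9 (mul_nonneg ha0 hl0.le)
  linarith

end Problem

/-! ## Dependence on the weak convexity constant -/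

theorem continuous_posVec {k : ℕ} : Continuous (posVec : Vec k → Vec k) :=
  (PiLp.continuous_toLp 2 _).comp (continuous_pi fun i => by fun_prop)

theorem norm_posVec_le {k : ℕ} (a : Vec k) : ‖posVec a‖ ≤ ‖a‖ := by
  rw [EuclideanSpace.norm_eq, EuclideanSpace.norm_eq]
  refine Real.sqrt_le_sqrt (Finset.sum_le_sum fun i _ => ?_)
  have h : |max (a i) 0| ≤ |a i| := by
    rw [abs_of_nonneg (le_max_right _ _)]
    exact max_le (le_abs_self _) (abs_nonneg _)
  exact pow_le_pow_left₀ (abs_nonneg _) h 2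

theorem orderConst_nonneg {M : ℝ} (hM : 1 ≤ M) : 0 ≤ orderConst M := by
  have : 0 ≤ Real.log (1008 * M ^ 10) :=
    Real.log_nonneg (by linarith [one_le_pow₀ hM (n := 10)])
  unfold orderConst
  positivity

/-- Sizes of `β` and `X` when `β² X ρ` is of the order of `N²`. -/
theorem bounds_of_balance {ρ₀ R N X β e x₁ n₁ n₂ κ₁ κ₂ : ℝ} (hρ : 0 < ρ₀) (hR : 1 ≤ R)
    (hβ : 0 < β) (he : 0 < e) (hx : 0 < x₁) (hn₁ : 0 < n₁) (hκ₁ : 0 < κ₁)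
    (hN1 : n₁ * R ^ 2 ≤ N) (hN2 : N ≤ n₂ * R ^ 2) (hX1 : x₁ * R ^ 2 / β ≤ X)
    (hX2 : X ≤ e * (1 + R ^ 2 / β + β)) (h1 : (κ₁ * N) ^ 2 ≤ β ^ 2 * (X * (R * ρ₀)))
    (h2 : β ^ 2 * (X * (R * ρ₀)) ≤ (κ₂ * N) ^ 2) :
    β ≤ κ₂ ^ 2 * n₂ ^ 2 / (x₁ * ρ₀) * R ∧
      min 1 (κ₁ ^ 2 * n₁ ^ 2 / (3 * e * ρ₀)) * R ≤ β ∧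
      X ≤ κ₂ ^ 2 * n₂ ^ 2 / (min 1 (κ₁ ^ 2 * n₁ ^ 2 / (3 * e * ρ₀)) ^ 2 * ρ₀) * R := by
  rw [mul_comm R ρ₀] at h1 h2
  have hN0 : 0 ≤ N := le_trans (by positivity) hN1
  have h2' : β ^ 2 * (X * (ρ₀ * R)) ≤ κ₂ ^ 2 * n₂ ^ 2 * R ^ 4 := by
    refine h2.trans ?_
    have := pow_le_pow_left₀ hN0 hN2 2
    calc (κ₂ * N) ^ 2 = κ₂ ^ 2 * N ^ 2 := by ring
      _ ≤ κ₂ ^ 2 * (n₂ * R ^ 2) ^ 2 := mul_le_mul_of_nonneg_left this (by positivity)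
      _ = _ := by ring
  obtain ⟨l, hl⟩ : ∃ l, l = min 1 (κ₁ ^ 2 * n₁ ^ 2 / (3 * e * ρ₀)) := ⟨_, rfl⟩
  have hl0 : 0 < l := by rw [hl]; exact lt_min one_pos (by positivity)
  have hl1 : l ≤ 1 := hl ▸ min_le_left _ _
  have hl2 : l * (3 * e * ρ₀) ≤ κ₁ ^ 2 * n₁ ^ 2 := by
    rw [← le_div_iff₀ (by positivity)]
    exact hl ▸ min_le_right _ _
  rw [← hl]
  -- If `β < l R ≤ R`, the upper bound on `X` gives `β² X ρ < 3 e ρ₀ l R⁴`, which is below `(κ₁ N)²`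
  -- by the choice of `l`.
  have hlβ : l * R ≤ β := by
    by_contra! hlt
    have hR2 : R ≤ R ^ 2 := le_self_pow₀ hR (by norm_num)
    have hβR : β ≤ R := hlt.le.trans (mul_le_of_le_one_left (by linarith) hl1)
    have h3 : κ₁ ^ 2 * n₁ ^ 2 * R ^ 4 ≤ β ^ 2 * (e * (1 + R ^ 2 / β + β) * (ρ₀ * R)) := by
      refine le_trans ?_ (h1.trans (by gcongr))
      calc _ = κ₁ ^ 2 * (n₁ * R ^ 2) ^ 2 := by ring
        _ ≤ κ₁ ^ 2 * N ^ 2 := by gcongr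
        _ = _ := by ring
    have h4 : β ^ 2 * (e * (1 + R ^ 2 / β + β) * (ρ₀ * R))
        = e * ρ₀ * R * (β * (β + R ^ 2 + β * β)) := by
      field_simp
    have h5 : β * (β + R ^ 2 + β * β) < l * R * (R ^ 2 + R ^ 2 + R ^ 2) := by
      have h6 : β * β ≤ R ^ 2 := by rw [pow_two]; gcongr
      have h7 : β + R ^ 2 + β * β ≤ R ^ 2 + R ^ 2 + R ^ 2 := by linarith
      exact mul_lt_mul hlt h7 (by positivity) (by positivity)
    have h8 : e * ρ₀ * R * (β * (β + R ^ 2 + β * β))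
        < e * ρ₀ * R * (l * R * (R ^ 2 + R ^ 2 + R ^ 2)) :=
      mul_lt_mul_of_pos_left h5 (by positivity)
    have h9 := mul_le_mul_of_nonneg_right hl2 (by positivity : 0 ≤ R ^ 4)
    linarith
  refine ⟨?_, hlβ, ?_⟩
  -- The lower bound `X ≥ x₁ R²/β` makes `β² X ρ` at least of order `β R³`, while it is at most of
  -- order `N² ≈ R⁴`.
  · have h3 : β * R ^ 3 * (x₁ * ρ₀) ≤ κ₂ ^ 2 * n₂ ^ 2 * R ^ 4 := by
      refine le_trans ?_ h2'
      calc β * R ^ 3 * (x₁ * ρ₀) = β ^ 2 * (x₁ * R ^ 2 / β * (ρ₀ * R)) := by field_simp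
        _ ≤ _ := by gcongr
    rw [div_mul_eq_mul_div, le_div_iff₀ (by positivity)]
    refine le_of_mul_le_mul_right ?_ (by positivity : 0 < R ^ 3)
    linarith
  · have hX0 : 0 ≤ X := le_trans (by positivity) hX1
    have h3 : (l * R) ^ 2 * (X * (ρ₀ * R)) ≤ κ₂ ^ 2 * n₂ ^ 2 * R ^ 4 := le_trans (by gcongr) h2'
    rw [div_mul_eq_mul_div, le_div_iff₀ (by positivity)]
    refine le_of_mul_le_mul_right ?_ (by positivity : 0 < R ^ 3)
    linarith

/-! ### Scaling of the constants with `ρ` and the balanced choice of `β₀` -/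

namespace Problem

variable {d n m : ℕ} {P : Problem d n m} {c : Constants d} {s : Setup d n m}

theorem Assumptions.of_le (h : P.Assumptions c) {ρ : ℝ} (hρ : c.ρ ≤ ρ) :
    P.Assumptions { c with ρ := ρ } :=
  { h with
    rho_pos := h.rho_pos.trans_le hρ
    weaklyConvex := by
      have hq : ConvexOn ℝ P.X (fun u => (ρ - c.ρ) / 2 * ‖u‖ ^ 2) := by
        have h1 : ConvexOn ℝ P.X (fun u : Vec d => ‖u‖ ^ 2) :=
          (convexOn_univ_norm.pow (fun _ _ => norm_nonneg _) 2).subset (subset_univ _) h.convex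
        exact h1.smul (by linarith : 0 ≤ (ρ - c.ρ) / 2)
      refine (h.weaklyConvex.add hq).congr fun u _ => ?_
      simp only [Pi.add_apply]
      ring }

theorem ValidSetup.with_beta (hs : P.ValidSetup s) {β : ℝ} (hβ : 0 < β) :
    P.ValidSetup { s with β0 := β } :=
  { hs with β0_pos := hβ }

section Scaling

variable {R : ℝ}

/-- This constant is affine in `ρ` with nonnegative coefficients, `τ` being independent of `ρ`. The
other scaling bounds rest on the same fact. -/
theorem Bbar_scale_le (hd : 0 < d) (hm : 0 < m) (h : P.Assumptions c) (hR : 1 ≤ R) :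
    P.Bbar { c with ρ := R * c.ρ } ≤ R * P.Bbar c := by
  have hD := (h.diam_pos hd).le
  have ht := (h.tau_pos hd hm).le
  have hρ := h.rho_pos
  have hr := h.rh_pos
  have hB := h.Bf_nonneg
  have e : R * P.Bbar c - P.Bbar { c with ρ := R * c.ρ }
      = (R - 1) * (P.diam * (c.rh + c.Bf) + P.diam + P.tau c * (1 + c.rh + c.Bf)) := by
    simp only [Bbar, tau, gmin, distBd]
    ring
  have : 0 ≤ (R - 1) * (P.diam * (c.rh + c.Bf) + P.diam + P.tau c * (1 + c.rh + c.Bf)) :=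
    mul_nonneg (by linarith) (by positivity)
  linarith

theorem le_Bbar_scale (hd : 0 < d) (hm : 0 < m) (h : P.Assumptions c) (hR : 0 ≤ R) :
    2 * c.ρ * P.diam ^ 2 * R ≤ P.Bbar { c with ρ := R * c.ρ } := by
  have hD := (h.diam_pos hd).le
  have ht := (h.tau_pos hd hm).le
  have hρ := h.rho_pos
  have hr := h.rh_pos
  have hB := h.Bf_nonneg
  have e : P.Bbar { c with ρ := R * c.ρ } = 2 * c.ρ * P.diam ^ 2 * R + (P.diam * (c.rh + c.Bf)
      + P.diam + P.tau c * (1 + c.rh + c.Bf + 2 * (R * c.ρ) * P.diam)) := by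
    simp only [Bbar, tau, gmin, distBd]
    ring
  rw [e]
  exact le_add_of_nonneg_right (by positivity)

theorem Bp_scale_le (hd : 0 < d) (hm : 0 < m) (h : P.Assumptions c) (s : Setup d n m)
    (hR : 1 ≤ R) : P.Bp { c with ρ := R * c.ρ } s ≤ R * P.Bp c s := by
  have hB := h.Bp_pos hd hm s
  refine max_le ?_ ?_
  · exact (le_max_left _ _ : _ ≤ P.Bp c s).trans (le_mul_of_one_le_left hB.le hR)
  · have h1 : P.theta { c with ρ := R * c.ρ } ≤ R * P.theta c := by
      have e : P.thetaDen { c with ρ := R * c.ρ } = P.thetaDen c := rfl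
      unfold theta
      rw [e, ← mul_div_assoc]
      exact div_le_div_of_nonneg_right (Bbar_scale_le hd hm h hR) (h.thetaDen_pos hd hm).le
    exact h1.trans (mul_le_mul_of_nonneg_left (le_max_right _ _) (by linarith))

/-- The term `2ρD²` makes `θ` grow at least linearly in `ρ`. This lower bound is what pins `β₀` to
the order `R`. -/
theorem le_Bp_scale (hd : 0 < d) (hm : 0 < m) (h : P.Assumptions c) (s : Setup d n m)
    (hR : 0 ≤ R) :
    2 * c.ρ * P.diam ^ 2 / P.thetaDen c * R ≤ P.Bp { c with ρ := R * c.ρ } s := by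
  refine le_trans ?_ (le_max_right _ _)
  have e : P.thetaDen { c with ρ := R * c.ρ } = P.thetaDen c := rfl
  unfold theta
  rw [e, div_mul_eq_mul_div]
  exact div_le_div_of_nonneg_right (le_Bbar_scale hd hm h hR) (h.thetaDen_pos hd hm).le

theorem Q_nonneg (hd : 0 < d) (h : P.Assumptions c) : 0 ≤ P.Q c := by
  have hD := (h.diam_pos hd).le
  have hρ := h.rho_pos
  have hr := h.rh_pos
  have hB := h.Bf_nonneg
  unfold Q
  positivity

theorem Q_scale_le (hd : 0 < d) (h : P.Assumptions c) (hR : 1 ≤ R) :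
    P.Q { c with ρ := R * c.ρ } ≤ R * P.Q c := by
  have hD := (h.diam_pos hd).le
  have hr := h.rh_pos
  have hB := h.Bf_nonneg
  have e : R * P.Q c - P.Q { c with ρ := R * c.ρ } = (R - 1) * (P.diam * (c.Bf + c.rh)) := by
    simp only [Q]
    ring
  have : 0 ≤ (R - 1) * (P.diam * (c.Bf + c.rh)) := mul_nonneg (by linarith) (by positivity)
  linarith

theorem Cp_scale_le (hd : 0 < d) (hm : 0 < m) (h : P.Assumptions c) (s : Setup d n m)
    (hR : 1 ≤ R) : P.Cp { c with ρ := R * c.ρ } s ≤ R * P.Cp c s := by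
  have hB := Bp_scale_le hd hm h s hR
  have hQ := pow_le_pow_left₀ (Q_nonneg hd (h.of_le (le_mul_of_one_le_left h.rho_pos.le hR)))
    (Q_scale_le hd h hR) 2
  have e1 : P.gmin { c with ρ := R * c.ρ } = P.gmin c := rfl
  have e2 : P.C1 { c with ρ := R * c.ρ } = P.C1 c := rfl
  unfold Cp Chatp
  rw [e1, e2]
  have h1 : √(P.Q { c with ρ := R * c.ρ } ^ 2 / P.gmin c ^ 2 + P.Q { c with ρ := R * c.ρ } ^ 2
      * ‖pinv (P.A * P.A.transpose) * P.A‖ ^ 2 * P.C1 c ^ 2)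
      ≤ R * √(P.Q c ^ 2 / P.gmin c ^ 2
        + P.Q c ^ 2 * ‖pinv (P.A * P.A.transpose) * P.A‖ ^ 2 * P.C1 c ^ 2) := by
    refine Real.sqrt_le_iff.2 ⟨by positivity, ?_⟩
    rw [mul_pow, Real.sq_sqrt (by positivity)]
    calc _ ≤ (R * P.Q c) ^ 2 / P.gmin c ^ 2 + (R * P.Q c) ^ 2
          * ‖pinv (P.A * P.A.transpose) * P.A‖ ^ 2 * P.C1 c ^ 2 := by gcongr
      _ = _ := by ring
  linarith

theorem C3_scale_le (hd : 0 < d) (hm : 0 < m) (h : P.Assumptions c) (s : Setup d n m)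
    (hR : 1 ≤ R) : P.C3 { c with ρ := R * c.ρ } s ≤ R * P.C3 c s := by
  have hB := Bp_scale_le hd hm h s hR
  have hg := h.Lg_nonneg hd hm
  have hf : c.Lf ≤ R * c.Lf := le_mul_of_one_le_left (h.Lf_nonneg hd) hR
  have := mul_le_mul_of_nonneg_left hB (by positivity : 0 ≤ √(m : ℝ) * c.Lg)
  simp only [C3]
  linarith

/-- Growth of `Cx` in `ρ` and `β₀`. -/
theorem exists_Cx_scale_le (hd : 0 < d) (hm : 0 < m) (h : P.Assumptions c)
    (hs : P.ValidSetup s) : ∃ e : ℝ, 0 < e ∧ ∀ R : ℝ, 1 ≤ R → ∀ β : ℝ, 0 < β →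
      P.Cx { c with ρ := R * c.ρ } { s with β0 := β } ≤ e * (1 + R ^ 2 / β + β) := by
  have hB0 := h.Bp_pos hd hm s
  have hC0 : 0 < P.Cp c s := by linarith [Assumptions.four_mul_Bp_add_two_le P c s]
  have hv := hs.v0_pos
  have hF := sSup_abs_F_nonneg h
  obtain ⟨a, ha⟩ : ∃ a, a = 2 * sSup ((fun x => |P.F x|) '' P.X) + |⟪s.y0, P.res s.x0⟫| := ⟨_, rfl⟩
  obtain ⟨x, hx⟩ : ∃ x, x = (14 * P.Cp c s ^ 2 + 8 * P.Bp c s * P.Cp c s + 7 * P.Bp c s ^ 2) / 4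
    + (10 * P.Cp c s + 4 * P.Bp c s) * s.v0 + ‖s.z0‖ ^ 2 := ⟨_, rfl⟩
  obtain ⟨b, hb⟩ : ∃ b, b = ‖P.res s.x0‖ ^ 2 / 2 + ‖P.gvec s.x0‖ ^ 2 := ⟨_, rfl⟩
  have ha0 : 0 ≤ a := by rw [ha]; positivity
  have hx0 : 0 < x := by rw [hx]; positivity
  have hb0 : 0 ≤ b := by rw [hb]; positivity
  refine ⟨a + x + b, by positivity, fun R hR β hβ => ?_⟩
  have hR0 : 0 < R := by linarith
  have h' := h.of_le (le_mul_of_one_le_left h.rho_pos.le hR)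
  have hB' := h'.Bp_pos hd hm s
  have hC' : 0 < P.Cp { c with ρ := R * c.ρ } s := by
    linarith [Assumptions.four_mul_Bp_add_two_le P { c with ρ := R * c.ρ } s]
  have hB := Bp_scale_le hd hm h s hR
  have hC := Cp_scale_le hd hm h s hR
  have eB : P.Bp { c with ρ := R * c.ρ } { s with β0 := β } = P.Bp { c with ρ := R * c.ρ } s := rfl
  have eC : P.Cp { c with ρ := R * c.ρ } { s with β0 := β } = P.Cp { c with ρ := R * c.ρ } s := rfl
  have t1 : 1 / (4 * β) * (14 * P.Cp { c with ρ := R * c.ρ } s ^ 2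
      + 8 * P.Bp { c with ρ := R * c.ρ } s * P.Cp { c with ρ := R * c.ρ } s
      + 7 * P.Bp { c with ρ := R * c.ρ } s ^ 2)
      ≤ (14 * P.Cp c s ^ 2 + 8 * P.Bp c s * P.Cp c s + 7 * P.Bp c s ^ 2) / 4 * (R ^ 2 / β) := by
    calc _ ≤ 1 / (4 * β) * (14 * (R * P.Cp c s) ^ 2 + 8 * (R * P.Bp c s) * (R * P.Cp c s)
          + 7 * (R * P.Bp c s) ^ 2) := by gcongr
      _ = _ := by field_simp
  have t2 : (10 * P.Cp { c with ρ := R * c.ρ } s + 4 * P.Bp { c with ρ := R * c.ρ } s) * (s.v0 / β)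
      ≤ (10 * P.Cp c s + 4 * P.Bp c s) * s.v0 * (R ^ 2 / β) := by
    have hRR : R ≤ R ^ 2 := le_self_pow₀ hR (by norm_num)
    calc _ ≤ (10 * (R * P.Cp c s) + 4 * (R * P.Bp c s)) * (s.v0 / β) := by gcongr
      _ = R * ((10 * P.Cp c s + 4 * P.Bp c s) * (s.v0 / β)) := by ring
      _ ≤ R ^ 2 * ((10 * P.Cp c s + 4 * P.Bp c s) * (s.v0 / β)) := by gcongr
      _ = _ := by ring
  have t3 : β / 2 * (‖P.res s.x0‖ ^ 2 + ‖posVec (P.gvec s.x0 + (1 / β) • s.z0)‖ ^ 2)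
      ≤ b * β + ‖s.z0‖ ^ 2 * (R ^ 2 / β) := by
    have h1 : ‖posVec (P.gvec s.x0 + (1 / β) • s.z0)‖ ^ 2
        ≤ 2 * ‖P.gvec s.x0‖ ^ 2 + 2 * (‖s.z0‖ / β) ^ 2 := by
      have h2 : ‖posVec (P.gvec s.x0 + (1 / β) • s.z0)‖ ≤ ‖P.gvec s.x0‖ + ‖s.z0‖ / β := by
        refine (norm_posVec_le _).trans ((norm_add_le _ _).trans ?_)
        rw [norm_smul, Real.norm_of_nonneg (by positivity), one_div_mul_eq_div]
      have h3 := pow_le_pow_left₀ (norm_nonneg _) h2 2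
      linarith [sq_nonneg (‖P.gvec s.x0‖ - ‖s.z0‖ / β)]
    have hR2 : 1 ≤ R ^ 2 := one_le_pow₀ hR
    calc _ ≤ β / 2 * (‖P.res s.x0‖ ^ 2 + (2 * ‖P.gvec s.x0‖ ^ 2 + 2 * (‖s.z0‖ / β) ^ 2)) := by
          gcongr
      _ = b * β + ‖s.z0‖ ^ 2 * (1 / β) := by rw [hb]; field_simp; ring
      _ ≤ _ := by gcongr
  have hp : 0 ≤ R ^ 2 / β := by positivity
  unfold Cx
  rw [eB, eC]
  calc _ ≤ a + x * (R ^ 2 / β) + b * β := by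
        rw [ha, hx]
        linarith
    _ ≤ _ := by linarith [mul_nonneg ha0 hp, mul_nonneg ha0 hβ.le, mul_nonneg hx0.le hβ.le,
        mul_nonneg hb0 hp]

end Scaling

theorem continuousOn_Cx (P : Problem d n m) (c : Constants d) (s : Setup d n m) :
    ContinuousOn (fun β => P.Cx c { s with β0 := β }) (Ioi 0) := by
  have hne : ∀ β ∈ Ioi (0 : ℝ), β ≠ 0 := fun β hβ => (mem_Ioi.1 hβ).ne'
  have hne4 : ∀ β ∈ Ioi (0 : ℝ), 4 * β ≠ 0 := fun β hβ => by simpa using hne β hβ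
  have hp : ContinuousOn (fun β : ℝ => ‖posVec (P.gvec s.x0 + (1 / β) • s.z0)‖ ^ 2) (Ioi 0) :=
    (continuous_posVec.comp_continuousOn (continuousOn_const.add
      ((continuousOn_const.div continuousOn_id hne).smul continuousOn_const))).norm.pow 2
  have h1 : ContinuousOn (fun β : ℝ => 1 / (4 * β)) (Ioi 0) :=
    continuousOn_const.div (continuousOn_const.mul continuousOn_id) hne4
  have h2 : ContinuousOn (fun β : ℝ => s.v0 / β) (Ioi 0) :=
    continuousOn_const.div continuousOn_id hne
  have h3 : ContinuousOn (fun β : ℝ => β / 2) (Ioi 0) := continuousOn_id.div_const 2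
  exact ((((continuousOn_const (c := 2 * sSup ((fun x => |P.F x|) '' P.X))).add
    (h1.mul (continuousOn_const (c := 14 * P.Cp c s ^ 2 + 8 * P.Bp c s * P.Cp c s
      + 7 * P.Bp c s ^ 2)))).add
    ((continuousOn_const (c := 10 * P.Cp c s + 4 * P.Bp c s)).mul h2)).add
    (h3.mul ((continuousOn_const (c := ‖P.res s.x0‖ ^ 2)).add hp))).add
    (continuousOn_const (c := |⟪s.y0, P.res s.x0⟫|))

/-- The equation that balances the two parts of `K` is solvable. -/
theorem exists_balanced_beta (hd : 0 < d) (hm : 0 < m) (h : P.Assumptions c)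
    (hs : P.ValidSetup s) : ∃ β : ℝ, 0 < β ∧
      β = (P.Bp c s + P.Cp c s + P.Cp c s ^ 2) / √(P.Cx c { s with β0 := β } * c.ρ) := by
  have hB := h.Bp_pos hd hm s
  have hC : 0 < P.Cp c s := by linarith [Assumptions.four_mul_Bp_add_two_le P c s]
  have hρ := h.rho_pos
  obtain ⟨N, hN⟩ : ∃ N, N = P.Bp c s + P.Cp c s + P.Cp c s ^ 2 := ⟨_, rfl⟩
  have hN0 : 0 < N := by rw [hN]; positivity
  obtain ⟨e, he, hX⟩ := exists_Cx_scale_le hd hm h hs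
  have hup : ∀ β : ℝ, 0 < β → P.Cx c { s with β0 := β } ≤ e * (1 + 1 / β + β) := by
    intro β hβ
    simpa using hX 1 le_rfl β hβ
  have hlow : ∀ β : ℝ, 0 < β → 56 * P.Bp c s ^ 2 / β ≤ P.Cx c { s with β0 := β } := by
    intro β hβ
    have h1 := Cx_lower hd hm h (hs.with_beta hβ)
    have h2 := sSup_abs_F_nonneg h
    have e1 : P.Bp c { s with β0 := β } = P.Bp c s := rfl
    rw [e1] at h1
    have h3 := hs.v0_pos
    have h4 : 0 ≤ 40 * P.Bp c s * (s.v0 / β) + 14 / β := by positivity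
    refine le_trans ?_ h1
    rw [mul_div_assoc]
    linarith
  have hcont : ContinuousOn (fun β => β * √(P.Cx c { s with β0 := β } * c.ρ)) (Ioi 0) :=
    continuousOn_id.mul ((continuousOn_Cx P c s).mul continuousOn_const).sqrt
  -- Intermediate value theorem for `β √(C_x(β) ρ)`: since `C_x ≤ e (1 + 1/β + β)` it is at most `N`
  -- at a small `β₁`, and since `C_x ≥ 56 B_p²/β` it is at least `N` at `β₂`.
  obtain ⟨β₁, hβ₁⟩ : ∃ β₁, β₁ = min 1 (N ^ 2 / (3 * e * c.ρ)) := ⟨_, rfl⟩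
  obtain ⟨β₂, hβ₂⟩ : ∃ β₂, β₂ = N ^ 2 / (56 * P.Bp c s ^ 2 * c.ρ) := ⟨_, rfl⟩
  have h1 : 0 < β₁ := by rw [hβ₁]; exact lt_min one_pos (by positivity)
  have h2 : 0 < β₂ := by rw [hβ₂]; positivity
  have hle : β₁ * √(P.Cx c { s with β0 := β₁ } * c.ρ) ≤ N := by
    have h3 : β₁ ≤ 1 := hβ₁ ▸ min_le_left _ _
    have h4 : β₁ * (3 * e * c.ρ) ≤ N ^ 2 := by
      rw [← le_div_iff₀ (by positivity)]
      exact hβ₁ ▸ min_le_right _ _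
    refine abs_le_of_sq_le_sq' ?_ hN0.le |>.2
    rw [mul_pow, Real.sq_sqrt (mul_nonneg (le_trans (by positivity) (hlow _ h1)) hρ.le)]
    calc _ ≤ β₁ ^ 2 * (e * (1 + 1 / β₁ + β₁) * c.ρ) := by
          have := hup _ h1
          gcongr
      _ = β₁ * (e * c.ρ) * (β₁ + 1 + β₁ * β₁) := by field_simp
      _ ≤ β₁ * (e * c.ρ) * 3 := by
          have : β₁ * β₁ ≤ 1 := mul_le_one₀ h3 h1.le h3
          gcongr
          linarith
      _ ≤ _ := by linarith
  have hge : N ≤ β₂ * √(P.Cx c { s with β0 := β₂ } * c.ρ) := by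
    refine abs_le_of_sq_le_sq' ?_ (by positivity) |>.2
    rw [mul_pow, Real.sq_sqrt (mul_nonneg (le_trans (by positivity) (hlow _ h2)) hρ.le)]
    calc N ^ 2 = β₂ * (56 * P.Bp c s ^ 2 * c.ρ) := by rw [hβ₂]; field_simp
      _ = β₂ ^ 2 * (56 * P.Bp c s ^ 2 / β₂ * c.ρ) := by field_simp
      _ ≤ _ := by
          have := hlow _ h2
          gcongr
  have hsub : uIcc β₁ β₂ ⊆ Ioi 0 := fun β hβ => (lt_min h1 h2).trans_le hβ.1
  obtain ⟨β, hβ, hβN⟩ := intermediate_value_uIcc (hcont.mono hsub) (Icc_subset_uIcc ⟨hle, hge⟩)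
  have hβ0 : 0 < β := hsub hβ
  refine ⟨β, hβ0, ?_⟩
  have hX0 := Cx_pos hd hm h (hs.with_beta hβ0)
  rw [← hN, eq_div_iff (by positivity)]
  exact hβN

/-- The order of the bound in `ρ`. -/
theorem exists_totalBound_le_rho (hd : 0 < d) (hm : 0 < m) (h : P.Assumptions c)
    (hs : P.ValidSetup s) {κ₁ κ₂ : ℝ} (hκ₁ : 0 < κ₁) :
    ∃ C : ℝ, ∀ ρ : ℝ, c.ρ ≤ ρ → ∀ β : ℝ, 0 < β →
      κ₁ * ((P.Bp { c with ρ := ρ } s + P.Cp { c with ρ := ρ } s + P.Cp { c with ρ := ρ } s ^ 2)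
        / √(P.Cx { c with ρ := ρ } { s with β0 := β } * ρ)) ≤ β →
      β ≤ κ₂ * ((P.Bp { c with ρ := ρ } s + P.Cp { c with ρ := ρ } s
        + P.Cp { c with ρ := ρ } s ^ 2) / √(P.Cx { c with ρ := ρ } { s with β0 := β } * ρ)) →
      ∀ ε : ℝ, 0 < ε → ε ≤ 1 / 2 → P.totalBound { c with ρ := ρ } { s with β0 := β } ε
        ≤ C * √ρ * (1 + ρ ^ 3) * ε ^ (-(5 / 2) : ℝ) * Real.log (1 / ε) := by
  have hB := h.Bp_pos hd hm s
  have hCB := Assumptions.four_mul_Bp_add_two_le P c s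
  have hC : 0 < P.Cp c s := by linarith
  have hρ := h.rho_pos
  have hD := h.diam_pos hd
  have hT := h.thetaDen_pos hd hm
  have hC2 := h.C2_nonneg hd hm
  have hC3 : 0 ≤ P.C3 c s := hρ.le.trans (h.rho_le_C3 hd hm s)
  obtain ⟨e, he, hX⟩ := exists_Cx_scale_le hd hm h hs
  obtain ⟨b₁, hb₁⟩ : ∃ b₁, b₁ = 2 * c.ρ * P.diam ^ 2 / P.thetaDen c := ⟨_, rfl⟩
  have hb₁0 : 0 < b₁ := by rw [hb₁]; positivity
  obtain ⟨n₂, hn₂⟩ : ∃ n₂, n₂ = P.Bp c s + P.Cp c s + P.Cp c s ^ 2 := ⟨_, rfl⟩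
  -- The numbers `l`, `u`, `w` are those of `bounds_of_balance`: `l R ≤ β ≤ u R` and `C_x ≤ w R`.
  -- The input `16 b₁²` comes from `C_p ≥ 4 B_p ≥ 4 b₁ R`, and `56 b₁²` from `Cx_lower`.
  obtain ⟨l, hl⟩ : ∃ l, l = min 1 (κ₁ ^ 2 * (16 * b₁ ^ 2) ^ 2 / (3 * e * c.ρ)) := ⟨_, rfl⟩
  have hl0 : 0 < l := by rw [hl]; exact lt_min one_pos (by positivity)
  obtain ⟨u, hu⟩ : ∃ u, u = κ₂ ^ 2 * n₂ ^ 2 / (56 * b₁ ^ 2 * c.ρ) := ⟨_, rfl⟩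
  have hu0 : 0 ≤ u := by rw [hu]; positivity
  obtain ⟨w, hw⟩ : ∃ w, w = κ₂ ^ 2 * n₂ ^ 2 / (l ^ 2 * c.ρ) := ⟨_, rfl⟩
  have hw0 : 0 ≤ w := by rw [hw]; positivity
  obtain ⟨a, ha⟩ : ∃ a, a = P.Cp c s ^ 2 / l ^ 2
    + (4 * P.Bp c s + 5 * P.Cp c s ^ 2) ^ 2 / (16 * l ^ 2) := ⟨_, rfl⟩
  have ha0 : 0 ≤ a := by rw [ha]; positivity
  obtain ⟨M, hM⟩ : ∃ M, M = a + 5 * w * c.ρ + 2 + P.C3 c s + P.C3 c s / c.ρ + P.C2 c + u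
    + u / c.ρ + 1 / c.ρ + P.diam := ⟨_, rfl⟩
  have k1 : 0 ≤ 5 * w * c.ρ := by positivity
  have k2 : 0 ≤ P.C3 c s / c.ρ := by positivity
  have k3 : 0 ≤ u / c.ρ := by positivity
  have k4 : 0 ≤ 1 / c.ρ := by positivity
  have hM1 : 1 ≤ M := by linarith
  refine ⟨orderConst M * (1 / √c.ρ * (1 / c.ρ ^ 2 + 1 / c.ρ ^ 3)),
    fun ρ hρρ β hβ hlo hhi ε hε hε2 => ?_⟩
  obtain ⟨R, hR⟩ : ∃ R, R = ρ / c.ρ := ⟨_, rfl⟩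
  have hR1 : 1 ≤ R := by rw [hR, one_le_div hρ]; exact hρρ
  have hR0 : 0 < R := by linarith
  obtain rfl : ρ = R * c.ρ := by rw [hR, div_mul_cancel₀ _ hρ.ne']
  clear hR
  have h' := h.of_le hρρ
  have hs' := hs.with_beta hβ
  have hX0 := Cx_pos hd hm h' hs'
  have hBu := Bp_scale_le hd hm h s hR1
  have hBl := le_Bp_scale hd hm h s hR0.le
  rw [← hb₁] at hBl
  have hCu := Cp_scale_le hd hm h s hR1
  have hCl := Assumptions.four_mul_Bp_add_two_le P { c with ρ := R * c.ρ } s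
  have hB'0 : 0 < P.Bp { c with ρ := R * c.ρ } s := lt_of_lt_of_le (by positivity) hBl
  have hC'0 : 0 < P.Cp { c with ρ := R * c.ρ } s := by linarith
  have hC'l : 4 * (b₁ * R) ≤ P.Cp { c with ρ := R * c.ρ } s := by linarith
  have hRR : R ≤ R ^ 2 := le_self_pow₀ hR1 (by norm_num)
  have hN2 : P.Bp { c with ρ := R * c.ρ } s + P.Cp { c with ρ := R * c.ρ } s
      + P.Cp { c with ρ := R * c.ρ } s ^ 2 ≤ n₂ * R ^ 2 := by
    have h1 := pow_le_pow_left₀ hC'0.le hCu 2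
    have h2 := mul_le_mul_of_nonneg_right hRR hB.le
    have h3 := mul_le_mul_of_nonneg_right hRR hC.le
    rw [hn₂]
    linarith
  have hN1 : 16 * b₁ ^ 2 * R ^ 2 ≤ P.Bp { c with ρ := R * c.ρ } s
      + P.Cp { c with ρ := R * c.ρ } s + P.Cp { c with ρ := R * c.ρ } s ^ 2 := by
    have h1 := pow_le_pow_left₀ (by positivity) hC'l 2
    linarith
  have hX1 : 56 * b₁ ^ 2 * R ^ 2 / β ≤ P.Cx { c with ρ := R * c.ρ } { s with β0 := β } := by
    have h1 := Cx_lower hd hm h' hs'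
    have h2 := sSup_abs_F_nonneg h
    have e1 : P.Bp { c with ρ := R * c.ρ } { s with β0 := β }
      = P.Bp { c with ρ := R * c.ρ } s := rfl
    rw [e1] at h1
    have h3 := hs.v0_pos
    have h4 : 0 ≤ 40 * P.Bp { c with ρ := R * c.ρ } s * (s.v0 / β) + 14 / β := by positivity
    have h5 : 56 * b₁ ^ 2 * R ^ 2 / β ≤ 56 * (P.Bp { c with ρ := R * c.ρ } s ^ 2 / β) := by
      calc 56 * b₁ ^ 2 * R ^ 2 / β = 56 * ((b₁ * R) ^ 2 / β) := by ring
        _ ≤ _ := by gcongr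
    refine h5.trans (le_trans ?_ h1)
    linarith
  have hsq : 0 < √(P.Cx { c with ρ := R * c.ρ } { s with β0 := β } * (R * c.ρ)) :=
    Real.sqrt_pos.2 (by positivity)
  rw [← mul_div_assoc, div_le_iff₀ hsq] at hlo
  rw [← mul_div_assoc, le_div_iff₀ hsq] at hhi
  have hlo2 := pow_le_pow_left₀ (by positivity) hlo 2
  have hhi2 := pow_le_pow_left₀ (by positivity) hhi 2
  rw [mul_pow β, Real.sq_sqrt (by positivity)] at hlo2 hhi2
  obtain ⟨q1, q2, q3⟩ := bounds_of_balance hρ hR1 hβ he (by positivity : 0 < 56 * b₁ ^ 2)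
    (by positivity : 0 < 16 * b₁ ^ 2) hκ₁ hN1 hN2 hX1 (hX R hR1 β hβ) hlo2 hhi2
  rw [← hl] at q2
  rw [← hl, ← hw] at q3
  rw [← hu] at q1
  -- For `K₁` the numerators are of order at most `R⁴` and `β² ≥ (l R)²`; for `K₂`, `C_x ρ ≤ w R · R
  -- ρ₀`. Both are of order `R²`.
  have hK : (P.K { c with ρ := R * c.ρ } { s with β0 := β } ε : ℝ) ≤ M * R ^ 2 / ε ^ 2 := by
    have hR2 : 1 ≤ R ^ 2 := one_le_pow₀ hR1
    have h1 : max (P.Cp { c with ρ := R * c.ρ } { s with β0 := β } ^ 2 / β ^ 2)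
        ((4 * P.Bp { c with ρ := R * c.ρ } { s with β0 := β }
          + 5 * P.Cp { c with ρ := R * c.ρ } { s with β0 := β } ^ 2) ^ 2 / (16 * β ^ 2))
        ≤ a * R ^ 2 := by
      refine max_le ?_ ?_
      · calc P.Cp { c with ρ := R * c.ρ } s ^ 2 / β ^ 2
            ≤ (R * P.Cp c s) ^ 2 / (l * R) ^ 2 := by gcongr
          _ = P.Cp c s ^ 2 / l ^ 2 := by field_simp
          _ ≤ a := by rw [ha]; exact le_add_of_nonneg_right (by positivity)
          _ ≤ _ := le_mul_of_one_le_right ha0 hR2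
      · calc (4 * P.Bp { c with ρ := R * c.ρ } s + 5 * P.Cp { c with ρ := R * c.ρ } s ^ 2) ^ 2
              / (16 * β ^ 2)
            ≤ (4 * (R * P.Bp c s) + 5 * (R * P.Cp c s) ^ 2) ^ 2 / (16 * (l * R) ^ 2) := by gcongr
          _ ≤ (4 * (R ^ 2 * P.Bp c s) + 5 * (R * P.Cp c s) ^ 2) ^ 2 / (16 * (l * R) ^ 2) := by
              gcongr
          _ = (4 * P.Bp c s + 5 * P.Cp c s ^ 2) ^ 2 / (16 * l ^ 2) * R ^ 2 := by field_simp
          _ ≤ _ := by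
              rw [ha]
              gcongr
              exact le_add_of_nonneg_left (by positivity)
    have h2 : 5 * P.Cx { c with ρ := R * c.ρ } { s with β0 := β } * (R * c.ρ)
        ≤ 5 * w * c.ρ * R ^ 2 := by
      calc _ ≤ 5 * (w * R) * (R * c.ρ) := by gcongr
        _ = _ := by ring
    refine (K_le_of_bounds hε (by linarith) h1 h2 hX0.le h'.rho_pos.le).trans ?_
    refine div_le_div_of_nonneg_right ?_ (by positivity)
    calc _ ≤ (a + 5 * w * c.ρ + 2) * R ^ 2 := by linarith
      _ ≤ _ := by
          gcongr
          linarith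
  have hC3u : P.C3 { c with ρ := R * c.ρ } { s with β0 := β } ≤ R * P.C3 c s :=
    C3_scale_le hd hm h s hR1
  have hRM : ∀ x : ℝ, x ≤ M → x * R ≤ M * R := fun x hx => by gcongr
  have hfin := totalBound_le_of_bounds (P := P) (c := { c with ρ := R * c.ρ })
    (s := { s with β0 := β }) hM1 hR1 hε hε2 h'.rho_pos hβ
    (h'.rho_pos.le.trans (h'.rho_le_C3 hd hm _)) hC2 hD.le hK
    (hC3u.trans (by rw [mul_comm]; exact hRM _ (by linarith)))
    ((div_le_div_of_nonneg_right hC3u h'.rho_pos.le).trans (by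
      rw [mul_div_mul_left _ _ hR0.ne']; linarith))
    (show P.C2 c ≤ M by linarith) (q1.trans (hRM _ (by linarith)))
    ((div_le_div_of_nonneg_right q1 h'.rho_pos.le).trans (by
      rw [mul_comm R, mul_div_mul_right _ _ hR0.ne']; linarith))
    ((one_div_le_one_div_of_le hρ hρρ).trans (by linarith)) (by linarith)
  refine hfin.trans ?_
  have hlog : 0 ≤ Real.log (1 / ε) := by linarith [one_le_two_mul_log_inv hε hε2]
  have hO := orderConst_nonneg hM1
  refine mul_le_mul_of_nonneg_right (mul_le_mul_of_nonneg_right ?_ (by positivity)) hlog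
  rw [mul_assoc (orderConst M), mul_assoc (orderConst M)]
  refine mul_le_mul_of_nonneg_left ?_ hO
  have hsρ : √(R * c.ρ) = √R * √c.ρ := Real.sqrt_mul hR0.le _
  -- The powers `ρ²` and `ρ³` that come from `R² (1 + R)` are both at most `1 + ρ³`; the remaining
  -- `√R` is `√ρ/√ρ₀`.
  have hx2 : (R * c.ρ) ^ 2 ≤ 1 + (R * c.ρ) ^ 3 := by
    have hx0 : 0 < R * c.ρ := by positivity
    generalize R * c.ρ = x at hx0
    rcases le_total x 1 with hx | hx
    · exact (pow_le_one₀ hx0.le hx).trans (le_add_of_nonneg_right (by positivity))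
    · exact (pow_le_pow_right₀ hx (by norm_num)).trans (le_add_of_nonneg_left zero_le_one)
  calc R ^ 2 * √R * (1 + R)
      = √R * ((1 / c.ρ ^ 2) * (R * c.ρ) ^ 2 + (1 / c.ρ ^ 3) * (R * c.ρ) ^ 3) := by field_simp
    _ ≤ √R * ((1 / c.ρ ^ 2) * (1 + (R * c.ρ) ^ 3) + (1 / c.ρ ^ 3) * (1 + (R * c.ρ) ^ 3)) := by
        gcongr
        linarith
    _ = _ := by
        rw [hsρ]
        field_simp

end Problem

end DPALM

theorem mainTheorem2 {d n m : ℕ} (hd : 0 < d) (hm : 0 < m) (P : Problem d n m) (c : Constants d)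
    (hP : P.Assumptions c) (s : Setup d n m) (hs : P.ValidSetup s) :
    -- termination, correctness and the explicit bound on the number of proximal gradient steps
    (∀ (r : Subroutine d), P.ValidSubroutine c s r → ∀ ε : ℝ, 0 < ε →
      (∀ k, (P.call c s r ε k).Terminates) ∧
      (∃ k < P.K c s ε, P.IsKKT c.ρ ε (P.iterate c s r ε (k + 1)).x) ∧
      ((∑ k ∈ Finset.range (P.K c s ε), (P.call c s r ε k).numIter : ℕ) : ℝ)
        ≤ P.totalBound c s ε) ∧
    -- the bound is `Õ(ε^{-5/2})`
    (∃ C : ℝ, ∀ ε : ℝ, 0 < ε → ε ≤ 1 / 2 →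
      P.totalBound c s ε ≤ C * ε ^ (-(5 / 2) : ℝ) * Real.log (1 / ε)) ∧
    -- so is the number of proximal gradient steps if the rejected trial steps are counted
    (∀ γd Lmin : ℝ, 0 < Lmin → ∃ C : ℝ, ∀ (r : Subroutine d), P.ValidSubroutine c s r →
      r.γd = γd → (∀ k, Lmin ≤ r.L0 k) → ∀ ε : ℝ, 0 < ε → ε ≤ 1 / 2 →
      ((∑ k ∈ Finset.range (P.K c s ε), (P.call c s r ε k).numTrials : ℕ) : ℝ)
        ≤ C * ε ^ (-(5 / 2) : ℝ) * Real.log (1 / ε)) ∧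
    -- dependence on `ρ` with `β₀` of the order of `(B_p + C_p + C_p²) / √(C_x ρ)`
    (∀ ρ : ℝ, c.ρ ≤ ρ → ∃ β0 : ℝ, 0 < β0 ∧
      let c' := { c with ρ := ρ }
      let s' := { s with β0 := β0 }
      β0 = (P.Bp c' s' + P.Cp c' s' + P.Cp c' s' ^ 2) / √(P.Cx c' s' * ρ)) ∧
    (∀ κ₁ κ₂ : ℝ, 0 < κ₁ → κ₁ ≤ κ₂ → ∃ C : ℝ, ∀ ρ : ℝ, c.ρ ≤ ρ → ∀ β0 : ℝ, 0 < β0 →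
      let c' := { c with ρ := ρ }
      let s' := { s with β0 := β0 }
      let R := (P.Bp c' s' + P.Cp c' s' + P.Cp c' s' ^ 2) / √(P.Cx c' s' * ρ)
      κ₁ * R ≤ β0 → β0 ≤ κ₂ * R → ∀ ε : ℝ, 0 < ε → ε ≤ 1 / 2 →
      P.totalBound c' s' ε ≤ C * √ρ * (1 + ρ ^ 3) * ε ^ (-(5 / 2) : ℝ) * Real.log (1 / ε)) := by
  refine ⟨fun r hr ε hε => ⟨fun k => (Problem.regular_call hd hm hP hs hr hε k).terminates,
    Problem.exists_isKKT hd hm hP hs hr hε, Problem.sum_numIter_le hd hm hP hs hr hε⟩,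
    Problem.exists_totalBound_le hd hm hP hs, Problem.exists_numTrials_le hd hm hP hs, ?_, ?_⟩
  · intro ρ hρ
    -- A larger `ρ` is again a weak convexity constant, so the balance equation is solved for the
    -- data with that constant.
    exact Problem.exists_balanced_beta hd hm (hP.of_le hρ) hs
  · intro κ₁ κ₂ hκ₁ _
    exact Problem.exists_totalBound_le_rho hd hm hP hs hκ₁
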